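/- Let $M$ be a smooth $n$-dimensional manifold and $L:A\to\mathbb R$ a pseudo-Finsler metric on $M$: $A\subset TM\setminus\mathbf 0$ is open with $\pi(A)=M$ and $\lambda v\in A$ for $v\in A$, $\lambda>0$; $L$ is smooth, $L(\lambda v)=\lambda^2L(v)$ for $v\in A$, $\lambda>0$, and for every $v\in A$ the fundamental tensor $g_v(u,w)=\frac12\frac{\partial^2}{\partial t\,\partial s}L(v+tu+sw)|_{t=s=0}$ is nondegenerate. Let $\nabla^N$ be its Chern connection with reference field $N$ (with values in $A$), and $D^W_\gamma$ the induced covariant derivative along a curve $\gamma$ with reference field $W$. Let $a<b$ and let $\gamma:[a,b]\to M$ be a geodesic, i.e. a smooth curve with $\dot\gamma(t)\in A$ for all $t\in[a,b]$ and $D^{\dot\gamma}_\gamma\dot\gamma=0$. Write $V'=D^{\dot\gamma}_\gamma V$ for a smooth vector field $V$ along $\gamma$. For smooth vector fields $V,Z$ along $\gamma$ let $R^\gamma(\dot\gamma,V)Z=\big(D^{\Lambda_t}_{\gamma_s}D^{\Lambda_t}_{\beta_t}\tilde Z-D^{\Lambda_t}_{\beta_t}D^{\Lambda_t}_{\gamma_s}\tilde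 Z\big)\big|_{s=0}$, where $\Lambda(t,s)=\gamma_s(t)=\beta_t(s)$ is any smooth variation of $\gamma=\gamma_0$ with variational field $V$ and longitudinal velocities $\Lambda_t$ in $A$, and $\tilde Z$ is any extension of $Z$ to a smooth vector field along $\Lambda$ (the result does not depend on these choices). Let $P,Q\subset M$ be submanifolds with $\gamma(a)\in P$ and $\gamma(b)\in Q$, such that $\dot\gamma(a)$ is $g_{\dot\gamma(a)}$-orthogonal to $T_{\gamma(a)}P$, $\dot\gamma(b)$ is $g_{\dot\gamma(b)}$-orthogonal to $T_{\gamma(b)}Q$, and the restrictions of $g_{\dot\gamma(a)}$ to $T_{\gamma(a)}P$ and of $g_{\dot\gamma(b)}$ to $T_{\gamma(b)}Q$ are nondegenerate. For $p=\gamma(a)$, $v=\dot\gamma(a)$, let $\tan_{\dot\gamma}$ and $\mathrm{nor}_{\dot\gamma}$ be the projections of $T_pM$ onto $T_pP$ and onto its $g_v$-orthogonal complement, and for $u,w\in T_pP$ put $$S^P_v(u,w)=\mathrm{nor}_{\dot\gamma}\,\nabla^N_uW,\qquad \tilde S^P_v(u)=\tan_{\dot\gamma}\nabla^N_uN,$$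 where $W$ is any smooth vector field tangent to $P$ near $p$ with $W(p)=w$, and $N$ is any smooth section of $TM$ with values in $A$ over a neighbourhood of $p$ in $P$, with $N(p)=v$ and $N(q)$ being $g_{N(q)}$-orthogonal to $T_qP$ for all $q$ (the results do not depend on these choices). Define $S^Q$, $\tilde S^Q$ and the projections at $\gamma(b)$ likewise, with $\dot\gamma(b)$. Let $T_\gamma C_L(P,Q)$ be the space of smooth vector fields $V$ along $\gamma$ with $V(a)\in T_{\gamma(a)}P$ and $V(b)\in T_{\gamma(b)}Q$, and define the $(P,Q)$-index form of $\gamma$ on it by $$I^\gamma_{P,Q}(V,W)=\int_a^b\big(-g_{\dot\gamma}(R^\gamma(\dot\gamma,V)W,\dot\gamma)+g_{\dot\gamma}(V',W')\big)\,dt+g_{\dot\gamma(b)}\big(S^Q_{\dot\gamma(b)}(V(b),W(b)),\dot\gamma(b)\big)-g_{\dot\gamma(a)}\big(S^P_{\dot\gamma(a)}(V(a),W(a)),\dot\gamma(a)\big).$$ Then the kernel $\{V\in T_\gamma C_L(P,Q): I^\gamma_{P,Q}(V,W)=0\ \text{for all}\ W\in T_\gamma C_L(P,Q)\}$ consists exactly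 of the fields $V\in T_\gamma C_L(P,Q)$ satisfying $$V''=R^\gamma(\dot\gamma,V)\dot\gamma,\qquad \tan_{\dot\gamma}V'(a)=\tilde S^P_{\dot\gamma(a)}(V(a)),\qquad \tan_{\dot\gamma}V'(b)=\tilde S^Q_{\dot\gamma(b)}(V(b))$$ (the $(P,Q)$-Jacobi fields along $\gamma$). -/

import Mathlib

open Set Filter Topology
open scoped Manifold ContDiff

set_option maxSynthPendingDepth 3

noncomputable section

namespace PseudoFinsler

/-! ### Calculus in one chart

Here `E` is the model vector space and `ℓ x y` is the coordinate expression of a metric function: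
`x` is the base point and `y` the fibre coordinate of a tangent vector. -/

section Local

variable {E : Type*} [NormedAddCommGroup E] [NormedSpace ℝ E]

/-- For a function `f` on a vector space, the form
`(u, w) ↦ (1/2) ∂²/∂t∂s f (y + t u + s w)` at `t = s = 0`. -/
def fundForm (f : E → ℝ) (y : E) : E →L[ℝ] E →L[ℝ] ℝ :=
  (1 / 2 : ℝ) • fderiv ℝ (fderiv ℝ f) y

/-- The Cartan form `(w₁, w₂, w₃) ↦ (1/4) ∂³/∂s₃∂s₂∂s₁ f (y + s₁ w₁ + s₂ w₂ + s₃ w₃)` at `0`,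
that is, one half of the derivative of the fundamental form. -/
def cartanForm (f : E → ℝ) (y : E) : E →L[ℝ] E →L[ℝ] E →L[ℝ] ℝ :=
  (1 / 2 : ℝ) • fderiv ℝ (fundForm f) y

/-- The derivative `∂_X g (Y, Z)` of the fundamental form with respect to the base point, the
fibre coordinate being fixed. The first argument is the direction `X`. -/
def baseDeriv (ℓ : E → E → ℝ) (x y : E) : E →L[ℝ] E →L[ℝ] E →L[ℝ] ℝ :=
  fderiv ℝ (fun x' => fundForm (ℓ x') y) x

/-- The covector `Z ↦ (1/2) (T_X (Y, Z) + T_Y (X, Z) - T_Z (X, Y))`. -/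
def koszul (T : E →L[ℝ] E →L[ℝ] E →L[ℝ] ℝ) (X Y : E) : E →L[ℝ] ℝ :=
  (1 / 2 : ℝ) • (T X Y + T Y X - (T.flip X).flip Y)

/-- The formal Christoffel symbols
`γ^k_ij = (1/2) g^{kl} (∂_i g_jl + ∂_j g_il - ∂_l g_ij)`, evaluated on `X` and `Y`. -/
def formalChristoffel (ℓ : E → E → ℝ) (x y X Y : E) : E :=
  (fundForm (ℓ x) y).inverse (koszul (baseDeriv ℓ x y) X Y)

/-- The nonlinear connection `N^k_i = γ^k_ij y^j - C^k_il γ^l_rs y^r y^s`, as the linear map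
`X ↦ N X`. (The bracket is `koszul (baseDeriv ℓ x y) X y`, written as a linear map in `X` by means
of the symmetry of the fundamental form.) -/
def nonlinearConnection (ℓ : E → E → ℝ) (x y : E) : E →L[ℝ] E :=
  (fundForm (ℓ x) y).inverse ∘L
    ((1 / 2 : ℝ) • ((baseDeriv ℓ x y).flip y + baseDeriv ℓ x y y
        - ((baseDeriv ℓ x y).flip y).flip)
      - (cartanForm (ℓ x) y).flip (formalChristoffel ℓ x y y y))

/-- The horizontal derivative `δ_X g = ∂_X g - 2 C (N X, ·, ·)` of the fundamental form, where
`2 C` is the fibre derivative of the fundamental form. -/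
def horizontalDeriv (ℓ : E → E → ℝ) (x y : E) : E →L[ℝ] E →L[ℝ] E →L[ℝ] ℝ :=
  baseDeriv ℓ x y - (2 : ℝ) • (cartanForm (ℓ x) y).comp (nonlinearConnection ℓ x y)

/-- The Christoffel symbols of the Chern connection,
`Γ^k_ij = (1/2) g^{kl} (δ_i g_jl + δ_j g_il - δ_l g_ij)`, at the vector `y` over the point `x`,
evaluated on `X` and `Y`: the vector with components `Γ^k_ij (x, y) X^i Y^j`. -/
def christoffel (ℓ : E → E → ℝ) (x y X Y : E) : E :=
  (fundForm (ℓ x) y).inverse (koszul (horizontalDeriv ℓ x y) X Y)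

/-- For a two-parameter map `x (t, s)` in a chart and a vector field `z (t, s)` along it: the
covariant derivative of `z` along the longitudinal curve `t ↦ x (t, s)`, with reference vector the
longitudinal velocity `∂x/∂t`. The parameter `t` ranges over `S`. -/
def longCovDeriv (ℓ : E → E → ℝ) (S : Set ℝ) (x z : ℝ → ℝ → E) (t s : ℝ) : E :=
  derivWithin (fun τ => z τ s) S t
    + christoffel ℓ (x t s) (derivWithin (fun τ => x τ s) S t) (z t s)
        (derivWithin (fun τ => x τ s) S t)

/-- The covariant derivative of `z` along the transverse curve `s ↦ x (t, s)`, with reference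
vector the longitudinal velocity `∂x/∂t`. -/
def transCovDeriv (ℓ : E → E → ℝ) (S : Set ℝ) (x z : ℝ → ℝ → E) (t s : ℝ) : E :=
  deriv (fun σ => z t σ) s
    + christoffel ℓ (x t s) (derivWithin (fun τ => x τ s) S t) (z t s)
        (deriv (fun σ => x t σ) s)

/-- The curvature of a two-parameter map: the commutator of the longitudinal and the transverse
covariant derivatives, applied to the vector field `z`. -/
def variationCurvature (ℓ : E → E → ℝ) (S : Set ℝ) (x z : ℝ → ℝ → E) (t s : ℝ) : E :=
  longCovDeriv ℓ S x (transCovDeriv ℓ S x z) t s - transCovDeriv ℓ S x (longCovDeriv ℓ S x z) t s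

/-- The `B`-orthogonal projection of `v` to `T`: the vector `z` of `T` such that `v - z` is
`B`-orthogonal to `T` (unique when `B` is nondegenerate on `T`). -/
def tanProj (B : E →L[ℝ] E →L[ℝ] ℝ) (T : Submodule ℝ E) (v : E) : E :=
  open Classical in
  if h : ∃ z ∈ T, ∀ w ∈ T, B (v - z) w = 0 then h.choose else 0

/-- The component of `v` normal to `T`. -/
def norProj (B : E →L[ℝ] E →L[ℝ] ℝ) (T : Submodule ℝ E) (v : E) : E :=
  v - tanProj B T v

end Local

/-! ### Pseudo-Finsler metrics -/

/-- A (conic, two-homogeneous) pseudo-Finsler metric on the manifold `M`: a smooth function `L` on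
an open conic subset `dom` of the tangent bundle without its zero section that projects onto `M`;
`L` is positive-homogeneous of degree two and has nondegenerate fundamental tensor. The values of
`L` outside `dom` are irrelevant. -/
structure Metric (E M : Type*) [NormedAddCommGroup E] [NormedSpace ℝ E]
    [TopologicalSpace M] [ChartedSpace E M] [IsManifold 𝓘(ℝ, E) ∞ M] where
  dom : Set (TangentBundle 𝓘(ℝ, E) M)
  isOpen_dom : IsOpen dom
  ne_zero : ∀ z ∈ dom, z.2 ≠ 0
  proj_surj : ∀ p : M, ∃ v : TangentSpace 𝓘(ℝ, E) p, (⟨p, v⟩ : TangentBundle 𝓘(ℝ, E) M) ∈ dom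
  conic : ∀ z ∈ dom, ∀ c : ℝ, 0 < c → (⟨z.1, c • z.2⟩ : TangentBundle 𝓘(ℝ, E) M) ∈ dom
  L : TangentBundle 𝓘(ℝ, E) M → ℝ
  smooth : ContMDiffOn 𝓘(ℝ, E).tangent 𝓘(ℝ, ℝ) ∞ L dom
  homogeneous : ∀ z ∈ dom, ∀ c : ℝ, 0 < c →
    L (⟨z.1, c • z.2⟩ : TangentBundle 𝓘(ℝ, E) M) = c ^ 2 * L z
  nondegenerate : ∀ z ∈ dom, ∀ u : E,
    (∀ w : E, fundForm (fun y : E => L (⟨z.1, y⟩ : TangentBundle 𝓘(ℝ, E) M)) z.2 u w = 0) → u = 0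

/-- The subset `P` of `M`, with the subspace topology and a manifold structure modelled on `K`, is a
submanifold of `M`: the inclusion is a smooth immersion. -/
structure IsSubmanifold (E : Type*) {M : Type*} [NormedAddCommGroup E] [NormedSpace ℝ E]
    [TopologicalSpace M] [ChartedSpace E M]
    (K : Type*) [NormedAddCommGroup K] [NormedSpace ℝ K] (P : Set M) [ChartedSpace K P] :
    Prop where
  isManifold : IsManifold 𝓘(ℝ, K) ∞ P
  smooth : ContMDiff 𝓘(ℝ, K) 𝓘(ℝ, E) ∞ (Subtype.val : P → M)
  immersion : ∀ p : P, Function.Injective (mfderiv 𝓘(ℝ, K) 𝓘(ℝ, E) (Subtype.val : P → M) p)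

section Manifold

variable {E M : Type*} [NormedAddCommGroup E] [NormedSpace ℝ E]
  [TopologicalSpace M] [ChartedSpace E M] [IsManifold 𝓘(ℝ, E) ∞ M]

/-- The fibre coordinate of a tangent vector `z` in the chart of `TM` induced by the preferred
chart of `M` at `p`. On `T_p M` itself it is the identity of the model space. -/
def fibreCoord (p : M) (z : TangentBundle 𝓘(ℝ, E) M) : E :=
  (extChartAt 𝓘(ℝ, E).tangent (⟨p, 0⟩ : TangentBundle 𝓘(ℝ, E) M) z).2

/-- Smoothness on `S` of a vector field along a curve. -/
def IsSmoothFieldAlong (S : Set ℝ) (γ : ℝ → M) (V : (t : ℝ) → TangentSpace 𝓘(ℝ, E) (γ t)) : Prop :=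
  ContMDiffOn 𝓘(ℝ, ℝ) 𝓘(ℝ, E).tangent ∞
    (fun t => (⟨γ t, V t⟩ : TangentBundle 𝓘(ℝ, E) M)) S

/-- The velocity of a curve with parameter in `S` (one-sided at the endpoints of an interval). -/
def velocity (S : Set ℝ) (γ : ℝ → M) (t : ℝ) : TangentSpace 𝓘(ℝ, E) (γ t) :=
  mfderivWithin 𝓘(ℝ, ℝ) 𝓘(ℝ, E) γ S t (1 : ℝ)

namespace Metric

variable (F : Metric E M)

/-- The fundamental tensor `g_v` of the metric at `v ∈ T_p M`. -/
def g (p : M) (v : TangentSpace 𝓘(ℝ, E) p) : E →L[ℝ] E →L[ℝ] ℝ :=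
  fundForm (fun y : E => F.L (⟨p, y⟩ : TangentBundle 𝓘(ℝ, E) M)) v

/-- The metric function in the chart of `TM` induced by the preferred chart of `M` at `p`. -/
def localL (p : M) (x y : E) : ℝ :=
  F.L ((extChartAt 𝓘(ℝ, E).tangent (⟨p, 0⟩ : TangentBundle 𝓘(ℝ, E) M)).symm (x, y))

/-- The Christoffel symbols of the Chern connection at `v ∈ T_p M`, in the preferred chart at `p`,
evaluated on `X, Y ∈ T_p M`. -/
def Gam (p : M) (v X Y : E) : E :=
  christoffel (F.localL p) (extChartAt 𝓘(ℝ, E) p p) v X Y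

/-- The covariant derivative `D^W_γ X` along a curve `γ` with parameter in `S`, induced by the
Chern connection with reference field `W`; at the parameter `t` it is computed in the preferred
chart at `γ t`. -/
def covDeriv (S : Set ℝ) (γ : ℝ → M) (W X : (t : ℝ) → TangentSpace 𝓘(ℝ, E) (γ t)) (t : ℝ) :
    TangentSpace 𝓘(ℝ, E) (γ t) :=
  (derivWithin (fun s => fibreCoord (γ t) (⟨γ s, X s⟩ : TangentBundle 𝓘(ℝ, E) M)) S t
    + F.Gam (γ t) (W t) (X t) (velocity S γ t) : E)

/-- `X' = D^γ̇_γ X`. -/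
def prime (S : Set ℝ) (γ : ℝ → M) (X : (t : ℝ) → TangentSpace 𝓘(ℝ, E) (γ t)) :
    (t : ℝ) → TangentSpace 𝓘(ℝ, E) (γ t) :=
  F.covDeriv S γ (velocity S γ) X

/-- `γ : [a, b] → M` is a geodesic: it is smooth, its velocity stays in the domain of the metric
and is parallel along `γ`. -/
structure IsGeodesic (a b : ℝ) (γ : ℝ → M) : Prop where
  smooth : ContMDiffOn 𝓘(ℝ, ℝ) 𝓘(ℝ, E) ∞ γ (Icc a b)
  admissible : ∀ t ∈ Icc a b,
    (⟨γ t, velocity (Icc a b) γ t⟩ : TangentBundle 𝓘(ℝ, E) M) ∈ F.dom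
  parallel : ∀ t ∈ Icc a b, F.prime (Icc a b) γ (velocity (Icc a b) γ) t = 0

/-- The vector field `R^γ (γ̇, V) Z` along `γ`: the curvature of a variation of `γ` with variational
field `V`, applied to an extension of `Z` to the variation. Neither the variation nor the extension
matters; at the parameter `t` the ones used are, in the preferred chart at `γ t`, the
straight-line variation `(τ, s) ↦ γ τ + s V τ` and the extension `(τ, s) ↦ Z τ`. -/
def jacobiOperator (S : Set ℝ) (γ : ℝ → M) (V Z : (t : ℝ) → TangentSpace 𝓘(ℝ, E) (γ t)) (t : ℝ) :
    TangentSpace 𝓘(ℝ, E) (γ t) :=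
  variationCurvature (E := E) (F.localL (γ t)) S
    (fun τ s => extChartAt 𝓘(ℝ, E) (γ t) (γ τ)
      + s • fibreCoord (γ t) (⟨γ τ, V τ⟩ : TangentBundle 𝓘(ℝ, E) M))
    (fun τ _ => fibreCoord (γ t) (⟨γ τ, Z τ⟩ : TangentBundle 𝓘(ℝ, E) M)) t 0

end Metric

/-! ### Second fundamental forms -/

section Submanifold

variable (K : Type*) [NormedAddCommGroup K] [NormedSpace ℝ K] (P : Set M) [ChartedSpace K P]

/-- The differential of the inclusion of `P` at `p`. -/
def inclDeriv (p : P) : K →L[ℝ] E :=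
  mfderiv 𝓘(ℝ, K) 𝓘(ℝ, E) (Subtype.val : P → M) p

/-- The tangent space of `P` at `p`, as a subspace of the tangent space of `M`. -/
def tangentSubspace (p : P) : Submodule ℝ E :=
  LinearMap.range (inclDeriv (E := E) K P p : K →ₗ[ℝ] E)

/-- Smoothness on `U ⊆ P` of a section of the restriction of `TM` to `P`. -/
def IsSmoothSection (U : Set P) (W : (q : P) → TangentSpace 𝓘(ℝ, E) (q : M)) : Prop :=
  ContMDiffOn 𝓘(ℝ, K) 𝓘(ℝ, E).tangent ∞
    (fun q : P => (⟨(q : M), W q⟩ : TangentBundle 𝓘(ℝ, E) M)) U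

namespace Metric

variable (F : Metric E M)

/-- The covariant derivative `∇^N_u W` at `p ∈ P` of a section `W` of the restriction of `TM` to
`P` in the direction `u ∈ T_p P`. It depends on the reference field `N` only through the vector
`v = N p`. (The derivative of the components of `W` is taken along the vector of the model of `P`
which the differential of the inclusion sends to `u`.) -/
def covDerivSub (p : P) (v : TangentSpace 𝓘(ℝ, E) (p : M))
    (W : (q : P) → TangentSpace 𝓘(ℝ, E) (q : M)) (u : E) : E :=
  (show K →L[ℝ] E from mfderiv 𝓘(ℝ, K) 𝓘(ℝ, E)
      (fun q : P => fibreCoord (p : M) (⟨(q : M), W q⟩ : TangentBundle 𝓘(ℝ, E) M)) p)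
        ((inclDeriv (E := E) K P p : K →ₗ[ℝ] E).leftInverse u)
    + F.Gam (p : M) v (W p) u

/-- `W` is a smooth vector field tangent to `P` on an open neighbourhood of `p` in `P`, with value
`w` at `p`. -/
def IsTangentExtension (p : P) (w : E) (W : (q : P) → TangentSpace 𝓘(ℝ, E) (q : M)) : Prop :=
  W p = w ∧ ∃ U : Set P, IsOpen U ∧ p ∈ U ∧ IsSmoothSection K P U W ∧
    ∀ q ∈ U, W q ∈ tangentSubspace (E := E) K P q

/-- `N` is a smooth section of the normal bundle of `P` on an open neighbourhood of `p` in `P`,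
with value `v` at `p`: it takes values in the domain of the metric, and `N q` is
`g_{N q}`-orthogonal to `T_q P`. -/
def IsNormalExtension (p : P) (v : E) (N : (q : P) → TangentSpace 𝓘(ℝ, E) (q : M)) : Prop :=
  N p = v ∧ ∃ U : Set P, IsOpen U ∧ p ∈ U ∧ IsSmoothSection K P U N ∧
    ∀ q ∈ U, (⟨(q : M), N q⟩ : TangentBundle 𝓘(ℝ, E) M) ∈ F.dom ∧
      ∀ w ∈ tangentSubspace (E := E) K P q, F.g (q : M) (N q) (N q) w = 0

/-- The second fundamental form `S^P_v (u, w) = nor_v ∇^N_u W` in the direction of the normal vector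
`v = N p`, where `W` is any local tangent extension of `w`. -/
def secondFundamentalForm (p : P) (v : TangentSpace 𝓘(ℝ, E) (p : M)) (u w : E) : E :=
  open Classical in
  if h : ∃ W, IsTangentExtension (E := E) K P p w W then
    norProj (F.g (p : M) v) (tangentSubspace K P p) (F.covDerivSub K P p v h.choose u)
  else 0

/-- The normal second fundamental form `S̃^P_v (u) = tan_v ∇^N_u N`, where `N` is any local normal
extension of `v`. -/
def normalSecondFundamentalForm (p : P) (v : TangentSpace 𝓘(ℝ, E) (p : M)) (u : E) : E :=
  open Classical in
  if h : ∃ N, F.IsNormalExtension K P p v N then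
    tanProj (F.g (p : M) v) (tangentSubspace K P p) (F.covDerivSub K P p v h.choose u)
  else 0

/-- `v ∈ T_p M` is `g_v`-orthogonal to `P`, and `g_v` is nondegenerate on `T_p P`. -/
structure IsNondegenerateNormal (p : P) (v : TangentSpace 𝓘(ℝ, E) (p : M)) : Prop where
  orthogonal : ∀ w ∈ tangentSubspace (E := E) K P p, F.g (p : M) v v w = 0
  nondegenerate : ∀ u ∈ tangentSubspace (E := E) K P p,
    (∀ w ∈ tangentSubspace (E := E) K P p, F.g (p : M) v u w = 0) → u = 0

end Metric

end Submanifold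

/-! ### The index form -/

section Index

variable (KP KQ : Type*) [NormedAddCommGroup KP] [NormedSpace ℝ KP]
  [NormedAddCommGroup KQ] [NormedSpace ℝ KQ]
  (P Q : Set M) [ChartedSpace KP P] [ChartedSpace KQ Q]

/-- The tangent space `T_γ C_L(P, Q)` at a smooth curve `γ : [a, b] → M` from `P` to `Q`: the smooth
vector fields along `γ` which are tangent to `P` at `a` and to `Q` at `b`. (Values at parameters
outside `[a, b]` are irrelevant.) -/
def tangentFields (a b : ℝ) (γ : ℝ → M) (ha : γ a ∈ P) (hb : γ b ∈ Q) :
    Set ((t : ℝ) → TangentSpace 𝓘(ℝ, E) (γ t)) :=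
  {V | IsSmoothFieldAlong (Icc a b) γ V ∧ V a ∈ tangentSubspace (E := E) KP P ⟨γ a, ha⟩ ∧
    V b ∈ tangentSubspace (E := E) KQ Q ⟨γ b, hb⟩}

namespace Metric

variable (F : Metric E M)

/-- The `(P, Q)`-index form of `γ : [a, b] → M`. -/
def indexForm (a b : ℝ) (γ : ℝ → M) (ha : γ a ∈ P) (hb : γ b ∈ Q)
    (V W : (t : ℝ) → TangentSpace 𝓘(ℝ, E) (γ t)) : ℝ :=
  (∫ t in a..b,
      (-(F.g (γ t) (velocity (Icc a b) γ t)
            (F.jacobiOperator (Icc a b) γ V W t) (velocity (Icc a b) γ t))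
        + F.g (γ t) (velocity (Icc a b) γ t)
            (F.prime (Icc a b) γ V t) (F.prime (Icc a b) γ W t)))
    + F.g (γ b) (velocity (Icc a b) γ b)
        (F.secondFundamentalForm KQ Q ⟨γ b, hb⟩ (velocity (Icc a b) γ b) (V b) (W b))
        (velocity (Icc a b) γ b)
    - F.g (γ a) (velocity (Icc a b) γ a)
        (F.secondFundamentalForm KP P ⟨γ a, ha⟩ (velocity (Icc a b) γ a) (V a) (W a))
        (velocity (Icc a b) γ a)

/-- The kernel of the `(P, Q)`-index form. -/
def indexKernel (a b : ℝ) (γ : ℝ → M) (ha : γ a ∈ P) (hb : γ b ∈ Q) :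
    Set ((t : ℝ) → TangentSpace 𝓘(ℝ, E) (γ t)) :=
  {V | V ∈ tangentFields KP KQ P Q a b γ ha hb ∧
    ∀ W ∈ tangentFields KP KQ P Q a b γ ha hb, F.indexForm KP KQ P Q a b γ ha hb V W = 0}

end Metric

end Index

end Manifold

end PseudoFinsler

end

/-! ### Coordinate calculus of a two-homogeneous function: symmetries and Euler identities. -/

noncomputable section

namespace PseudoFinsler

section LocalAlgebra

variable {E : Type*} [NormedAddCommGroup E] [NormedSpace ℝ E]
  {G : Type*} [NormedAddCommGroup G] [NormedSpace ℝ G]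

/-! Integration by parts rewrites the index form as −∫ g(V'' − R(γ',V)γ', W) dt, plus g(V' − S̃(V),
W) at `b`, minus the same expression at `a` (`indexForm_eq`). Fields W vanishing at both ends then
force the Jacobi equation, by the fundamental lemma of the calculus of variations
(`eq_zero_of_integral_g_eq_zero`). After that, fields W vanishing at one end and with an arbitrary
tangent value at the other force the two projection conditions. The converse is read off the same
formula.

The integration by parts rests on three identities. The Chern connection is only almost metric:
differentiating g_y(X, Y) produces an extra Cartan term 2C(Dy, X, Y)
(`hasFDerivWithinAt_totalForm`). This term vanishes when the reference vector y is parallel, and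
also when X or Y equals y, because g is homogeneous of degree zero in y. The first mechanism gives
the product rule along a geodesic (`hasDerivWithinAt_g`). Both together give g(R(γ',V)W, γ') =
−g(R(γ',V)γ', W), by equating the mixed partial derivatives of g(Z, ∂Λ/∂t) on a variation Λ
(`totalForm_variationCurvature`). The second gives g(S(u,w), v) = −g(S̃(u), w), by differentiating
g_N(N, W) = 0 along the submanifold (`g_secondFundamentalForm`); the normal field N comes from the
implicit function theorem (`exists_normalField`).

There remains a regularity question. The covariant derivative and the curvature are computed, at
each time, in the chart centred at the current point, whereas the argument needs V'' − R(γ',V)γ' to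
be a smooth field. In coordinates this expression is the linearized spray equation
(`variationCurvature_velocity`), and along a geodesic the linearized spray transforms like a vector
(`linearizedSpray_eq`). The curvature applied to a general W enters only through the skew-symmetry,
pointwise and in the central chart, so no chart independence is needed for it. -/

/-- The total function `(x, y) ↦ ℓ x y`. -/
def totalFn (ℓ : E → E → ℝ) (z : E × E) : ℝ := ℓ z.1 z.2

/-- The fibre derivative of `ℓ` as a function on the product. -/
def fibreDeriv (ℓ : E → E → ℝ) (z : E × E) : E →L[ℝ] ℝ := fderiv ℝ (ℓ z.1) z.2

/-- The fundamental form as a function on the product. -/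
def totalForm (ℓ : E → E → ℝ) (z : E × E) : E →L[ℝ] E →L[ℝ] ℝ := fundForm (ℓ z.1) z.2

/-- The (doubled) spray coefficients `γ^k_ij y^i y^j`. -/
def spray (ℓ : E → E → ℝ) (z : E × E) : E := formalChristoffel ℓ z.1 z.2 z.2 z.2

/-- A smooth two-homogeneous function with nondegenerate fundamental form on an open conic set,
in coordinates. -/
structure IsLocalMetric (Ω : Set (E × E)) (ℓ : E → E → ℝ) : Prop where
  isOpen : IsOpen Ω
  smooth : ∀ z ∈ Ω, ContDiffAt ℝ ∞ (totalFn ℓ) z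
  conic : ∀ z ∈ Ω, ∀ c : ℝ, 0 < c → (z.1, c • z.2) ∈ Ω
  homogeneous : ∀ z ∈ Ω, ∀ c : ℝ, 0 < c → ℓ z.1 (c • z.2) = c ^ 2 * ℓ z.1 z.2
  nondegenerate : ∀ z ∈ Ω, ∀ u : E, (∀ w : E, totalForm ℓ z u w = 0) → u = 0

theorem hasFDerivAt_slice_right {H : E × E → G} {z : E × E} (h : DifferentiableAt ℝ H z) :
    HasFDerivAt (fun y => H (z.1, y)) ((fderiv ℝ H z).comp (.inr ℝ E E)) z.2 :=
  HasFDerivAt.comp (x := z.2) (g := H) (f := fun y => (z.1, y)) h.hasFDerivAt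
    (hasFDerivAt_prodMk_right z.1 z.2)

theorem hasFDerivAt_slice_left {H : E × E → G} {z : E × E} (h : DifferentiableAt ℝ H z) :
    HasFDerivAt (fun x => H (x, z.2)) ((fderiv ℝ H z).comp (.inl ℝ E E)) z.1 :=
  HasFDerivAt.comp (x := z.1) (g := H) (f := fun x => (x, z.2)) h.hasFDerivAt
    (hasFDerivAt_prodMk_left z.1 z.2)

/-- The basic tensors are defined by differentiating slices with the other variable frozen. Writing
a slice derivative as the total derivative composed with an injection, on the open set `Ω`, yields
joint smoothness in base and fibre. -/
theorem contDiffAt_fderiv_slice_right {H : E × E → G} {Ω : Set (E × E)} (hΩ : IsOpen Ω)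
    (h : ∀ z ∈ Ω, ContDiffAt ℝ ∞ H z) {z : E × E} (hz : z ∈ Ω) :
    ContDiffAt ℝ ∞ (fun z : E × E => fderiv ℝ (fun y => H (z.1, y)) z.2) z := by
  have h1 : ContDiffAt ℝ ∞ (fun z => (fderiv ℝ H z).comp (.inr ℝ E E)) z :=
    ((h z hz).fderiv_right (m := ∞) (by simp)).clm_comp contDiffAt_const
  refine h1.congr_of_eventuallyEq ?_
  filter_upwards [hΩ.mem_nhds hz] with w hw
  exact (hasFDerivAt_slice_right ((h w hw).differentiableAt (by simp))).fderiv

theorem symm_fderiv_fderiv {f : E → G} {x : E} (h : ContDiffAt ℝ ∞ f x) (u v : E) :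
    fderiv ℝ (fderiv ℝ f) x u v = fderiv ℝ (fderiv ℝ f) x v u :=
  (h.isSymmSndFDerivAt (by
    rw [minSmoothness_of_isRCLikeNormedField]; exact WithTop.coe_le_coe.2 le_top)) u v

theorem fderiv_prod_apply {H : E × E → G} {z : E × E} (u w : E) :
    fderiv ℝ H z (u, w) = fderiv ℝ H z (u, 0) + fderiv ℝ H z (0, w) := by
  rw [← map_add]; simp

namespace IsLocalMetric

variable {Ω : Set (E × E)} {ℓ : E → E → ℝ} (hℓ : IsLocalMetric Ω ℓ)

include hℓ

theorem fibreDeriv_apply {z : E × E} (hz : z ∈ Ω) (w : E) :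
    fibreDeriv ℓ z w = fderiv ℝ (totalFn ℓ) z (0, w) := by
  have := (hasFDerivAt_slice_right ((hℓ.smooth z hz).differentiableAt (by simp))).fderiv
  change fderiv ℝ (fun y => totalFn ℓ (z.1, y)) z.2 w = _
  rw [this]; simp

theorem contDiffAt_fibreDeriv {z : E × E} (hz : z ∈ Ω) : ContDiffAt ℝ ∞ (fibreDeriv ℓ) z :=
  contDiffAt_fderiv_slice_right hℓ.isOpen hℓ.smooth hz

theorem differentiableAt_fibreDeriv {z : E × E} (hz : z ∈ Ω) :
    DifferentiableAt ℝ (fibreDeriv ℓ) z := (hℓ.contDiffAt_fibreDeriv hz).differentiableAt (by simp)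

theorem contDiffAt_totalForm {z : E × E} (hz : z ∈ Ω) : ContDiffAt ℝ ∞ (totalForm ℓ) z :=
  ContDiffAt.const_smul (1 / 2 : ℝ)
    (contDiffAt_fderiv_slice_right hℓ.isOpen (fun _ => hℓ.contDiffAt_fibreDeriv) hz)

theorem differentiableAt_totalForm {z : E × E} (hz : z ∈ Ω) :
    DifferentiableAt ℝ (totalForm ℓ) z := (hℓ.contDiffAt_totalForm hz).differentiableAt (by simp)

theorem totalForm_apply {z : E × E} (hz : z ∈ Ω) (u w : E) :
    totalForm ℓ z u w = (1 / 2 : ℝ) * fderiv ℝ (fibreDeriv ℓ) z (0, u) w := by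
  have := (hasFDerivAt_slice_right (hℓ.differentiableAt_fibreDeriv hz)).fderiv
  change ((1 / 2 : ℝ) • fderiv ℝ (fun y => fibreDeriv ℓ (z.1, y)) z.2) u w = _
  rw [this]; simp

theorem baseDeriv_apply {z : E × E} (hz : z ∈ Ω) (u : E) :
    baseDeriv ℓ z.1 z.2 u = fderiv ℝ (totalForm ℓ) z (u, 0) := by
  have := (hasFDerivAt_slice_left (hℓ.differentiableAt_totalForm hz)).fderiv
  change fderiv ℝ (fun x => totalForm ℓ (x, z.2)) z.1 u = _
  rw [this]; simp

theorem cartanForm_apply {z : E × E} (hz : z ∈ Ω) (u : E) :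
    cartanForm (ℓ z.1) z.2 u = (1 / 2 : ℝ) • fderiv ℝ (totalForm ℓ) z (0, u) := by
  have := (hasFDerivAt_slice_right (hℓ.differentiableAt_totalForm hz)).fderiv
  change ((1 / 2 : ℝ) • fderiv ℝ (fun y => totalForm ℓ (z.1, y)) z.2) u = _
  rw [this]; simp

theorem fderiv_totalForm {z : E × E} (hz : z ∈ Ω) (u w : E) :
    fderiv ℝ (totalForm ℓ) z (u, w) =
      baseDeriv ℓ z.1 z.2 u + (2 : ℝ) • cartanForm (ℓ z.1) z.2 w := by
  rw [fderiv_prod_apply, hℓ.baseDeriv_apply hz, hℓ.cartanForm_apply hz, smul_smul]; norm_num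

theorem slice_contDiffAt {z : E × E} (hz : z ∈ Ω) : ContDiffAt ℝ ∞ (ℓ z.1) z.2 :=
  (hℓ.smooth z hz).comp (f := fun y => (z.1, y)) z.2 (contDiffAt_const.prodMk contDiffAt_id)

theorem totalForm_symm {z : E × E} (hz : z ∈ Ω) (u w : E) :
    totalForm ℓ z u w = totalForm ℓ z w u := by
  simp only [totalForm, fundForm, smul_apply]
  rw [symm_fderiv_fderiv (hℓ.slice_contDiffAt hz)]

theorem fderiv_totalForm_symm {z : E × E} (hz : z ∈ Ω) (h : E × E) (u w : E) :
    fderiv ℝ (totalForm ℓ) z h u w = fderiv ℝ (totalForm ℓ) z h w u := by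
  have hd := (hℓ.differentiableAt_totalForm hz).hasFDerivAt
  have h1 := (hd.clm_apply (hasFDerivAt_const u z)).clm_apply (hasFDerivAt_const w z)
  have h2 := (hd.clm_apply (hasFDerivAt_const w z)).clm_apply (hasFDerivAt_const u z)
  have he : (fun z => totalForm ℓ z u w) =ᶠ[𝓝 z] fun z => totalForm ℓ z w u := by
    filter_upwards [hℓ.isOpen.mem_nhds hz] with y hy using hℓ.totalForm_symm hy u w
  have := congrArg (fun L => L h) ((h1.congr_of_eventuallyEq he.symm).unique h2)
  simpa using this

theorem baseDeriv_symm {z : E × E} (hz : z ∈ Ω) (X u w : E) :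
    baseDeriv ℓ z.1 z.2 X u w = baseDeriv ℓ z.1 z.2 X w u := by
  rw [hℓ.baseDeriv_apply hz, hℓ.fderiv_totalForm_symm hz]

theorem cartanForm_symm_right {z : E × E} (hz : z ∈ Ω) (X u w : E) :
    cartanForm (ℓ z.1) z.2 X u w = cartanForm (ℓ z.1) z.2 X w u := by
  simp only [hℓ.cartanForm_apply hz, smul_apply]
  rw [hℓ.fderiv_totalForm_symm hz]

/-- Up to a constant this is a third derivative of the slice, whose two outer differentiations
commute. Together with `cartanForm_symm_right` it makes the Cartan form totally symmetric. -/
theorem cartanForm_symm_left {z : E × E} (hz : z ∈ Ω) (X u : E) :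
    cartanForm (ℓ z.1) z.2 X u = cartanForm (ℓ z.1) z.2 u X := by
  have h1 : ContDiffAt ℝ ∞ (fderiv ℝ (ℓ z.1)) z.2 :=
    (hℓ.slice_contDiffAt hz).fderiv_right (by simp)
  have h2 : DifferentiableAt ℝ (fderiv ℝ (fderiv ℝ (ℓ z.1))) z.2 :=
    (h1.fderiv_right (m := ∞) (by simp)).differentiableAt (by simp)
  have h3 : fderiv ℝ (fundForm (ℓ z.1)) z.2 =
      (1 / 2 : ℝ) • fderiv ℝ (fderiv ℝ (fderiv ℝ (ℓ z.1))) z.2 :=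
    (h2.hasFDerivAt.const_smul (1 / 2 : ℝ)).fderiv
  simp only [cartanForm, h3, smul_apply]
  rw [symm_fderiv_fderiv h1]

/-- Positive homogeneity of degree one of the fibre derivative. -/
theorem fibreDeriv_smul {z : E × E} (hz : z ∈ Ω) {c : ℝ} (hc : 0 < c) :
    fibreDeriv ℓ (z.1, c • z.2) = c • fibreDeriv ℓ z := by
  have hz' := hℓ.conic z hz c hc
  have h1 : HasFDerivAt (ℓ z.1) (fibreDeriv ℓ (z.1, c • z.2)) (c • z.2) :=
    ((hℓ.slice_contDiffAt hz').differentiableAt (by simp)).hasFDerivAt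
  have h2 : HasFDerivAt (ℓ z.1) (fibreDeriv ℓ z) z.2 :=
    ((hℓ.slice_contDiffAt hz).differentiableAt (by simp)).hasFDerivAt
  have h3 : HasFDerivAt (fun y => ℓ z.1 (c • y))
      ((fibreDeriv ℓ (z.1, c • z.2)).comp (c • ContinuousLinearMap.id ℝ E)) z.2 :=
    HasFDerivAt.comp (x := z.2) (g := ℓ z.1) (f := fun y => c • y) h1
      ((hasFDerivAt_id z.2).const_smul c)
  have h4 := h2.const_mul (c ^ 2)
  have he : (fun y => ℓ z.1 (c • y)) =ᶠ[𝓝 z.2] fun y => c ^ 2 * ℓ z.1 y := by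
    have : ∀ᶠ y in 𝓝 z.2, (z.1, y) ∈ Ω :=
      (Continuous.prodMk_right z.1).continuousAt.eventually_mem
        (hℓ.isOpen.mem_nhds (by simpa using hz))
    filter_upwards [this] with y hy using hℓ.homogeneous (z.1, y) hy c hc
  have h5 := (h3.congr_of_eventuallyEq he.symm).unique h4
  ext w
  have h6 := congrArg (fun L => L w) h5
  simp only [ContinuousLinearMap.comp_apply, smul_apply,
    ContinuousLinearMap.id_apply, map_smul, smul_eq_mul] at h6 ⊢
  -- The chain rule puts a factor `c` on the left against `c ^ 2` on the right; one factor cancels.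
  have : c * (fibreDeriv ℓ (z.1, c • z.2) w) = c * (c * fibreDeriv ℓ z w) := by
    rw [h6]; ring
  exact mul_left_cancel₀ hc.ne' this

/-- Positive homogeneity of degree zero of the fundamental form. -/
theorem totalForm_smul {z : E × E} (hz : z ∈ Ω) {c : ℝ} (hc : 0 < c) :
    totalForm ℓ (z.1, c • z.2) = totalForm ℓ z := by
  have hz' := hℓ.conic z hz c hc
  have h1 := hasFDerivAt_slice_right (hℓ.differentiableAt_fibreDeriv hz')
  have h2 := hasFDerivAt_slice_right (hℓ.differentiableAt_fibreDeriv hz)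
  have h3 := HasFDerivAt.comp (x := z.2) (g := fun y => fibreDeriv ℓ (z.1, y))
    (f := fun y => c • y) h1 ((hasFDerivAt_id z.2).const_smul c)
  have h4 := h2.const_smul c
  have he : (fun y => fibreDeriv ℓ (z.1, c • y)) =ᶠ[𝓝 z.2] fun y => c • fibreDeriv ℓ (z.1, y) := by
    have : ∀ᶠ y in 𝓝 z.2, (z.1, y) ∈ Ω :=
      (Continuous.prodMk_right z.1).continuousAt.eventually_mem
        (hℓ.isOpen.mem_nhds (by simpa using hz))
    filter_upwards [this] with y hy using hℓ.fibreDeriv_smul hy hc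
  have h5 := (h3.congr_of_eventuallyEq he.symm).unique h4
  ext u w
  have h6 := congrArg (fun L => L u w) h5
  simp only [ContinuousLinearMap.comp_apply, smul_apply,
    ContinuousLinearMap.id_apply, map_smul, smul_eq_mul, ContinuousLinearMap.inr_apply] at h6 ⊢
  rw [hℓ.totalForm_apply hz, hℓ.totalForm_apply hz']
  congr 1
  exact mul_left_cancel₀ hc.ne' h6

/-- Euler's identity for the metric function. -/
theorem fibreDeriv_self {z : E × E} (hz : z ∈ Ω) : fibreDeriv ℓ z z.2 = 2 * ℓ z.1 z.2 := by
  have h2 : HasFDerivAt (ℓ z.1) (fibreDeriv ℓ z) ((1 : ℝ) • z.2) := by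
    rw [one_smul]; exact ((hℓ.slice_contDiffAt hz).differentiableAt (by simp)).hasFDerivAt
  have h3 : HasDerivAt (fun c : ℝ => ℓ z.1 (c • z.2)) (fibreDeriv ℓ z ((1 : ℝ) • z.2)) 1 :=
    h2.comp_hasDerivAt (1 : ℝ) ((hasDerivAt_id (1 : ℝ)).smul_const z.2)
  have h4 : HasDerivAt (fun c : ℝ => c ^ 2 * ℓ z.1 z.2) ((2 * (1 : ℝ) ^ 1) * ℓ z.1 z.2) 1 := by
    simpa using (hasDerivAt_pow 2 (1 : ℝ)).mul_const (ℓ z.1 z.2)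
  have he : (fun c : ℝ => ℓ z.1 (c • z.2)) =ᶠ[𝓝 1] fun c : ℝ => c ^ 2 * ℓ z.1 z.2 := by
    filter_upwards [lt_mem_nhds (zero_lt_one (α := ℝ))] with c hc
    exact hℓ.homogeneous z hz c hc
  have := (h3.congr_of_eventuallyEq he.symm).unique h4
  simpa using this

/-- Euler's identity for the fibre derivative. -/
theorem totalForm_self_left {z : E × E} (hz : z ∈ Ω) (w : E) :
    totalForm ℓ z z.2 w = (1 / 2 : ℝ) * fibreDeriv ℓ z w := by
  have h1 : HasFDerivAt (fun y => fibreDeriv ℓ (z.1, y))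
      ((fderiv ℝ (fibreDeriv ℓ) z).comp (.inr ℝ E E)) ((1 : ℝ) • z.2) := by
    rw [one_smul]; exact hasFDerivAt_slice_right (hℓ.differentiableAt_fibreDeriv hz)
  have h3 := HasFDerivAt.comp_hasDerivAt (l := fun y => fibreDeriv ℓ (z.1, y))
    (f := fun c : ℝ => c • z.2) (1 : ℝ) h1 ((hasDerivAt_id (1 : ℝ)).smul_const z.2)
  have h4 : HasDerivAt (fun c : ℝ => c • fibreDeriv ℓ z) ((1 : ℝ) • fibreDeriv ℓ z) 1 :=
    (hasDerivAt_id (1 : ℝ)).smul_const _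
  have he : (fun c : ℝ => fibreDeriv ℓ (z.1, c • z.2)) =ᶠ[𝓝 1] fun c : ℝ => c • fibreDeriv ℓ z := by
    filter_upwards [lt_mem_nhds (zero_lt_one (α := ℝ))] with c hc
    exact hℓ.fibreDeriv_smul hz hc
  have h5 := congrArg (fun L => L w) ((h3.congr_of_eventuallyEq he.symm).unique h4)
  simp only [ContinuousLinearMap.comp_apply, one_smul, ContinuousLinearMap.inr_apply] at h5
  rw [hℓ.totalForm_apply hz, h5]

theorem totalForm_self_self {z : E × E} (hz : z ∈ Ω) :
    totalForm ℓ z z.2 z.2 = totalFn ℓ z := by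
  rw [hℓ.totalForm_self_left hz, hℓ.fibreDeriv_self hz, totalFn]; ring

/-- The fundamental form is constant along the ray through `z.2`, and the Cartan form is half of its
fibre derivative. By symmetry the Cartan form vanishes as soon as any slot holds the reference
vector. -/
theorem cartanForm_self {z : E × E} (hz : z ∈ Ω) : cartanForm (ℓ z.1) z.2 z.2 = 0 := by
  have h1 : HasFDerivAt (fun y => totalForm ℓ (z.1, y))
      ((fderiv ℝ (totalForm ℓ) z).comp (.inr ℝ E E)) ((1 : ℝ) • z.2) := by
    rw [one_smul]; exact hasFDerivAt_slice_right (hℓ.differentiableAt_totalForm hz)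
  have h3 := HasFDerivAt.comp_hasDerivAt (l := fun y => totalForm ℓ (z.1, y))
    (f := fun c : ℝ => c • z.2) (1 : ℝ) h1 ((hasDerivAt_id (1 : ℝ)).smul_const z.2)
  have h4 : HasDerivAt (fun _ : ℝ => totalForm ℓ z) 0 1 := hasDerivAt_const _ _
  have he : (fun c : ℝ => totalForm ℓ (z.1, c • z.2)) =ᶠ[𝓝 1] fun _ : ℝ => totalForm ℓ z := by
    filter_upwards [lt_mem_nhds (zero_lt_one (α := ℝ))] with c hc
    exact hℓ.totalForm_smul hz hc
  have h5 := (h3.congr_of_eventuallyEq he.symm).unique h4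
  simp only [ContinuousLinearMap.comp_apply, one_smul, ContinuousLinearMap.inr_apply] at h5
  rw [hℓ.cartanForm_apply hz, h5, smul_zero]

theorem cartanForm_self_mid {z : E × E} (hz : z ∈ Ω) (u : E) :
    cartanForm (ℓ z.1) z.2 u z.2 = 0 := by
  rw [hℓ.cartanForm_symm_left hz, hℓ.cartanForm_self hz]; rfl

theorem cartanForm_self_right {z : E × E} (hz : z ∈ Ω) (u w : E) :
    cartanForm (ℓ z.1) z.2 u w z.2 = 0 := by
  rw [hℓ.cartanForm_symm_right hz, hℓ.cartanForm_self_mid hz]; rfl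

/-- Base derivative of the Euler identity `totalForm_self_left`, with the fibre coordinate held
fixed; `baseDeriv_self_self` is obtained in the same way from `totalForm_self_self`. They turn the
contracted Koszul expression of the spray into Euler–Lagrange form. -/
theorem baseDeriv_self {z : E × E} (hz : z ∈ Ω) (X w : E) :
    baseDeriv ℓ z.1 z.2 X z.2 w = (1 / 2 : ℝ) * fderiv ℝ (fibreDeriv ℓ) z (X, 0) w := by
  have h1 := (((hℓ.differentiableAt_totalForm hz).hasFDerivAt.clm_apply
    (hasFDerivAt_snd (𝕜 := ℝ) (E := E) (F := E) (p := z))).clm_apply (hasFDerivAt_const w z))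
  have h2 := ((hℓ.differentiableAt_fibreDeriv hz).hasFDerivAt.clm_apply
    (hasFDerivAt_const w z)).const_mul (1 / 2 : ℝ)
  have he : (fun z : E × E => totalForm ℓ z z.2 w) =ᶠ[𝓝 z]
      fun z => (1 / 2 : ℝ) * fibreDeriv ℓ z w := by
    filter_upwards [hℓ.isOpen.mem_nhds hz] with y hy using hℓ.totalForm_self_left hy w
  have h5 := congrArg (fun L => L (X, 0)) ((h1.congr_of_eventuallyEq he.symm).unique h2)
  rw [hℓ.baseDeriv_apply hz]
  simpa using h5

theorem baseDeriv_self_self {z : E × E} (hz : z ∈ Ω) (X : E) :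
    baseDeriv ℓ z.1 z.2 X z.2 z.2 = fderiv ℝ (totalFn ℓ) z (X, 0) := by
  have h1 := (((hℓ.differentiableAt_totalForm hz).hasFDerivAt.clm_apply
    (hasFDerivAt_snd (𝕜 := ℝ) (E := E) (F := E) (p := z))).clm_apply
    (hasFDerivAt_snd (𝕜 := ℝ) (E := E) (F := E) (p := z)))
  have h2 := ((hℓ.smooth z hz).differentiableAt (by simp)).hasFDerivAt
  have he : (fun z : E × E => totalForm ℓ z z.2 z.2) =ᶠ[𝓝 z] totalFn ℓ := by
    filter_upwards [hℓ.isOpen.mem_nhds hz] with y hy using hℓ.totalForm_self_self hy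
  have h5 := congrArg (fun L => L (X, 0)) ((h1.congr_of_eventuallyEq he.symm).unique h2)
  rw [hℓ.baseDeriv_apply hz]
  simpa using h5

/-- `ContinuousLinearMap.inverse` is zero on maps that are not invertible, so the formulas for the
spray and the Christoffel symbols have content only once nondegeneracy is upgraded to invertibility,
by a dimension count. -/
theorem isInvertible [FiniteDimensional ℝ E] {z : E × E} (hz : z ∈ Ω) :
    (totalForm ℓ z).IsInvertible := by
  have hinj : Function.Injective (totalForm ℓ z) := by
    rw [injective_iff_map_eq_zero]
    intro u hu
    exact hℓ.nondegenerate z hz u fun w => by rw [hu]; rfl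
  have hfin : Module.finrank ℝ E = Module.finrank ℝ (E →L[ℝ] ℝ) := by
    rw [← (LinearMap.toContinuousLinearMap (𝕜 := ℝ) (E := E) (F' := ℝ)).finrank_eq]
    exact (Subspace.dual_finrank_eq (K := ℝ) (V := E)).symm
  refine ⟨(LinearEquiv.ofInjectiveOfFinrankEq (totalForm ℓ z : E →ₗ[ℝ] (E →L[ℝ] ℝ)) hinj
    hfin).toContinuousLinearEquiv, ?_⟩
  ext u w
  rfl

variable [FiniteDimensional ℝ E]

theorem totalForm_inverse {z : E × E} (hz : z ∈ Ω) (α : E →L[ℝ] ℝ) :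
    totalForm ℓ z ((totalForm ℓ z).inverse α) = α := (hℓ.isInvertible hz).self_apply_inverse α

theorem totalForm_left_cancel {z : E × E} (hz : z ∈ Ω) {u v : E}
    (h : ∀ w, totalForm ℓ z u w = totalForm ℓ z v w) : u = v :=
  (hℓ.isInvertible hz).injective (ContinuousLinearMap.ext h)

/-- The Euler-Lagrange form of the spray coefficients. -/
theorem totalForm_spray {z : E × E} (hz : z ∈ Ω) (w : E) :
    totalForm ℓ z (spray ℓ z) w =
      (1 / 2 : ℝ) * (fderiv ℝ (fibreDeriv ℓ) z (z.2, 0) w - fderiv ℝ (totalFn ℓ) z (w, 0)) := by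
  have h : totalForm ℓ z (spray ℓ z) = koszul (baseDeriv ℓ z.1 z.2) z.2 z.2 :=
    hℓ.totalForm_inverse hz _
  rw [h]
  simp only [koszul, smul_apply, add_apply,
    sub_apply, ContinuousLinearMap.flip_apply, smul_eq_mul]
  rw [hℓ.baseDeriv_self hz, hℓ.baseDeriv_self_self hz]
  ring

theorem contDiffAt_inverse {z : E × E} (hz : z ∈ Ω) :
    ContDiffAt ℝ ∞ (fun z => (totalForm ℓ z).inverse) z :=
  (hℓ.isInvertible hz).contDiffAt_map_inverse.comp z (hℓ.contDiffAt_totalForm hz)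

omit [FiniteDimensional ℝ E] in
theorem contDiffAt_baseDeriv {z : E × E} (hz : z ∈ Ω) :
    ContDiffAt ℝ ∞ (fun z : E × E => baseDeriv ℓ z.1 z.2) z := by
  have h1 : ContDiffAt ℝ ∞ (fun z => (fderiv ℝ (totalForm ℓ) z).comp (.inl ℝ E E)) z :=
    ((hℓ.contDiffAt_totalForm hz).fderiv_right (m := ∞) (by simp)).clm_comp contDiffAt_const
  refine h1.congr_of_eventuallyEq ?_
  filter_upwards [hℓ.isOpen.mem_nhds hz] with w hw
  ext1 u
  simp [hℓ.baseDeriv_apply hw]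

omit [FiniteDimensional ℝ E] in
theorem contDiffAt_cartanForm {z : E × E} (hz : z ∈ Ω) :
    ContDiffAt ℝ ∞ (fun z : E × E => cartanForm (ℓ z.1) z.2) z := by
  have h1 : ContDiffAt ℝ ∞
      (fun z => (1 / 2 : ℝ) • (fderiv ℝ (totalForm ℓ) z).comp (.inr ℝ E E)) z :=
    (((hℓ.contDiffAt_totalForm hz).fderiv_right (m := ∞) (by simp)).clm_comp
      contDiffAt_const).const_smul _
  refine h1.congr_of_eventuallyEq ?_
  filter_upwards [hℓ.isOpen.mem_nhds hz] with w hw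
  ext1 u
  simp [hℓ.cartanForm_apply hw]

end IsLocalMetric

/-- The operator `flip` as a continuous linear map. -/
abbrev flipL : (E →L[ℝ] E →L[ℝ] G) →L[ℝ] (E →L[ℝ] E →L[ℝ] G) :=
  ((ContinuousLinearMap.flipₗᵢ ℝ E E G).toContinuousLinearEquiv : _ →L[ℝ] _)

theorem _root_.ContDiffAt.clm_flip {V : Type*} [NormedAddCommGroup V] [NormedSpace ℝ V]
    {T : V → E →L[ℝ] E →L[ℝ] G} {p : V} (hT : ContDiffAt ℝ ∞ T p) :
    ContDiffAt ℝ ∞ (fun p => (T p).flip) p :=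
  (flipL (E := E) (G := G)).contDiff.contDiffAt.comp p hT

theorem contDiffAt_koszul {V : Type*} [NormedAddCommGroup V] [NormedSpace ℝ V]
    {T : V → E →L[ℝ] E →L[ℝ] E →L[ℝ] ℝ} {X Y : V → E} {p : V} (hT : ContDiffAt ℝ ∞ T p)
    (hX : ContDiffAt ℝ ∞ X p) (hY : ContDiffAt ℝ ∞ Y p) :
    ContDiffAt ℝ ∞ (fun p => koszul (T p) (X p) (Y p)) p :=
  ((((hT.clm_apply hX).clm_apply hY).add ((hT.clm_apply hY).clm_apply hX)).sub
    ((hT.clm_flip.clm_apply hX).clm_flip.clm_apply hY)).const_smul _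

/-! ### Spray, nonlinear connection and Chern connection in coordinates. -/

namespace IsLocalMetric

variable {Ω : Set (E × E)} {ℓ : E → E → ℝ} (hℓ : IsLocalMetric Ω ℓ)
  [FiniteDimensional ℝ E]

include hℓ

theorem contDiffAt_spray {z : E × E} (hz : z ∈ Ω) : ContDiffAt ℝ ∞ (spray ℓ) z :=
  (hℓ.contDiffAt_inverse hz).clm_apply
    (contDiffAt_koszul (hℓ.contDiffAt_baseDeriv hz) contDiffAt_snd contDiffAt_snd)

theorem contDiffAt_nonlinearConnection {z : E × E} (hz : z ∈ Ω) :
    ContDiffAt ℝ ∞ (fun z : E × E => nonlinearConnection ℓ z.1 z.2) z := by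
  have hb := hℓ.contDiffAt_baseDeriv hz
  have hs : ContDiffAt ℝ ∞ (fun z : E × E => z.2) z := contDiffAt_snd
  exact (hℓ.contDiffAt_inverse hz).clm_comp
    ((((hb.clm_flip.clm_apply hs).add (hb.clm_apply hs)).sub
      (hb.clm_flip.clm_apply hs).clm_flip).const_smul (1 / 2 : ℝ) |>.sub
        ((hℓ.contDiffAt_cartanForm hz).clm_flip.clm_apply (hℓ.contDiffAt_spray hz)))

theorem contDiffAt_horizontalDeriv {z : E × E} (hz : z ∈ Ω) :
    ContDiffAt ℝ ∞ (fun z : E × E => horizontalDeriv ℓ z.1 z.2) z :=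
  (hℓ.contDiffAt_baseDeriv hz).sub
    (((hℓ.contDiffAt_cartanForm hz).clm_comp (hℓ.contDiffAt_nonlinearConnection hz)).const_smul _)

theorem contDiffAt_christoffel {V : Type*} [NormedAddCommGroup V] [NormedSpace ℝ V]
    {x y X Y : V → E} {p : V} (hp : (x p, y p) ∈ Ω) (hx : ContDiffAt ℝ ∞ x p)
    (hy : ContDiffAt ℝ ∞ y p) (hX : ContDiffAt ℝ ∞ X p) (hY : ContDiffAt ℝ ∞ Y p) :
    ContDiffAt ℝ ∞ (fun p => christoffel ℓ (x p) (y p) (X p) (Y p)) p := by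
  have hxy := hx.prodMk hy
  have h1 : ContDiffAt ℝ ∞ (fun p => (totalForm ℓ (x p, y p)).inverse) p :=
    ContDiffAt.comp (g := fun z => (totalForm ℓ z).inverse) (f := fun p => (x p, y p)) p
      (hℓ.contDiffAt_inverse hp) hxy
  have h2 : ContDiffAt ℝ ∞ (fun p => horizontalDeriv ℓ (x p) (y p)) p :=
    ContDiffAt.comp (g := fun z : E × E => horizontalDeriv ℓ z.1 z.2)
      (f := fun p => (x p, y p)) p
      (hℓ.contDiffAt_horizontalDeriv hp) hxy
  have h3 := contDiffAt_koszul h2 hX hY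
  have h4 := h1.clm_apply h3
  unfold christoffel
  exact h4

theorem totalForm_nonlinearConnection {z : E × E} (hz : z ∈ Ω) (X w : E) :
    totalForm ℓ z (nonlinearConnection ℓ z.1 z.2 X) w =
      (1 / 2 : ℝ) * (baseDeriv ℓ z.1 z.2 X z.2 w + baseDeriv ℓ z.1 z.2 z.2 X w
        - baseDeriv ℓ z.1 z.2 w z.2 X) - cartanForm (ℓ z.1) z.2 X (spray ℓ z) w := by
  have : totalForm ℓ z (nonlinearConnection ℓ z.1 z.2 X) = _ := hℓ.totalForm_inverse hz _
  rw [this]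
  simp [spray]

/-- The nonlinear connection is one half of the fibre derivative of the spray coefficients. -/
theorem fderiv_spray {z : E × E} (hz : z ∈ Ω) (X : E) :
    fderiv ℝ (spray ℓ) z (0, X) = (2 : ℝ) • nonlinearConnection ℓ z.1 z.2 X := by
  apply hℓ.totalForm_left_cancel hz
  intro w
  have hS := (hℓ.contDiffAt_spray hz).differentiableAt (by simp) |>.hasFDerivAt
  have h1 := (((hℓ.differentiableAt_totalForm hz).hasFDerivAt.clm_apply hS).clm_apply
    (hasFDerivAt_const w z))
  have hD : DifferentiableAt ℝ (fderiv ℝ (fibreDeriv ℓ)) z :=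
    ((hℓ.contDiffAt_fibreDeriv hz).fderiv_right (m := ∞) (by simp)).differentiableAt (by simp)
  have hT : DifferentiableAt ℝ (fderiv ℝ (totalFn ℓ)) z :=
    ((hℓ.smooth z hz).fderiv_right (m := ∞) (by simp)).differentiableAt (by simp)
  have hv : HasFDerivAt (fun z : E × E => (z.2, (0 : E)))
      ((ContinuousLinearMap.snd ℝ E E).prod 0) z :=
    hasFDerivAt_snd.prodMk (hasFDerivAt_const _ _)
  have h2 := ((((hD.hasFDerivAt.clm_apply hv).clm_apply (hasFDerivAt_const w z))).sub
    (hT.hasFDerivAt.clm_apply (hasFDerivAt_const (w, (0 : E)) z))).const_mul (1 / 2 : ℝ)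
  have he : (fun z : E × E => totalForm ℓ z (spray ℓ z) w) =ᶠ[𝓝 z] fun z => (1 / 2 : ℝ) *
      (fderiv ℝ (fibreDeriv ℓ) z (z.2, 0) w - fderiv ℝ (totalFn ℓ) z (w, 0)) := by
    filter_upwards [hℓ.isOpen.mem_nhds hz] with y hy using hℓ.totalForm_spray hy w
  -- Fibre derivative of the Euler–Lagrange identity. Differentiating g on the left gives 2C(X,
  -- spray, w), which is the Cartan correction in the nonlinear connection. The other terms are
  -- mixed derivatives of ℓ, which `hmix`, `hmix2` and the Euler identities bring to Koszul form.
  have h5 := congrArg (fun L => L (0, X)) ((h1.congr_of_eventuallyEq he.symm).unique h2)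
  simp only [add_apply, sub_apply,
    smul_apply, ContinuousLinearMap.comp_apply,
    ContinuousLinearMap.flip_apply, zero_apply, smul_eq_mul, map_zero,
    ContinuousLinearMap.prod_apply, ContinuousLinearMap.coe_snd', zero_add] at h5
  have hmix : ∀ u : E, fderiv ℝ (fderiv ℝ (fibreDeriv ℓ)) z (0, X) (u, 0) w =
      2 * baseDeriv ℓ z.1 z.2 u X w := by
    intro u
    rw [symm_fderiv_fderiv (hℓ.contDiffAt_fibreDeriv hz), hℓ.baseDeriv_apply hz]
    have g1 := ((hD.hasFDerivAt.clm_apply (hasFDerivAt_const ((0 : E), X) z)).clm_apply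
      (hasFDerivAt_const w z)).const_mul (1 / 2 : ℝ)
    have g2 := (((hℓ.differentiableAt_totalForm hz).hasFDerivAt.clm_apply
      (hasFDerivAt_const X z)).clm_apply (hasFDerivAt_const w z))
    have he : (fun z : E × E => totalForm ℓ z X w) =ᶠ[𝓝 z]
        fun z => (1 / 2 : ℝ) * fderiv ℝ (fibreDeriv ℓ) z (0, X) w := by
      filter_upwards [hℓ.isOpen.mem_nhds hz] with y hy using hℓ.totalForm_apply hy X w
    have g5 := congrArg (fun L => L (u, 0)) ((g2.congr_of_eventuallyEq he.symm).unique g1)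
    simp at g5
    rw [g5]; ring
  have hmix2 : fderiv ℝ (fderiv ℝ (totalFn ℓ)) z (0, X) (w, 0) =
      fderiv ℝ (fibreDeriv ℓ) z (w, 0) X := by
    rw [symm_fderiv_fderiv (hℓ.smooth z hz)]
    have g1 := (hT.hasFDerivAt.clm_apply (hasFDerivAt_const ((0 : E), X) z))
    have g2 := (hℓ.differentiableAt_fibreDeriv hz).hasFDerivAt.clm_apply (hasFDerivAt_const X z)
    have he : (fun z : E × E => fibreDeriv ℓ z X) =ᶠ[𝓝 z]
        fun z => fderiv ℝ (totalFn ℓ) z (0, X) := by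
      filter_upwards [hℓ.isOpen.mem_nhds hz] with y hy using hℓ.fibreDeriv_apply hy X
    have g5 := congrArg (fun L => L (w, 0)) ((g2.congr_of_eventuallyEq he.symm).unique g1)
    simpa using g5.symm
  have hb1 := hℓ.baseDeriv_self hz X w
  have hb2 := hℓ.baseDeriv_self hz w X
  have hc := congrArg (fun L => L (spray ℓ z) w) (hℓ.cartanForm_apply hz X)
  simp only [smul_apply, smul_eq_mul] at hc
  rw [hmix, hmix2] at h5
  rw [map_smul, smul_apply, smul_eq_mul, hℓ.totalForm_nonlinearConnection hz]
  rw [hc]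
  rw [hb1, hb2]
  linarith

/-- The Cartan correction drops out because its first slot is the reference vector, and what remains
is the Koszul expression defining the spray. -/
theorem nonlinearConnection_self {z : E × E} (hz : z ∈ Ω) :
    nonlinearConnection ℓ z.1 z.2 z.2 = spray ℓ z := by
  apply hℓ.totalForm_left_cancel hz
  intro w
  rw [hℓ.totalForm_nonlinearConnection hz, hℓ.cartanForm_self hz, hℓ.totalForm_spray hz,
    hℓ.baseDeriv_self hz, hℓ.baseDeriv_self_self hz]
  simp only [zero_apply]
  ring

omit hℓ [FiniteDimensional ℝ E] in
theorem horizontalDeriv_apply (z : E × E) (u X Y : E) :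
    horizontalDeriv ℓ z.1 z.2 u X Y = baseDeriv ℓ z.1 z.2 u X Y
      - 2 * cartanForm (ℓ z.1) z.2 (nonlinearConnection ℓ z.1 z.2 u) X Y := by
  simp [horizontalDeriv]

omit [FiniteDimensional ℝ E] in
theorem horizontalDeriv_symm {z : E × E} (hz : z ∈ Ω) (u X Y : E) :
    horizontalDeriv ℓ z.1 z.2 u X Y = horizontalDeriv ℓ z.1 z.2 u Y X := by
  rw [horizontalDeriv_apply, horizontalDeriv_apply, hℓ.baseDeriv_symm hz,
    hℓ.cartanForm_symm_right hz]

theorem totalForm_christoffel {z : E × E} (hz : z ∈ Ω) (X Y w : E) :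
    totalForm ℓ z (christoffel ℓ z.1 z.2 X Y) w =
      (1 / 2 : ℝ) * (horizontalDeriv ℓ z.1 z.2 X Y w + horizontalDeriv ℓ z.1 z.2 Y X w
        - horizontalDeriv ℓ z.1 z.2 w X Y) := by
  have : totalForm ℓ z (christoffel ℓ z.1 z.2 X Y) = _ := hℓ.totalForm_inverse hz _
  rw [this]
  simp [koszul]

/-- Contraction of the Chern Christoffel symbols with the reference vector gives the nonlinear
connection. -/
theorem christoffel_self_left {z : E × E} (hz : z ∈ Ω) (X : E) :
    christoffel ℓ z.1 z.2 z.2 X = nonlinearConnection ℓ z.1 z.2 X := by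
  apply hℓ.totalForm_left_cancel hz
  intro w
  rw [hℓ.totalForm_christoffel hz, hℓ.totalForm_nonlinearConnection hz]
  simp only [horizontalDeriv_apply]
  -- Of the three Cartan terms in the Koszul formula, two contain the reference vector. The third
  -- comes from N y = spray and is the correction in the nonlinear connection.
  rw [hℓ.cartanForm_self_mid hz, hℓ.cartanForm_self_mid hz, hℓ.nonlinearConnection_self hz,
    hℓ.cartanForm_symm_left hz (spray ℓ z) X]
  simp only [zero_apply]
  ring

theorem christoffel_symm {z : E × E} (hz : z ∈ Ω) (X Y : E) :
    christoffel ℓ z.1 z.2 X Y = christoffel ℓ z.1 z.2 Y X := by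
  apply hℓ.totalForm_left_cancel hz
  intro w
  rw [hℓ.totalForm_christoffel hz, hℓ.totalForm_christoffel hz, hℓ.horizontalDeriv_symm hz w X Y]
  ring

theorem christoffel_self_right {z : E × E} (hz : z ∈ Ω) (X : E) :
    christoffel ℓ z.1 z.2 X z.2 = nonlinearConnection ℓ z.1 z.2 X := by
  rw [hℓ.christoffel_symm hz, hℓ.christoffel_self_left hz]

/-- In the sum of the two Koszul formulas on the right, all horizontal derivatives cancel in pairs
except those in the direction `u`: the Chern symbols are metric for the horizontal derivative. -/
theorem horizontalDeriv_eq {z : E × E} (hz : z ∈ Ω) (u X Y : E) :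
    horizontalDeriv ℓ z.1 z.2 u X Y =
      totalForm ℓ z (christoffel ℓ z.1 z.2 X u) Y + totalForm ℓ z X (christoffel ℓ z.1 z.2 Y u) := by
  rw [hℓ.totalForm_symm hz X, hℓ.totalForm_christoffel hz, hℓ.totalForm_christoffel hz,
    hℓ.horizontalDeriv_symm hz u Y X, hℓ.horizontalDeriv_symm hz X u Y,
    hℓ.horizontalDeriv_symm hz Y u X]
  ring

/-- Almost metric compatibility of the Chern connection along a map `(x, y)` into the tangent
bundle, in coordinates. -/
theorem hasFDerivWithinAt_totalForm {H : Type*} [NormedAddCommGroup H] [NormedSpace ℝ H]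
    {S : Set H} {x y X Y : H → E} {x' y' X' Y' : H →L[ℝ] E} {p : H} (hp : (x p, y p) ∈ Ω)
    (hx : HasFDerivWithinAt x x' S p) (hy : HasFDerivWithinAt y y' S p)
    (hX : HasFDerivWithinAt X X' S p) (hY : HasFDerivWithinAt Y Y' S p) :
    ∃ D : H →L[ℝ] ℝ, HasFDerivWithinAt (fun q => totalForm ℓ (x q, y q) (X q) (Y q)) D S p ∧
      ∀ h, D h = totalForm ℓ (x p, y p) (X' h + christoffel ℓ (x p) (y p) (X p) (x' h)) (Y p)
        + totalForm ℓ (x p, y p) (X p) (Y' h + christoffel ℓ (x p) (y p) (Y p) (x' h))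
        + 2 * cartanForm (ℓ (x p)) (y p)
            (y' h + christoffel ℓ (x p) (y p) (y p) (x' h)) (X p) (Y p) := by
  have hg : HasFDerivWithinAt (fun q => totalForm ℓ (x q, y q))
      ((fderiv ℝ (totalForm ℓ) (x p, y p)).comp (x'.prod y')) S p :=
    HasFDerivAt.comp_hasFDerivWithinAt (g := totalForm ℓ) (f := fun q => (x q, y q)) p
      (hℓ.differentiableAt_totalForm hp).hasFDerivAt (hx.prodMk hy)
  refine ⟨_, (hg.clm_apply hX).clm_apply hY, fun h => ?_⟩
  -- The derivative of g along (x', y') is ∂_{x'} g + 2C(y') = δ_{x'} g + 2C(y' + N x'). Since N x'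
  -- = Γ(y, x'), the Cartan form receives exactly the covariant derivative of the reference vector.
  have h1 := hℓ.horizontalDeriv_eq hp (x' h) (X p) (Y p)
  have h2 := horizontalDeriv_apply (ℓ := ℓ) (x p, y p) (x' h) (X p) (Y p)
  have h3 := congrArg (fun L => L (X p) (Y p)) (hℓ.fderiv_totalForm hp (x' h) (y' h))
  have h4 := hℓ.christoffel_self_left hp (x' h)
  simp only [add_apply, smul_apply,
    smul_eq_mul] at h1 h2 h3 h4
  simp only [add_apply, ContinuousLinearMap.comp_apply,
    ContinuousLinearMap.flip_apply, ContinuousLinearMap.prod_apply, map_add]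
  rw [h3, h4]
  linarith

/-- One-parameter form of `hasFDerivWithinAt_totalForm`. -/
theorem hasDerivWithinAt_totalForm {S : Set ℝ} {x y X Y : ℝ → E} {x' y' X' Y' : E} {t : ℝ}
    (ht : (x t, y t) ∈ Ω) (hx : HasDerivWithinAt x x' S t) (hy : HasDerivWithinAt y y' S t)
    (hX : HasDerivWithinAt X X' S t) (hY : HasDerivWithinAt Y Y' S t) :
    HasDerivWithinAt (fun q => totalForm ℓ (x q, y q) (X q) (Y q))
      (totalForm ℓ (x t, y t) (X' + christoffel ℓ (x t) (y t) (X t) x') (Y t)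
        + totalForm ℓ (x t, y t) (X t) (Y' + christoffel ℓ (x t) (y t) (Y t) x')
        + 2 * cartanForm (ℓ (x t)) (y t)
            (y' + christoffel ℓ (x t) (y t) (y t) x') (X t) (Y t)) S t := by
  obtain ⟨D, hD, hD'⟩ := hℓ.hasFDerivWithinAt_totalForm ht hx.hasFDerivWithinAt
    hy.hasFDerivWithinAt hX.hasFDerivWithinAt hY.hasFDerivWithinAt
  have := hD.hasDerivWithinAt
  rw [hD' 1] at this
  simpa using this

end IsLocalMetric

end LocalAlgebra

end PseudoFinsler

end

/-! ### Transformation laws under a change of coordinates. -/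

noncomputable section

namespace PseudoFinsler

section ChartChange

variable {E : Type*} [NormedAddCommGroup E] [NormedSpace ℝ E]

theorem contDiffWithinAt_derivWithin {S : Set ℝ} (hS : UniqueDiffOn ℝ S) {x : ℝ → E} {t : ℝ}
    (ht : t ∈ S) (hx : ContDiffWithinAt ℝ ∞ x S t) :
    ContDiffWithinAt ℝ ∞ (derivWithin x S) S t :=
  (hx.fderivWithin_right hS (m := ∞) (by simp) ht).clm_apply contDiffWithinAt_const

/-- The covariant derivative of a vector field `v` along a curve `x` in a chart, with the velocity
of the curve as reference field. -/
def localPrime (ℓ : E → E → ℝ) (S : Set ℝ) (x v : ℝ → E) (t : ℝ) : E :=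
  derivWithin v S t + nonlinearConnection ℓ (x t) (derivWithin x S t) (v t)

/-- The linearization at `x` in the direction `v` of the spray expression `x'' + 2 G (x, x')`. -/
def linearizedSpray (ℓ : E → E → ℝ) (S : Set ℝ) (x v : ℝ → E) (t : ℝ) : E :=
  derivWithin (derivWithin v S) S t
    + fderiv ℝ (spray ℓ) (x t, derivWithin x S t) (v t, derivWithin v S t)

/-- The tangent map of `ψ` as a map of the product. -/
def tangentFn (ψ : E → E) (z : E × E) : E × E := (ψ z.1, fderiv ℝ ψ z.1 z.2)

/-- `ψ` is a change of coordinates on the open set `U` which carries the metric `ℓ` to `ℓ'`. -/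
structure IsMetricChange (Ω : Set (E × E)) (ℓ : E → E → ℝ) (Ω' : Set (E × E)) (ℓ' : E → E → ℝ)
    (U : Set E) (ψ : E → E) : Prop where
  source : IsLocalMetric Ω ℓ
  target : IsLocalMetric Ω' ℓ'
  isOpen : IsOpen U
  smooth : ∀ x ∈ U, ContDiffAt ℝ ∞ ψ x
  surjective : ∀ x ∈ U, Function.Surjective (fderiv ℝ ψ x)
  maps : ∀ z ∈ Ω, z.1 ∈ U → tangentFn ψ z ∈ Ω'
  eq : ∀ x ∈ U, ∀ y, ℓ x y = ℓ' (ψ x) (fderiv ℝ ψ x y)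

theorem hasFDerivAt_tangentFn {ψ : E → E} {z : E × E} (h : ContDiffAt ℝ ∞ ψ z.1) :
    ∃ D : E × E →L[ℝ] E × E, HasFDerivAt (tangentFn ψ) D z ∧ ∀ u w, D (u, w) =
      (fderiv ℝ ψ z.1 u, fderiv ℝ (fderiv ℝ ψ) z.1 u z.2 + fderiv ℝ ψ z.1 w) := by
  have h1 : HasFDerivAt (fun z : E × E => ψ z.1) _ z :=
    HasFDerivAt.comp (g := ψ) (f := Prod.fst) z
      (h.differentiableAt (by simp)).hasFDerivAt hasFDerivAt_fst
  have h2 : HasFDerivAt (fun z : E × E => fderiv ℝ ψ z.1) _ z :=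
    HasFDerivAt.comp (g := fderiv ℝ ψ) (f := Prod.fst) z
      ((h.fderiv_right (m := ∞) (by simp)).differentiableAt (by simp)).hasFDerivAt hasFDerivAt_fst
  refine ⟨_, h1.prodMk (h2.clm_apply hasFDerivAt_snd), fun u w => ?_⟩
  simp [add_comm]

namespace IsMetricChange

variable {Ω Ω' : Set (E × E)} {ℓ ℓ' : E → E → ℝ} {U : Set E} {ψ : E → E}
  (h : IsMetricChange Ω ℓ Ω' ℓ' U ψ)

include h

theorem eventually_mem {z : E × E} (hz : z ∈ Ω) (hU : z.1 ∈ U) :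
    ∀ᶠ w in 𝓝 z, w ∈ Ω ∧ w.1 ∈ U :=
  (h.source.isOpen.eventually_mem hz).and
    (continuousAt_fst.eventually_mem (h.isOpen.mem_nhds hU))

theorem fibreDeriv_eq {z : E × E} (hz : z ∈ Ω) (hU : z.1 ∈ U) (w : E) :
    fibreDeriv ℓ z w = fibreDeriv ℓ' (tangentFn ψ z) (fderiv ℝ ψ z.1 w) := by
  have h1 : ℓ z.1 = fun y => ℓ' (ψ z.1) (fderiv ℝ ψ z.1 y) := funext (h.eq z.1 hU)
  have h2 : HasFDerivAt (ℓ' (ψ z.1)) (fibreDeriv ℓ' (tangentFn ψ z)) (fderiv ℝ ψ z.1 z.2) :=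
    ((h.target.slice_contDiffAt (h.maps z hz hU)).differentiableAt (by simp)).hasFDerivAt
  have h3 : HasFDerivAt (fun y => ℓ' (ψ z.1) (fderiv ℝ ψ z.1 y)) _ z.2 :=
    HasFDerivAt.comp (g := ℓ' (ψ z.1)) (f := fderiv ℝ ψ z.1) z.2 h2
      (ContinuousLinearMap.hasFDerivAt _)
  rw [fibreDeriv, h1, h3.fderiv]
  rfl

/-- Both the reference point and the test vector `fderiv ℝ ψ z.1 w` move with the base point. The
second dependence produces the last term. -/
theorem fderiv_fibreDeriv_eq {z : E × E} (hz : z ∈ Ω) (hU : z.1 ∈ U) (u v w : E) :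
    fderiv ℝ (fibreDeriv ℓ) z (u, v) w =
      fderiv ℝ (fibreDeriv ℓ') (tangentFn ψ z)
        (fderiv ℝ ψ z.1 u, fderiv ℝ (fderiv ℝ ψ) z.1 u z.2 + fderiv ℝ ψ z.1 v) (fderiv ℝ ψ z.1 w)
      + fibreDeriv ℓ' (tangentFn ψ z) (fderiv ℝ (fderiv ℝ ψ) z.1 u w) := by
  obtain ⟨D, hD, hD'⟩ := hasFDerivAt_tangentFn (h.smooth z.1 hU)
  have h1 := (h.source.differentiableAt_fibreDeriv hz).hasFDerivAt.clm_apply (hasFDerivAt_const w z)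
  have h2 : HasFDerivAt (fun z => fibreDeriv ℓ' (tangentFn ψ z)) _ z :=
    HasFDerivAt.comp (g := fibreDeriv ℓ') (f := tangentFn ψ) z
    (h.target.differentiableAt_fibreDeriv (h.maps z hz hU)).hasFDerivAt hD
  have h3 : HasFDerivAt (fun z : E × E => fderiv ℝ ψ z.1) _ z :=
    HasFDerivAt.comp (g := fderiv ℝ ψ) (f := Prod.fst) z
      (((h.smooth z.1 hU).fderiv_right (m := ∞) (by simp)).differentiableAt (by simp)).hasFDerivAt
      hasFDerivAt_fst
  have h4 := h2.clm_apply (h3.clm_apply (hasFDerivAt_const w z))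
  have he : (fun z => fibreDeriv ℓ z w) =ᶠ[𝓝 z]
      fun z => fibreDeriv ℓ' (tangentFn ψ z) (fderiv ℝ ψ z.1 w) := by
    filter_upwards [h.eventually_mem hz hU] with y hy using h.fibreDeriv_eq hy.1 hy.2 w
  have h5 := congrArg (fun L => L (u, v)) ((h1.congr_of_eventuallyEq he.symm).unique h4)
  simp only [add_apply, ContinuousLinearMap.comp_apply, ContinuousLinearMap.flip_apply,
    zero_apply, map_zero, zero_add, ContinuousLinearMap.coe_fst', hD'] at h5
  rw [h5, add_comm]

/-- Invariance of the fundamental form. -/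
theorem totalForm_eq {z : E × E} (hz : z ∈ Ω) (hU : z.1 ∈ U) (u w : E) :
    totalForm ℓ z u w =
      totalForm ℓ' (tangentFn ψ z) (fderiv ℝ ψ z.1 u) (fderiv ℝ ψ z.1 w) := by
  rw [h.source.totalForm_apply hz, h.target.totalForm_apply (h.maps z hz hU),
    h.fderiv_fibreDeriv_eq hz hU]
  simp

theorem fderiv_totalFn_eq {z : E × E} (hz : z ∈ Ω) (hU : z.1 ∈ U) (w : E) :
    fderiv ℝ (totalFn ℓ) z (w, 0) = fderiv ℝ (totalFn ℓ') (tangentFn ψ z) (fderiv ℝ ψ z.1 w, 0)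
      + fibreDeriv ℓ' (tangentFn ψ z) (fderiv ℝ (fderiv ℝ ψ) z.1 w z.2) := by
  obtain ⟨D, hD, hD'⟩ := hasFDerivAt_tangentFn (h.smooth z.1 hU)
  have h1 := ((h.source.smooth z hz).differentiableAt (by simp)).hasFDerivAt
  have h2 : HasFDerivAt (fun z => totalFn ℓ' (tangentFn ψ z)) _ z :=
    HasFDerivAt.comp (g := totalFn ℓ') (f := tangentFn ψ) z
    ((h.target.smooth _ (h.maps z hz hU)).differentiableAt (by simp)).hasFDerivAt hD
  have he : totalFn ℓ =ᶠ[𝓝 z] fun z => totalFn ℓ' (tangentFn ψ z) := by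
    filter_upwards [h.eventually_mem hz hU] with y hy using h.eq y.1 hy.2 y.2
  have h5 := congrArg (fun L => L (w, 0)) ((h1.congr_of_eventuallyEq he.symm).unique h2)
  simp only [ContinuousLinearMap.comp_apply, hD', map_zero, add_zero] at h5
  rw [h5, fderiv_prod_apply, h.target.fibreDeriv_apply (h.maps z hz hU)]

theorem fderiv_fderiv_symm {x : E} (hx : x ∈ U) (u v : E) :
    fderiv ℝ (fderiv ℝ ψ) x u v = fderiv ℝ (fderiv ℝ ψ) x v u := symm_fderiv_fderiv (h.smooth x hx) u v

theorem derivWithin_comp {S : Set ℝ} (hS : UniqueDiffOn ℝ S) {x : ℝ → E} {t : ℝ} (ht : t ∈ S)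
    (hU : x t ∈ U) (hx : ContDiffWithinAt ℝ ∞ x S t) :
    derivWithin (fun τ => ψ (x τ)) S t = fderiv ℝ ψ (x t) (derivWithin x S t) :=
  (((h.smooth _ hU).differentiableAt (by simp)).hasFDerivAt.comp_hasDerivWithinAt t
    (hx.differentiableWithinAt (by simp)).hasDerivWithinAt).derivWithin (hS t ht)

/-- The derivative of the push-forward of a vector field along a curve. -/
theorem hasDerivWithinAt_pushforward {S : Set ℝ} {x v : ℝ → E} {t : ℝ} (hU : x t ∈ U)
    (hx : ContDiffWithinAt ℝ ∞ x S t) (hv : ContDiffWithinAt ℝ ∞ v S t) :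
    HasDerivWithinAt (fun τ => fderiv ℝ ψ (x τ) (v τ))
      (fderiv ℝ (fderiv ℝ ψ) (x t) (derivWithin x S t) (v t)
        + fderiv ℝ ψ (x t) (derivWithin v S t)) S t := by
  have h1 : ContDiffAt ℝ ∞ (fderiv ℝ ψ) (x t) := (h.smooth _ hU).fderiv_right (by simp)
  exact ((h1.differentiableAt (by simp)).hasFDerivAt.comp_hasDerivWithinAt t
    (hx.differentiableWithinAt (by simp)).hasDerivWithinAt).clm_apply
      (hv.differentiableWithinAt (by simp)).hasDerivWithinAt

variable [FiniteDimensional ℝ E]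

/-- Transformation law of the spray coefficients. -/
theorem spray_eq {z : E × E} (hz : z ∈ Ω) (hU : z.1 ∈ U) :
    spray ℓ' (tangentFn ψ z) =
      fderiv ℝ ψ z.1 (spray ℓ z) - fderiv ℝ (fderiv ℝ ψ) z.1 z.2 z.2 := by
  have hz' := h.maps z hz hU
  apply h.target.totalForm_left_cancel hz'
  intro w'
  -- It is enough to test against pushed-forward vectors. The two terms in which the fibre
  -- derivative is applied to D²ψ cancel by symmetry of D²ψ. The inhomogeneous term of the law is
  -- the g'-dual of half the fibre second derivative in the direction D²ψ(y, y).
  obtain ⟨w, rfl⟩ := h.surjective z.1 hU w'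
  have h1 := h.source.totalForm_spray hz w
  rw [h.totalForm_eq hz hU, h.fderiv_fibreDeriv_eq hz hU, h.fderiv_totalFn_eq hz hU, map_zero,
    add_zero, fderiv_prod_apply, h.fderiv_fderiv_symm hU w z.2] at h1
  have h2 := h.target.totalForm_apply hz' (fderiv ℝ (fderiv ℝ ψ) z.1 z.2 z.2) (fderiv ℝ ψ z.1 w)
  have h3 := h.target.totalForm_spray hz' (fderiv ℝ ψ z.1 w)
  change _ = _ * (fderiv ℝ (fibreDeriv ℓ') (tangentFn ψ z) (fderiv ℝ ψ z.1 z.2, 0) _ - _) at h3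
  rw [map_sub, sub_apply, h1, h2, h3, add_apply]
  ring

/-- The derivative of the transformation law of the spray coefficients. -/
theorem fderiv_spray_eq {z : E × E} (hz : z ∈ Ω) (hU : z.1 ∈ U) (u v : E) :
    fderiv ℝ (spray ℓ') (tangentFn ψ z)
        (fderiv ℝ ψ z.1 u, fderiv ℝ (fderiv ℝ ψ) z.1 u z.2 + fderiv ℝ ψ z.1 v) =
      fderiv ℝ ψ z.1 (fderiv ℝ (spray ℓ) z (u, v)) + fderiv ℝ (fderiv ℝ ψ) z.1 u (spray ℓ z)
        - fderiv ℝ (fderiv ℝ (fderiv ℝ ψ)) z.1 u z.2 z.2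
        - fderiv ℝ (fderiv ℝ ψ) z.1 v z.2 - fderiv ℝ (fderiv ℝ ψ) z.1 z.2 v := by
  obtain ⟨D, hD, hD'⟩ := hasFDerivAt_tangentFn (h.smooth z.1 hU)
  have hz' := h.maps z hz hU
  have h1 : HasFDerivAt (fun z => spray ℓ' (tangentFn ψ z)) _ z :=
    HasFDerivAt.comp (g := spray ℓ') (f := tangentFn ψ) z
      ((h.target.contDiffAt_spray hz').differentiableAt (by simp)).hasFDerivAt hD
  have hψ1 : ContDiffAt ℝ ∞ (fderiv ℝ ψ) z.1 := (h.smooth z.1 hU).fderiv_right (by simp)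
  have hψ2 : ContDiffAt ℝ ∞ (fderiv ℝ (fderiv ℝ ψ)) z.1 := hψ1.fderiv_right (by simp)
  have h3 : HasFDerivAt (fun z : E × E => fderiv ℝ ψ z.1) _ z :=
    HasFDerivAt.comp (g := fderiv ℝ ψ) (f := Prod.fst) z
      (hψ1.differentiableAt (by simp)).hasFDerivAt hasFDerivAt_fst
  have h4 : HasFDerivAt (fun z : E × E => fderiv ℝ (fderiv ℝ ψ) z.1) _ z :=
    HasFDerivAt.comp (g := fderiv ℝ (fderiv ℝ ψ)) (f := Prod.fst) z
      (hψ2.differentiableAt (by simp)).hasFDerivAt hasFDerivAt_fst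
  have hs := ((h.source.contDiffAt_spray hz).differentiableAt (by simp)).hasFDerivAt
  have h5 := (h3.clm_apply hs).sub
    ((h4.clm_apply (hasFDerivAt_snd (p := z))).clm_apply (hasFDerivAt_snd (p := z)))
  have he : (fun z => spray ℓ' (tangentFn ψ z)) =ᶠ[𝓝 z]
      fun z => fderiv ℝ ψ z.1 (spray ℓ z) - fderiv ℝ (fderiv ℝ ψ) z.1 z.2 z.2 := by
    filter_upwards [h.eventually_mem hz hU] with y hy using h.spray_eq hy.1 hy.2
  have h6 := congrArg (fun L => L (u, v)) (h1.unique (h5.congr_of_eventuallyEq he))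
  simp only [add_apply, sub_apply, ContinuousLinearMap.comp_apply, ContinuousLinearMap.flip_apply,
    ContinuousLinearMap.coe_fst', ContinuousLinearMap.coe_snd', hD'] at h6
  rw [h6]
  abel

/-- Transformation law of the nonlinear connection. -/
theorem nonlinearConnection_eq {z : E × E} (hz : z ∈ Ω) (hU : z.1 ∈ U) (v : E) :
    nonlinearConnection ℓ' (tangentFn ψ z).1 (tangentFn ψ z).2 (fderiv ℝ ψ z.1 v) =
      fderiv ℝ ψ z.1 (nonlinearConnection ℓ z.1 z.2 v) - fderiv ℝ (fderiv ℝ ψ) z.1 z.2 v := by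
  -- Only the fibre is varied, because the nonlinear connection is half the fibre derivative of the
  -- spray.
  have h1 := h.fderiv_spray_eq hz hU 0 v
  simp only [map_zero, zero_apply, zero_add, add_zero, sub_zero] at h1
  rw [h.target.fderiv_spray (z := tangentFn ψ z) (h.maps z hz hU), h.source.fderiv_spray hz,
    h.fderiv_fderiv_symm hU v, map_smul] at h1
  have h2 := congrArg (fun e => (1 / 2 : ℝ) • e) h1
  simp only [smul_sub, smul_smul] at h2
  norm_num at h2
  rw [h2, sub_sub, ← add_smul]
  norm_num

/-- Transformation law of the covariant derivative along a curve. -/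
theorem localPrime_eq {S : Set ℝ} (hS : UniqueDiffOn ℝ S) {x v : ℝ → E} {t : ℝ} (ht : t ∈ S)
    (hU : x t ∈ U) (hx : ContDiffWithinAt ℝ ∞ x S t) (hv : ContDiffWithinAt ℝ ∞ v S t)
    (hz : (x t, derivWithin x S t) ∈ Ω) :
    localPrime ℓ' S (fun τ => ψ (x τ)) (fun τ => fderiv ℝ ψ (x τ) (v τ)) t =
      fderiv ℝ ψ (x t) (localPrime ℓ S x v t) := by
  have h1 := h.nonlinearConnection_eq hz hU (v t)
  simp only [tangentFn] at h1
  rw [localPrime, localPrime, (h.hasDerivWithinAt_pushforward hU hx hv).derivWithin (hS t ht),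
    h.derivWithin_comp hS ht hU hx, h1, map_add]
  abel

/-- Transformation law of the linearized spray equation along a geodesic. -/
theorem linearizedSpray_eq {S : Set ℝ} (hS : UniqueDiffOn ℝ S) {x v : ℝ → E} {t : ℝ} (ht : t ∈ S)
    (hx : ∀ᶠ τ in 𝓝[S] t, ContDiffWithinAt ℝ ∞ x S τ ∧ x τ ∈ U)
    (hv : ∀ᶠ τ in 𝓝[S] t, ContDiffWithinAt ℝ ∞ v S τ)
    (hz : (x t, derivWithin x S t) ∈ Ω)
    (hgeo : derivWithin (derivWithin x S) S t + spray ℓ (x t, derivWithin x S t) = 0) :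
    linearizedSpray ℓ' S (fun τ => ψ (x τ)) (fun τ => fderiv ℝ ψ (x τ) (v τ)) t =
      fderiv ℝ ψ (x t) (linearizedSpray ℓ S x v t) := by
  have hxt := hx.self_of_nhdsWithin ht
  rw [linearizedSpray, linearizedSpray, h.derivWithin_comp hS ht hxt.2 hxt.1]
  change _ + fderiv ℝ (spray ℓ') (tangentFn ψ (x t, derivWithin x S t)) _ = _
  have hvt := hv.self_of_nhdsWithin ht
  have hψ1 : ∀ y ∈ U, ContDiffAt ℝ ∞ (fderiv ℝ ψ) y := fun y hy =>
    (h.smooth y hy).fderiv_right (by simp)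
  have hψ2 : ∀ y ∈ U, ContDiffAt ℝ ∞ (fderiv ℝ (fderiv ℝ ψ)) y := fun y hy =>
    (hψ1 y hy).fderiv_right (by simp)
  have hder : ∀ {w : ℝ → E} {τ}, ContDiffWithinAt ℝ ∞ w S τ →
      HasDerivWithinAt w (derivWithin w S τ) S τ := fun hw =>
    (hw.differentiableWithinAt (by simp)).hasDerivWithinAt
  have hSm : ∀ᶠ τ in 𝓝[S] t, τ ∈ S := self_mem_nhdsWithin
  have hE : (derivWithin (fun τ => fderiv ℝ ψ (x τ) (v τ)) S) =ᶠ[𝓝[S] t]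
      fun τ => fderiv ℝ (fderiv ℝ ψ) (x τ) (derivWithin x S τ) (v τ)
          + fderiv ℝ ψ (x τ) (derivWithin v S τ) := by
    filter_upwards [hx, hv, hSm] with τ h1 h2 h3
    exact (h.hasDerivWithinAt_pushforward h1.2 h1.1 h2).derivWithin (hS τ h3)
  have hx2 : HasDerivWithinAt (derivWithin x S) (derivWithin (derivWithin x S) S t) S t :=
    hder (contDiffWithinAt_derivWithin hS ht hxt.1)
  have hv2 : HasDerivWithinAt (derivWithin v S) (derivWithin (derivWithin v S) S t) S t :=
    hder (contDiffWithinAt_derivWithin hS ht hvt)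
  have hA := ((hψ1 _ hxt.2).differentiableAt (by simp)).hasFDerivAt.comp_hasDerivWithinAt t
      (hder hxt.1)
  have hA2 := ((hψ2 _ hxt.2).differentiableAt (by simp)).hasFDerivAt.comp_hasDerivWithinAt t
      (hder hxt.1)
  have hDD := (((hA2.clm_apply hx2).clm_apply (hder hvt)).add (hA.clm_apply hv2))
  rw [hE.derivWithin_eq (hE.self_of_nhdsWithin ht), hE.self_of_nhdsWithin ht]
  have hDD' := hDD.derivWithin (hS t ht)
  have hl := h.fderiv_spray_eq hz hxt.2 (v t) (derivWithin v S t)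
  -- The third derivative of ψ enters twice: on (x', x', v) from the second derivative of the
  -- pushed-forward field and, with opposite sign, on (v, x', x') from the spray law. This symmetry
  -- makes the two cancel.
  have hs3 : ∀ u w : E, fderiv ℝ (fderiv ℝ (fderiv ℝ ψ)) (x t) u w w =
      fderiv ℝ (fderiv ℝ (fderiv ℝ ψ)) (x t) w w u := by
    intro u w
    rw [symm_fderiv_fderiv (hψ1 _ hxt.2)]
    have hF := ((hψ2 _ hxt.2).differentiableAt (by simp)).hasFDerivAt
    have g1 := (hF.clm_apply (hasFDerivAt_const u _)).clm_apply (hasFDerivAt_const w _)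
    have g2 := (hF.clm_apply (hasFDerivAt_const w _)).clm_apply (hasFDerivAt_const u _)
    have he : (fun x => fderiv ℝ (fderiv ℝ ψ) x u w) =ᶠ[𝓝 (x t)]
        fun x => fderiv ℝ (fderiv ℝ ψ) x w u := by
      filter_upwards [h.isOpen.mem_nhds hxt.2] with y hy using h.fderiv_fderiv_symm hy u w
    simpa using congrArg (fun L => L w) ((g1.congr_of_eventuallyEq he.symm).unique g2)
  -- The geodesic equation makes D²ψ(x'', v) cancel against D²ψ(v, spray). Without it these terms
  -- would remain and the expression would not transform like a vector.
  have hgeo' : derivWithin (derivWithin x S) S t = - spray ℓ (x t, derivWithin x S t) :=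
    eq_neg_of_add_eq_zero_left hgeo
  rw [hs3 (v t)] at hl
  simp only [h.fderiv_fderiv_symm hxt.2 (v t)] at hl
  erw [hDD']
  simp only [Function.comp_apply, add_apply, hgeo', map_neg, neg_apply]
  rw [hl, map_add, h.fderiv_fderiv_symm hxt.2 (derivWithin v S t)]
  abel

end IsMetricChange

end ChartChange

end PseudoFinsler

end

/-! ### Curvature of the straight-line variation of a geodesic, in one chart. -/

noncomputable section

namespace PseudoFinsler

section CurvesInAChart

variable {E : Type*} [NormedAddCommGroup E] [NormedSpace ℝ E]

theorem koszul_smul_left (T : E →L[ℝ] E →L[ℝ] E →L[ℝ] ℝ) (c : ℝ) (X Y : E) :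
    koszul T (c • X) Y = c • koszul T X Y := by
  ext w; simp [koszul]; ring

theorem christoffel_smul_left (ℓ : E → E → ℝ) (c : ℝ) (x y X Y : E) :
    christoffel ℓ x y (c • X) Y = c • christoffel ℓ x y X Y := by
  simp [christoffel, koszul_smul_left]

theorem christoffel_zero_left (ℓ : E → E → ℝ) (x y Y : E) : christoffel ℓ x y 0 Y = 0 := by
  simpa using christoffel_smul_left ℓ 0 x y 0 Y

/-- The mixed partial derivatives of a smooth function of two variables agree. -/
theorem mixed_partials_eq {f : ℝ × ℝ → ℝ} {t s : ℝ} (hf : ContDiffAt ℝ ∞ f (t, s))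
    {α β : ℝ → ℝ} {α' β' : ℝ} (hα : ∀ᶠ τ in 𝓝 t, HasDerivAt (fun σ => f (τ, σ)) (α τ) s)
    (hβ : ∀ᶠ σ in 𝓝 s, HasDerivAt (fun τ => f (τ, σ)) (β σ) t)
    (hα' : HasDerivAt α α' t) (hβ' : HasDerivAt β β' s) : α' = β' := by
  have hdiff : ∀ᶠ z in 𝓝 (t, s), DifferentiableAt ℝ f z :=
    ((hf.of_le (m := 1) (by simp)).eventually (by simp)).mono
      fun z hz => hz.differentiableAt (by simp)
  have hDf : HasFDerivAt (fderiv ℝ f) (fderiv ℝ (fderiv ℝ f) (t, s)) (t, s) :=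
    ((hf.fderiv_right (m := ∞) (by simp)).differentiableAt (by simp)).hasFDerivAt
  have hl : ∀ z : ℝ × ℝ, HasDerivAt (fun τ : ℝ => (τ, z.2)) ((1 : ℝ), (0 : ℝ)) z.1 := fun z =>
    (hasDerivAt_id z.1).prodMk (hasDerivAt_const z.1 z.2)
  have hr : ∀ z : ℝ × ℝ, HasDerivAt (fun σ : ℝ => (z.1, σ)) ((0 : ℝ), (1 : ℝ)) z.2 := fun z =>
    (hasDerivAt_const z.2 z.1).prodMk (hasDerivAt_id z.2)
  have h1 : α =ᶠ[𝓝 t] fun τ => fderiv ℝ f (τ, s) (0, 1) := by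
    have : ∀ᶠ τ in 𝓝 t, DifferentiableAt ℝ f (τ, s) :=
      (hl (t, s)).continuousAt.eventually hdiff
    filter_upwards [hα, this] with τ h1 h2
    exact h1.unique (h2.hasFDerivAt.comp_hasDerivAt s (hr (τ, s)))
  have h2 : β =ᶠ[𝓝 s] fun σ => fderiv ℝ f (t, σ) (1, 0) := by
    have : ∀ᶠ σ in 𝓝 s, DifferentiableAt ℝ f (t, σ) :=
      (hr (t, s)).continuousAt.eventually hdiff
    filter_upwards [hβ, this] with σ h1 h2
    exact h1.unique (h2.hasFDerivAt.comp_hasDerivAt t (hl (t, σ)))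
  have h3 : HasDerivAt (fun τ => fderiv ℝ f (τ, s) (0, 1))
      (fderiv ℝ (fderiv ℝ f) (t, s) (1, 0) (0, 1)) t := by
    simpa using (HasFDerivAt.comp_hasDerivAt (l := fderiv ℝ f)
      (f := fun τ => (τ, s)) t hDf (hl (t, s))).clm_apply (hasDerivAt_const t ((0 : ℝ), (1 : ℝ)))
  have h4 : HasDerivAt (fun σ => fderiv ℝ f (t, σ) (1, 0))
      (fderiv ℝ (fderiv ℝ f) (t, s) (0, 1) (1, 0)) s := by
    simpa using (HasFDerivAt.comp_hasDerivAt (l := fderiv ℝ f)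
      (f := fun σ => (t, σ)) s hDf (hr (t, s))).clm_apply (hasDerivAt_const s ((1 : ℝ), (0 : ℝ)))
  rw [hα'.unique (h3.congr_of_eventuallyEq h1), hβ'.unique (h4.congr_of_eventuallyEq h2),
    symm_fderiv_fderiv hf]

theorem derivWithin_add_const_smul {S : Set ℝ} {x v : ℝ → E} {t : ℝ}
    (hx : DifferentiableWithinAt ℝ x S t) (hv : DifferentiableWithinAt ℝ v S t) (hS : UniqueDiffOn ℝ S) (ht : t ∈ S)
    (s : ℝ) :
    derivWithin (fun τ => x τ + s • v τ) S t = derivWithin x S t + s • derivWithin v S t :=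
  (hx.hasDerivWithinAt.add (hv.hasDerivWithinAt.const_smul s)).derivWithin (hS t ht)

/-- The curvature of the straight-line variation in coordinates. -/
theorem variationCurvature_line (ℓ : E → E → ℝ) {S : Set ℝ} {x v z : ℝ → E} {t : ℝ}
    (hx : DifferentiableWithinAt ℝ x S t) (hv : DifferentiableWithinAt ℝ v S t) (hS : UniqueDiffOn ℝ S) (ht : t ∈ S) :
    variationCurvature ℓ S (fun τ s => x τ + s • v τ) (fun τ _ => z τ) t 0 =
      derivWithin (fun τ => christoffel ℓ (x τ) (derivWithin x S τ) (z τ) (v τ)) S t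
        + christoffel ℓ (x t) (derivWithin x S t)
          (christoffel ℓ (x t) (derivWithin x S t) (z t) (v t)) (derivWithin x S t)
      - (deriv (fun σ : ℝ => christoffel ℓ (x t + σ • v t) (derivWithin x S t + σ • derivWithin v S t)
            (z t) (derivWithin x S t + σ • derivWithin v S t)) 0
        + christoffel ℓ (x t) (derivWithin x S t) (derivWithin z S t
          + christoffel ℓ (x t) (derivWithin x S t) (z t) (derivWithin x S t)) (v t)) := by
  have hd : ∀ τ, deriv (fun σ : ℝ => x τ + σ • v τ) 0 = v τ := fun τ => by
    simpa using (((hasDerivAt_id (0 : ℝ)).smul_const (v τ)).const_add (x τ)).deriv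
  have hl := derivWithin_add_const_smul hx hv hS ht
  -- The field is extended constantly in `s`, so the inner transverse covariant derivative reduces
  -- to its Christoffel term.
  simp only [variationCurvature, longCovDeriv, transCovDeriv, hd, hl, deriv_const, zero_smul,
    add_zero, zero_add, deriv_const_add]

namespace IsLocalMetric

variable {Ω : Set (E × E)} {ℓ : E → E → ℝ} (hℓ : IsLocalMetric Ω ℓ) [FiniteDimensional ℝ E]
  {S : Set ℝ} (hS : UniqueDiffOn ℝ S) {x v : ℝ → E} {t : ℝ} (ht : t ∈ S)

include hℓ

omit [FiniteDimensional ℝ E] in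
include hS ht in
theorem eventually_velocity_mem (hx : ContDiffWithinAt ℝ ∞ x S t)
    (hz : (x t, derivWithin x S t) ∈ Ω) :
    ∀ᶠ τ in 𝓝[S] t, (x τ, derivWithin x S τ) ∈ Ω :=
  (hx.continuousWithinAt.prodMk
    (contDiffWithinAt_derivWithin hS ht hx).continuousWithinAt).eventually_mem
      (hℓ.isOpen.mem_nhds hz)

theorem contDiffWithinAt_nonlinearConnection {y : ℝ → E} (hz : (x t, y t) ∈ Ω)
    (hx : ContDiffWithinAt ℝ ∞ x S t) (hy : ContDiffWithinAt ℝ ∞ y S t)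
    (hv : ContDiffWithinAt ℝ ∞ v S t) :
    ContDiffWithinAt ℝ ∞ (fun τ => nonlinearConnection ℓ (x τ) (y τ) (v τ)) S t :=
  ContDiffWithinAt.clm_apply
    (ContDiffAt.comp_contDiffWithinAt (g := fun z : E × E => nonlinearConnection ℓ z.1 z.2)
      (f := fun τ => (x τ, y τ)) t (hℓ.contDiffAt_nonlinearConnection hz) (hx.prodMk hy)) hv

include hS ht in
theorem contDiffWithinAt_localPrime (hx : ContDiffWithinAt ℝ ∞ x S t)
    (hv : ContDiffWithinAt ℝ ∞ v S t) (hz : (x t, derivWithin x S t) ∈ Ω) :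
    ContDiffWithinAt ℝ ∞ (localPrime ℓ S x v) S t :=
  (contDiffWithinAt_derivWithin hS ht hv).add
    (hℓ.contDiffWithinAt_nonlinearConnection hz hx (contDiffWithinAt_derivWithin hS ht hx) hv)

include hS ht in
theorem contDiffWithinAt_linearizedSpray (hx : ContDiffWithinAt ℝ ∞ x S t)
    (hv : ContDiffWithinAt ℝ ∞ v S t) (hz : (x t, derivWithin x S t) ∈ Ω) :
    ContDiffWithinAt ℝ ∞ (linearizedSpray ℓ S x v) S t := by
  have hx' := contDiffWithinAt_derivWithin hS ht hx
  have hv' := contDiffWithinAt_derivWithin hS ht hv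
  have h1 : ContDiffAt ℝ ∞ (fderiv ℝ (spray ℓ)) (x t, derivWithin x S t) :=
    (hℓ.contDiffAt_spray hz).fderiv_right (by simp)
  exact (contDiffWithinAt_derivWithin hS ht hv').add (ContDiffWithinAt.clm_apply
    (ContDiffAt.comp_contDiffWithinAt (g := fderiv ℝ (spray ℓ))
      (f := fun τ => (x τ, derivWithin x S τ)) t h1 (hx.prodMk hx')) (hv.prodMk hv'))

include hS ht in
/-- Along a geodesic, `V'' - R (γ', V) γ'` is the linearized spray equation. -/
theorem variationCurvature_velocity (hx : ContDiffWithinAt ℝ ∞ x S t)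
    (hv : ContDiffWithinAt ℝ ∞ v S t) (hz : (x t, derivWithin x S t) ∈ Ω)
    (hgeo : localPrime ℓ S x (derivWithin x S) t = 0) {z : ℝ → E}
    (hzx : z =ᶠ[𝓝[S] t] derivWithin x S) :
    variationCurvature ℓ S (fun τ s => x τ + s • v τ) (fun τ _ => z τ) t 0 =
      localPrime ℓ S x (localPrime ℓ S x v) t - linearizedSpray ℓ S x v t := by
  have hx' := contDiffWithinAt_derivWithin hS ht hx
  have hv' := contDiffWithinAt_derivWithin hS ht hv
  have hN := hℓ.contDiffWithinAt_nonlinearConnection hz hx hx' hv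
  have hsm : ∀ {w : ℝ → E}, ContDiffWithinAt ℝ ∞ w S t → DifferentiableWithinAt ℝ w S t :=
    fun hw => hw.differentiableWithinAt (by simp)
  rw [variationCurvature_line ℓ (hsm hx) (hsm hv) hS ht]
  have hzt : z t = derivWithin x S t := hzx.self_of_nhdsWithin ht
  have hΩ := hℓ.eventually_velocity_mem hS ht hx hz
  have e1 : (fun τ => christoffel ℓ (x τ) (derivWithin x S τ) (z τ) (v τ)) =ᶠ[𝓝[S] t]
      fun τ => nonlinearConnection ℓ (x τ) (derivWithin x S τ) (v τ) := by
    filter_upwards [hzx, hΩ] with τ h1 h2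
    rw [h1]; exact hℓ.christoffel_self_left h2 (v τ)
  have e2 : christoffel ℓ (x t) (derivWithin x S t) (derivWithin x S t) (v t) =
      nonlinearConnection ℓ (x t) (derivWithin x S t) (v t) := hℓ.christoffel_self_left hz (v t)
  have e3 : ∀ w, christoffel ℓ (x t) (derivWithin x S t) w (derivWithin x S t) =
      nonlinearConnection ℓ (x t) (derivWithin x S t) w := hℓ.christoffel_self_right hz
  have e4 : derivWithin z S t = derivWithin (derivWithin x S) S t := hzx.derivWithin_eq hzt
  have e5 : derivWithin (derivWithin x S) S t
      + nonlinearConnection ℓ (x t) (derivWithin x S t) (derivWithin x S t) = 0 := hgeo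
  rw [e1.derivWithin_eq (e1.self_of_nhdsWithin ht), hzt, e2, e3, e3, e4, e5,
    christoffel_zero_left, add_zero]
  set y := derivWithin x S t
  set w := derivWithin v S t
  have hc : HasDerivAt (fun σ : ℝ => (x t + σ • v t, y + σ • w)) (v t, w) 0 := by
    simpa using (((hasDerivAt_id (0 : ℝ)).smul_const (v t)).const_add (x t)).prodMk
      (((hasDerivAt_id (0 : ℝ)).smul_const w).const_add y)
  have hc0 : (x t + (0 : ℝ) • v t, y + (0 : ℝ) • w) = (x t, y) := by simp
  have hcΩ : ∀ᶠ σ in 𝓝 (0 : ℝ), (x t + σ • v t, y + σ • w) ∈ Ω :=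
    hc.continuousAt.eventually_mem (hℓ.isOpen.mem_nhds (by rw [hc0]; exact hz))
  -- On the curve at parameter σ the velocity is y + σw, while the field being transported is still
  -- y. Writing y = (y + σw) − σw and contracting with the velocity leaves the spray minus σ N w.
  have e6 : (fun σ : ℝ => christoffel ℓ (x t + σ • v t) (y + σ • w) y (y + σ • w)) =ᶠ[𝓝 0]
      fun σ => spray ℓ (x t + σ • v t, y + σ • w)
        - σ • nonlinearConnection ℓ (x t + σ • v t) (y + σ • w) w := by
    filter_upwards [hcΩ] with σ hσ
    have h1 := hℓ.christoffel_self_right hσ y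
    have h2 := hℓ.nonlinearConnection_self hσ
    simp only at h1 h2
    rw [h1, ← h2, map_add, map_smul]
    abel
  have hsp : HasDerivAt (fun σ : ℝ => spray ℓ (x t + σ • v t, y + σ • w))
      (fderiv ℝ (spray ℓ) (x t, y) (v t, w)) 0 := by
    have : HasFDerivAt (spray ℓ) (fderiv ℝ (spray ℓ) (x t, y))
        (x t + (0 : ℝ) • v t, y + (0 : ℝ) • w) := by
      rw [hc0]; exact ((hℓ.contDiffAt_spray hz).differentiableAt (by simp)).hasFDerivAt
    exact this.comp_hasDerivAt (0 : ℝ) hc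
  -- The factor σ vanishes at 0, so the derivative of the nonlinear connection itself does not
  -- contribute.
  have hnl : HasDerivAt (fun σ : ℝ => σ • nonlinearConnection ℓ (x t + σ • v t) (y + σ • w) w)
      (nonlinearConnection ℓ (x t) y w) 0 := by
    have h1 : HasFDerivAt (fun z : E × E => nonlinearConnection ℓ z.1 z.2)
        (fderiv ℝ (fun z : E × E => nonlinearConnection ℓ z.1 z.2) (x t, y))
        (x t + (0 : ℝ) • v t, y + (0 : ℝ) • w) := by
      rw [hc0]
      exact ((hℓ.contDiffAt_nonlinearConnection hz).differentiableAt (by simp)).hasFDerivAt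
    have h2 := HasFDerivAt.comp_hasDerivAt (l := fun z : E × E => nonlinearConnection ℓ z.1 z.2)
      (f := fun σ : ℝ => (x t + σ • v t, y + σ • w)) (0 : ℝ) h1 hc
    have h3 := (hasDerivAt_id' (0 : ℝ)).fun_smul (h2.clm_apply (hasDerivAt_const (0 : ℝ) w))
    simpa using h3
  have e7 := (hsp.sub hnl).congr_of_eventuallyEq e6
  rw [e7.deriv]
  rw [localPrime, linearizedSpray]
  have e8 : derivWithin (localPrime ℓ S x v) S t = derivWithin (derivWithin v S) S t
      + derivWithin (fun τ => nonlinearConnection ℓ (x τ) (derivWithin x S τ) (v τ)) S t :=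
    derivWithin_fun_add (hsm hv') (hsm hN)
  rw [e8, localPrime, map_add]
  abel

include hS in
/-- Along a geodesic, `R (γ', V)` is skew-symmetric with respect to `γ'`. -/
theorem totalForm_variationCurvature (hSt : S ∈ 𝓝 t)
    (hx : ContDiffWithinAt ℝ ∞ x S t) (hv : ContDiffWithinAt ℝ ∞ v S t)
    {z : ℝ → E} (hzs : ContDiffWithinAt ℝ ∞ z S t)
    (hz : (x t, derivWithin x S t) ∈ Ω)
    (hgeo : localPrime ℓ S x (derivWithin x S) t = 0) :
    totalForm ℓ (x t, derivWithin x S t)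
        (variationCurvature ℓ S (fun τ s => x τ + s • v τ) (fun τ _ => z τ) t 0)
        (derivWithin x S t)
      + totalForm ℓ (x t, derivWithin x S t) (z t)
        (localPrime ℓ S x (localPrime ℓ S x v) t - linearizedSpray ℓ S x v t) = 0 := by
  have ht := mem_of_mem_nhds hSt
  set y := derivWithin x S with hy
  set w := derivWithin v S with hw
  have hys : ContDiffWithinAt ℝ ∞ y S t := contDiffWithinAt_derivWithin hS ht hx
  have hws : ContDiffWithinAt ℝ ∞ w S t := contDiffWithinAt_derivWithin hS ht hv
  have hder : ∀ {u : ℝ → E}, ContDiffWithinAt ℝ ∞ u S t → HasDerivAt u (derivWithin u S t) t :=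
    fun h => (h.differentiableWithinAt (by simp)).hasDerivWithinAt.hasDerivAt hSt
  have hat : ∀ {u : ℝ → E}, ContDiffWithinAt ℝ ∞ u S t → ContDiffAt ℝ ∞ u t :=
    fun h => h.contDiffAt hSt
  rw [variationCurvature_line ℓ (hx.differentiableWithinAt (by simp))
    (hv.differentiableWithinAt (by simp)) hS ht]
  rw [← hy, ← hw]
  have hline : ∀ (a b : E), HasDerivAt (fun σ : ℝ => a + σ • b) b 0 := fun a b => by
    simpa using ((hasDerivAt_id (0 : ℝ)).smul_const b).const_add a
  have hc0 : ∀ a b : E, a + (0 : ℝ) • b = a := fun a b => by simp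
  have hΩ : ∀ᶠ τ in 𝓝 t, (x τ, y τ) ∈ Ω := by
    have := hℓ.eventually_velocity_mem hS ht hx hz
    rwa [nhdsWithin_eq_nhds.2 hSt] at this
  have hΩ' : ∀ᶠ σ in 𝓝 (0 : ℝ), (x t + σ • v t, y t + σ • w t) ∈ Ω :=
    ((hline (x t) (v t)).continuousAt.prodMk (hline (y t) (w t)).continuousAt).eventually_mem
      (hℓ.isOpen.mem_nhds (by rw [hc0, hc0]; exact hz))
  -- the scalar function of two variables whose mixed partial derivatives are compared
  let f : ℝ × ℝ → ℝ := fun p =>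
    totalForm ℓ (x p.1 + p.2 • v p.1, y p.1 + p.2 • w p.1) (z p.1) (y p.1 + p.2 • w p.1)
  have hfst : ContDiffAt ℝ ∞ (Prod.fst : ℝ × ℝ → ℝ) (t, (0 : ℝ)) := contDiffAt_fst
  have hsnd : ContDiffAt ℝ ∞ (Prod.snd : ℝ × ℝ → ℝ) (t, (0 : ℝ)) := contDiffAt_snd
  have hlift : ∀ {u : ℝ → E}, ContDiffWithinAt ℝ ∞ u S t →
      ContDiffAt ℝ ∞ (fun p : ℝ × ℝ => u p.1) (t, (0 : ℝ)) := fun h =>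
    ContDiffAt.comp (f := (Prod.fst : ℝ × ℝ → ℝ)) (t, (0 : ℝ)) (hat h) hfst
  have hX := (hlift hx).add (hsnd.smul (hlift hv))
  have hY := (hlift hys).add (hsnd.smul (hlift hws))
  have hf : ContDiffAt ℝ ∞ f (t, 0) := by
    have h1 : ContDiffAt ℝ ∞ (totalForm ℓ) (x t + (0 : ℝ) • v t, y t + (0 : ℝ) • w t) := by
      rw [hc0, hc0]; exact hℓ.contDiffAt_totalForm hz
    exact (ContDiffAt.clm_apply (ContDiffAt.comp (g := totalForm ℓ)
      (f := fun p : ℝ × ℝ => (x p.1 + p.2 • v p.1, y p.1 + p.2 • w p.1)) (t, (0 : ℝ)) h1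
      (hX.prodMk hY)) (hlift hzs)).clm_apply hY
  -- The Cartan term has the reference vector y in its last slot and drops out. The covariant
  -- s-derivative of the velocity is w + N v, the covariant t-derivative of the variational field:
  -- this is where the symmetry of the connection enters.
  have hα : ∀ᶠ τ in 𝓝 t, HasDerivAt (fun σ => f (τ, σ))
      (totalForm ℓ (x τ, y τ) (christoffel ℓ (x τ) (y τ) (z τ) (v τ)) (y τ)
        + totalForm ℓ (x τ, y τ) (z τ) (localPrime ℓ S x v τ)) 0 := by
    filter_upwards [hΩ] with τ h1
    have h2 := hℓ.hasDerivWithinAt_totalForm (S := univ) (t := 0)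
      (x := fun σ : ℝ => x τ + σ • v τ) (y := fun σ : ℝ => y τ + σ • w τ)
      (X := fun _ => z τ) (Y := fun σ : ℝ => y τ + σ • w τ) (by simpa using h1)
      (hline (x τ) (v τ)).hasDerivWithinAt (hline (y τ) (w τ)).hasDerivWithinAt
      (hasDerivAt_const _ _).hasDerivWithinAt (hline (y τ) (w τ)).hasDerivWithinAt
    rw [hasDerivWithinAt_univ] at h2
    simp only [hc0, zero_add] at h2
    have h3 := hℓ.cartanForm_self_right h1
    have h4 := hℓ.christoffel_self_left h1
    simp only at h3 h4
    rw [h3, h4, mul_zero, add_zero] at h2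
    exact h2
  -- The same cancellation on each nearby curve, whose reference vector is y + σw; the covariant
  -- acceleration of that curve involves its spray.
  have hβ : ∀ᶠ σ in 𝓝 (0 : ℝ), HasDerivAt (fun τ => f (τ, σ))
      (totalForm ℓ (x t + σ • v t, y t + σ • w t) (derivWithin z S t
          + christoffel ℓ (x t + σ • v t) (y t + σ • w t) (z t) (y t + σ • w t)) (y t + σ • w t)
        + totalForm ℓ (x t + σ • v t, y t + σ • w t) (z t) (derivWithin y S t
          + σ • derivWithin w S t + spray ℓ (x t + σ • v t, y t + σ • w t))) t := by
    filter_upwards [hΩ'] with σ h1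
    have h2 := hℓ.hasDerivWithinAt_totalForm (S := univ) (t := t)
      (x := fun τ : ℝ => x τ + σ • v τ) (y := fun τ : ℝ => y τ + σ • w τ)
      (X := z) (Y := fun τ : ℝ => y τ + σ • w τ) h1
      ((hder hx).add ((hder hv).const_smul σ)).hasDerivWithinAt
      ((hder hys).add ((hder hws).const_smul σ)).hasDerivWithinAt
      (hder hzs).hasDerivWithinAt
      ((hder hys).add ((hder hws).const_smul σ)).hasDerivWithinAt
    rw [hasDerivWithinAt_univ] at h2
    have h3 := hℓ.cartanForm_self_right h1
    have h4 := hℓ.christoffel_self_left h1 (y t + σ • w t)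
    rw [hℓ.nonlinearConnection_self h1] at h4
    simp only at h3 h4
    simp only [← hy, ← hw] at h2
    rw [h3, h4, mul_zero, add_zero] at h2
    exact h2
  have hE' : derivWithin y S t + nonlinearConnection ℓ (x t) (y t) (y t) = 0 := hgeo
  have hsp0 : derivWithin y S t + spray ℓ (x t, y t) = 0 := by
    rw [← hℓ.nonlinearConnection_self hz]; exact hgeo
  have hB : ContDiffAt ℝ ∞ (fun τ => christoffel ℓ (x τ) (y τ) (z τ) (v τ)) t :=
    hℓ.contDiffAt_christoffel hz (hat hx) (hat hys) (hat hzs) (hat hv)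
  have hB' := hder hB.contDiffWithinAt
  have hlp := hder (hℓ.contDiffWithinAt_localPrime hS ht hx hv hz)
  -- Second derivative along s = 0. The Cartan terms here carry the covariant acceleration of the
  -- curve, which is zero for a geodesic.
  have hα' := ((hℓ.hasDerivWithinAt_totalForm (S := univ) hz (hder hx).hasDerivWithinAt
      (hder hys).hasDerivWithinAt hB'.hasDerivWithinAt
      (hder hys).hasDerivWithinAt).add
    (hℓ.hasDerivWithinAt_totalForm (S := univ) hz (hder hx).hasDerivWithinAt
      (hder hys).hasDerivWithinAt (hder hzs).hasDerivWithinAt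
      hlp.hasDerivWithinAt))
  rw [hasDerivWithinAt_univ] at hα'
  have hz0 : (x t + (0 : ℝ) • v t, y t + (0 : ℝ) • w t) ∈ Ω := by rw [hc0, hc0]; exact hz
  have hlineS : ∀ a b : E, ContDiffAt ℝ ∞ (fun σ : ℝ => a + σ • b) 0 := fun a b =>
    contDiffAt_const.add (contDiffAt_id.smul contDiffAt_const)
  have hP : DifferentiableAt ℝ (fun σ : ℝ =>
      christoffel ℓ (x t + σ • v t) (y t + σ • w t) (z t) (y t + σ • w t)) 0 :=
    (hℓ.contDiffAt_christoffel hz0 (hlineS _ _) (hlineS _ _) contDiffAt_const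
      (hlineS _ _)).differentiableAt (by simp)
  have hsp : HasDerivAt (fun σ : ℝ => spray ℓ (x t + σ • v t, y t + σ • w t))
      (fderiv ℝ (spray ℓ) (x t, y t) (v t, w t)) 0 := by
    have : HasFDerivAt (spray ℓ) (fderiv ℝ (spray ℓ) (x t, y t))
        (x t + (0 : ℝ) • v t, y t + (0 : ℝ) • w t) := by
      rw [hc0, hc0]; exact ((hℓ.contDiffAt_spray hz).differentiableAt (by simp)).hasFDerivAt
    exact this.comp_hasDerivAt (0 : ℝ) ((hline _ _).prodMk (hline _ _))
  -- Second derivative across the variation. The first Cartan term contains the reference vector;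
  -- the second contains the acceleration of the middle curve, zero by `hsp0`. Differentiating that
  -- acceleration in σ produces the linearized spray.
  have hβ' := ((hℓ.hasDerivWithinAt_totalForm (S := univ) (t := (0 : ℝ)) hz0
      (hline (x t) (v t)).hasDerivWithinAt (hline (y t) (w t)).hasDerivWithinAt
      (hP.hasDerivAt.const_add (derivWithin z S t)).hasDerivWithinAt
      (hline (y t) (w t)).hasDerivWithinAt).add
    (hℓ.hasDerivWithinAt_totalForm (S := univ) (t := (0 : ℝ)) hz0
      (hline (x t) (v t)).hasDerivWithinAt (hline (y t) (w t)).hasDerivWithinAt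
      (hasDerivAt_const (0 : ℝ) (z t)).hasDerivWithinAt
      ((hline (derivWithin y S t) (derivWithin w S t)).add hsp).hasDerivWithinAt))
  rw [hasDerivWithinAt_univ] at hβ'
  -- The pairing of the covariant derivatives of z and v along the curve occurs on both sides and
  -- cancels. What survives is the curvature on z paired with the velocity, and z paired with the
  -- curvature on the velocity.
  have key := mixed_partials_eq hf hα hβ hα' hβ'
  have hC := hℓ.cartanForm_self_right hz
  have hN := hℓ.christoffel_self_right hz
  have hN' := hℓ.christoffel_self_left hz
  simp only at hC hN hN'
  have hlpt : w t + nonlinearConnection ℓ (x t) (y t) (v t) = localPrime ℓ S x v t := rfl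
  simp only [← hy, hc0, hE', hsp0, hC, map_zero, zero_apply, mul_zero, add_zero, zero_add,
    christoffel_zero_left, hN, hN', hlpt, Pi.add_apply] at key
  rw [localPrime, ← hy, linearizedSpray, ← hy, ← hw]
  simp only [hN, map_add, map_sub, add_apply, sub_apply] at key ⊢
  linarith

end IsLocalMetric

end CurvesInAChart

end PseudoFinsler

end

/-! ### Charts of the tangent bundle and the metric read in them. -/

noncomputable section

namespace PseudoFinsler

section Charts

variable {E M : Type*} [NormedAddCommGroup E] [NormedSpace ℝ E]
  [TopologicalSpace M] [ChartedSpace E M] [IsManifold 𝓘(ℝ, E) ∞ M]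

/-- The transition map from the preferred chart at `p` to the one at `q`. -/
def transition (p q : M) : E → E := extChartAt 𝓘(ℝ, E) q ∘ (extChartAt 𝓘(ℝ, E) p).symm

/-- The domain of the transition map. -/
def transitionDom (p q : M) : Set E :=
  (extChartAt 𝓘(ℝ, E) p).target ∩ (extChartAt 𝓘(ℝ, E) p).symm ⁻¹' (extChartAt 𝓘(ℝ, E) q).source

omit [IsManifold 𝓘(ℝ, E) ∞ M] in
theorem isOpen_transitionDom (p q : M) : IsOpen (transitionDom (E := E) p q) :=
  (continuousOn_extChartAt_symm p).isOpen_inter_preimage (isOpen_extChartAt_target p)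
    (isOpen_extChartAt_source q)

theorem contDiffAt_transition (p q : M) {x : E} (hx : x ∈ transitionDom p q) :
    ContDiffAt ℝ ∞ (transition p q) x := by
  have h := contDiffOn_ext_coord_change (I := 𝓘(ℝ, E)) (n := ∞) q p
  exact h.contDiffAt ((isOpen_transitionDom p q).mem_nhds hx)

theorem fderiv_transition (p q : M) {x : E} (hx : x ∈ (extChartAt 𝓘(ℝ, E) p).target) :
    fderiv ℝ (transition p q) x =
      tangentCoordChange 𝓘(ℝ, E) p q ((extChartAt 𝓘(ℝ, E) p).symm x) := by
  rw [tangentCoordChange_def, (extChartAt 𝓘(ℝ, E) p).right_inv hx]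
  simp [transition, fderivWithin_univ]

theorem fibreCoord_eq (p : M) (z : TangentBundle 𝓘(ℝ, E) M) :
    fibreCoord p z = tangentCoordChange 𝓘(ℝ, E) z.1 p z.1 z.2 := rfl

theorem fibreCoord_self (p : M) (v : TangentSpace 𝓘(ℝ, E) p) :
    fibreCoord p (⟨p, v⟩ : TangentBundle 𝓘(ℝ, E) M) = v :=
  tangentCoordChange_self (mem_extChartAt_source p)

theorem fibreCoord_smul (p q : M) (c : ℝ) (v : TangentSpace 𝓘(ℝ, E) q) :
    fibreCoord p (⟨q, c • v⟩ : TangentBundle 𝓘(ℝ, E) M) =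
      c • fibreCoord p (⟨q, v⟩ : TangentBundle 𝓘(ℝ, E) M) :=
  map_smul (tangentCoordChange 𝓘(ℝ, E) q p q) c v

/-- The vector at `q` with fibre coordinate `y` in the chart at `p`. -/
def ofFibreCoord (p q : M) (y : E) : TangentSpace 𝓘(ℝ, E) q := tangentCoordChange 𝓘(ℝ, E) p q q y

theorem ofFibreCoord_smul (p q : M) (c : ℝ) (y : E) :
    ofFibreCoord p q (c • y) = c • ofFibreCoord p q y :=
  map_smul (tangentCoordChange 𝓘(ℝ, E) p q q) c y

theorem fibreCoord_ofFibreCoord {p q : M} (hq : q ∈ (extChartAt 𝓘(ℝ, E) p).source) (y : E) :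
    fibreCoord p (⟨q, ofFibreCoord p q y⟩ : TangentBundle 𝓘(ℝ, E) M) = y := by
  rw [fibreCoord_eq, ofFibreCoord, tangentCoordChange_comp ⟨⟨hq, mem_extChartAt_source q⟩, hq⟩,
    tangentCoordChange_self hq]

theorem ofFibreCoord_fibreCoord {p q : M} (hq : q ∈ (extChartAt 𝓘(ℝ, E) p).source)
    (v : TangentSpace 𝓘(ℝ, E) q) :
    ofFibreCoord p q (fibreCoord p (⟨q, v⟩ : TangentBundle 𝓘(ℝ, E) M)) = v := by
  have h1 := tangentCoordChange_comp (E := E) (I := 𝓘(ℝ, E)) (v := v)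
    ⟨⟨mem_extChartAt_source (I := 𝓘(ℝ, E)) q, hq⟩, mem_extChartAt_source q⟩
  exact h1.trans (tangentCoordChange_self (mem_extChartAt_source q))

theorem fibreCoord_change {p q r : M} (hp : r ∈ (extChartAt 𝓘(ℝ, E) p).source)
    (hq : r ∈ (extChartAt 𝓘(ℝ, E) q).source) (v : TangentSpace 𝓘(ℝ, E) r) :
    fibreCoord q (⟨r, v⟩ : TangentBundle 𝓘(ℝ, E) M) =
      fderiv ℝ (transition p q) (extChartAt 𝓘(ℝ, E) p r)
        (fibreCoord p (⟨r, v⟩ : TangentBundle 𝓘(ℝ, E) M)) := by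
  rw [fderiv_transition p q ((extChartAt 𝓘(ℝ, E) p).map_source hp),
    (extChartAt 𝓘(ℝ, E) p).left_inv hp, fibreCoord_eq, fibreCoord_eq]
  exact (tangentCoordChange_comp ⟨⟨mem_extChartAt_source r, hp⟩, hq⟩).symm

theorem transition_surjective (p q : M) {x : E} (hx : x ∈ transitionDom p q) :
    Function.Surjective (fderiv ℝ (transition p q) x) := by
  have hp := (extChartAt 𝓘(ℝ, E) p).map_target hx.1
  intro w
  refine ⟨fibreCoord p ⟨(extChartAt 𝓘(ℝ, E) p).symm x, ofFibreCoord q _ w⟩, ?_⟩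
  have := fibreCoord_change hp hx.2 (ofFibreCoord q _ w)
  rw [fibreCoord_ofFibreCoord hx.2, (extChartAt 𝓘(ℝ, E) p).right_inv hx.1] at this
  exact this.symm

omit [IsManifold 𝓘(ℝ, E) ∞ M] in
theorem extChartAt_mem_transitionDom {p q r : M} (hp : r ∈ (extChartAt 𝓘(ℝ, E) p).source)
    (hq : r ∈ (extChartAt 𝓘(ℝ, E) q).source) :
    extChartAt 𝓘(ℝ, E) p r ∈ transitionDom p q :=
  ⟨(extChartAt 𝓘(ℝ, E) p).map_source hp, by
    rw [mem_preimage, (extChartAt 𝓘(ℝ, E) p).left_inv hp]; exact hq⟩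

theorem mem_tangentChart_source {p : M} {z : TangentBundle 𝓘(ℝ, E) M}
    (hz : z.1 ∈ (extChartAt 𝓘(ℝ, E) p).source) :
    z ∈ (extChartAt 𝓘(ℝ, E).tangent (⟨p, 0⟩ : TangentBundle 𝓘(ℝ, E) M)).source := by
  rw [extChartAt_source] at hz ⊢
  rwa [TangentBundle.mem_chart_source_iff]

theorem tangentChart_apply (p : M) (z : TangentBundle 𝓘(ℝ, E) M) :
    extChartAt 𝓘(ℝ, E).tangent (⟨p, 0⟩ : TangentBundle 𝓘(ℝ, E) M) z =
      (extChartAt 𝓘(ℝ, E) p z.1, fibreCoord p z) := rfl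

theorem tangentChart_symm {p : M} {x : E} (hx : x ∈ (extChartAt 𝓘(ℝ, E) p).target) (y : E) :
    (extChartAt 𝓘(ℝ, E).tangent (⟨p, 0⟩ : TangentBundle 𝓘(ℝ, E) M)).symm (x, y) =
      ⟨(extChartAt 𝓘(ℝ, E) p).symm x, ofFibreCoord p _ y⟩ := by
  have hq := (extChartAt 𝓘(ℝ, E) p).map_target hx
  rw [← PartialEquiv.left_inv _ (mem_tangentChart_source (p := p)
    (z := ⟨(extChartAt 𝓘(ℝ, E) p).symm x, ofFibreCoord p _ y⟩) hq), tangentChart_apply,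
    fibreCoord_ofFibreCoord hq]
  rw [(extChartAt 𝓘(ℝ, E) p).right_inv hx]

theorem mem_tangentChart_target {p : M} {z : E × E} :
    z ∈ (extChartAt 𝓘(ℝ, E).tangent (⟨p, 0⟩ : TangentBundle 𝓘(ℝ, E) M)).target ↔
      z.1 ∈ (extChartAt 𝓘(ℝ, E) p).target := by
  constructor
  · intro hz
    have h1 := PartialEquiv.map_target _ hz
    rw [extChartAt_source, TangentBundle.mem_chart_source_iff] at h1
    have h2 := congrArg Prod.fst (PartialEquiv.right_inv _ hz)
    rw [tangentChart_apply] at h2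
    simp only at h2
    rw [← h2]
    exact (extChartAt 𝓘(ℝ, E) p).map_source (by rw [extChartAt_source]; exact h1)
  · intro hz
    have hq := (extChartAt 𝓘(ℝ, E) p).map_target hz
    have h := PartialEquiv.map_source _ (mem_tangentChart_source (p := p)
      (z := ⟨(extChartAt 𝓘(ℝ, E) p).symm z.1, ofFibreCoord p _ z.2⟩) hq)
    rwa [tangentChart_apply, fibreCoord_ofFibreCoord hq,
      (extChartAt 𝓘(ℝ, E) p).right_inv hz] at h

theorem fundForm_comp {f : E → ℝ} (A : E →L[ℝ] E) {y : E} (hf : ContDiffAt ℝ ∞ f (A y)) (u w : E) :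
    fundForm (fun y => f (A y)) y u w = fundForm f (A y) (A u) (A w) := by
  have h1 : ∀ᶠ y' in 𝓝 y, DifferentiableAt ℝ f (A y') := by
    have := ((hf.of_le (m := 1) (by simp)).eventually (by simp)).mono
      fun z hz => hz.differentiableAt (by simp)
    exact A.continuous.continuousAt.eventually this
  have h2 : fderiv ℝ (fun y => f (A y)) =ᶠ[𝓝 y] fun y => (fderiv ℝ f (A y)).comp A := by
    filter_upwards [h1] with y' hy'
    exact (HasFDerivAt.comp (g := f) (f := A) y' hy'.hasFDerivAt A.hasFDerivAt).fderiv
  have h3 : HasFDerivAt (fderiv ℝ f) (fderiv ℝ (fderiv ℝ f) (A y)) (A y) :=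
    ((hf.fderiv_right (m := ∞) (by simp)).differentiableAt (by simp)).hasFDerivAt
  have h4 : HasFDerivAt (fun y => fderiv ℝ f (A y)) _ y :=
    HasFDerivAt.comp (g := fderiv ℝ f) (f := A) y h3 A.hasFDerivAt
  have h5 := (h4.clm_comp (hasFDerivAt_const A y)).congr_of_eventuallyEq h2
  simp only [fundForm, h5.fderiv, smul_apply, add_apply]
  simp

namespace Metric

variable (F : Metric E M)

/-- The domain of the coordinate expression of the metric in the preferred chart at `p`. -/
def localDom (p : M) : Set (E × E) :=
  (extChartAt 𝓘(ℝ, E).tangent (⟨p, 0⟩ : TangentBundle 𝓘(ℝ, E) M)).target ∩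
    (extChartAt 𝓘(ℝ, E).tangent (⟨p, 0⟩ : TangentBundle 𝓘(ℝ, E) M)).symm ⁻¹' F.dom

theorem localL_eq (p : M) {x : E} (hx : x ∈ (extChartAt 𝓘(ℝ, E) p).target) (y : E) :
    F.localL p x y = F.L ⟨(extChartAt 𝓘(ℝ, E) p).symm x, ofFibreCoord p _ y⟩ := by
  rw [localL, tangentChart_symm hx]

theorem mem_localDom {p : M} {z : E × E} : z ∈ F.localDom p ↔
    z.1 ∈ (extChartAt 𝓘(ℝ, E) p).target ∧
      (⟨(extChartAt 𝓘(ℝ, E) p).symm z.1, ofFibreCoord p _ z.2⟩ : TangentBundle 𝓘(ℝ, E) M) ∈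
        F.dom := by
  rw [localDom, mem_inter_iff, mem_tangentChart_target]
  refine and_congr_right fun h => ?_
  rw [mem_preimage, ← tangentChart_symm h]

theorem mem_localDom_of_mem_dom {p : M} {z : TangentBundle 𝓘(ℝ, E) M}
    (hz : z.1 ∈ (extChartAt 𝓘(ℝ, E) p).source) (h : z ∈ F.dom) :
    (extChartAt 𝓘(ℝ, E) p z.1, fibreCoord p z) ∈ F.localDom p := by
  rw [← tangentChart_apply]
  refine ⟨PartialEquiv.map_source _ (mem_tangentChart_source hz), ?_⟩
  rwa [mem_preimage, PartialEquiv.left_inv _ (mem_tangentChart_source hz)]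

theorem contDiffAt_localL (p : M) {z : E × E} (hz : z ∈ F.localDom p) :
    ContDiffAt ℝ ∞ (totalFn (F.localL p)) z := by
  have h1 := contMDiffOn_extChartAt_symm (I := 𝓘(ℝ, E).tangent) (n := ∞)
    (⟨p, 0⟩ : TangentBundle 𝓘(ℝ, E) M)
  have h2 : ContMDiffAt 𝓘(ℝ, E × E) 𝓘(ℝ, E).tangent ∞ _ z :=
    (h1 z hz.1).contMDiffAt ((isOpen_extChartAt_target _).mem_nhds hz.1)
  have h3 := (F.smooth _ hz.2).contMDiffAt (F.isOpen_dom.mem_nhds hz.2)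
  exact (h3.comp z h2).contDiffAt

theorem slice_eq (p : M) (v : E) :
    F.L (⟨p, v⟩ : TangentBundle 𝓘(ℝ, E) M) = F.localL p (extChartAt 𝓘(ℝ, E) p p) v := by
  have := tangentChart_symm (mem_extChartAt_target (I := 𝓘(ℝ, E)) p) v
  rw [localL, this]
  -- The inverse chart returns `p` only up to a propositional equality on which the fibre depends.
  -- Stating the identity for every `q` equal to `p` allows substitution.
  have h : ∀ q : M, q = p → (⟨p, v⟩ : TangentBundle 𝓘(ℝ, E) M) = ⟨q, ofFibreCoord p q v⟩ := by
    rintro q rfl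
    rw [ofFibreCoord, tangentCoordChange_self (mem_extChartAt_source _)]
  rw [← h _ ((extChartAt 𝓘(ℝ, E) p).left_inv (mem_extChartAt_source p))]

theorem g_eq (p : M) (v : TangentSpace 𝓘(ℝ, E) p) :
    F.g p v = totalForm (F.localL p) (extChartAt 𝓘(ℝ, E) p p, v) := by
  have : (fun y : E => F.L (⟨p, y⟩ : TangentBundle 𝓘(ℝ, E) M)) =
      F.localL p (extChartAt 𝓘(ℝ, E) p p) := funext (F.slice_eq p)
  rw [g, this]; rfl

theorem isLocalMetric (p : M) : IsLocalMetric (F.localDom p) (F.localL p) where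
  isOpen := (continuousOn_extChartAt_symm _).isOpen_inter_preimage (isOpen_extChartAt_target _)
    F.isOpen_dom
  smooth _ hz := F.contDiffAt_localL p hz
  conic z hz c hc := by
    rw [mem_localDom] at hz ⊢
    refine ⟨hz.1, ?_⟩
    rw [ofFibreCoord_smul]
    exact F.conic _ hz.2 c hc
  homogeneous z hz c hc := by
    rw [mem_localDom] at hz
    rw [F.localL_eq p hz.1, F.localL_eq p hz.1, ← F.homogeneous _ hz.2 c hc, ofFibreCoord_smul]
  nondegenerate z hz u hu := by
    have hz' := F.mem_localDom.1 hz
    have hq := (extChartAt 𝓘(ℝ, E) p).map_target hz'.1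
    set q := (extChartAt 𝓘(ℝ, E) p).symm z.1
    have h1 : F.localL p z.1 = fun y => F.L ⟨q, tangentCoordChange 𝓘(ℝ, E) p q q y⟩ :=
      funext (F.localL_eq p hz'.1)
    have h2 : (extChartAt 𝓘(ℝ, E) q q, ofFibreCoord p q z.2) ∈ F.localDom q := by
      have := F.mem_localDom_of_mem_dom (p := q) (mem_extChartAt_source q) hz'.2
      rwa [fibreCoord_self] at this
    have h3 : ContDiffAt ℝ ∞ (fun y : E => F.L (⟨q, y⟩ : TangentBundle 𝓘(ℝ, E) M))
        (tangentCoordChange 𝓘(ℝ, E) p q q z.2) := by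
      rw [funext (F.slice_eq q)]
      exact (F.contDiffAt_localL q h2).comp
        (f := fun y => (extChartAt 𝓘(ℝ, E) q q, y)) _ (contDiffAt_const.prodMk contDiffAt_id)
    -- The passage between fibre coordinates at `p` and at `q` is an isomorphism of fibres. A
    -- degenerate direction in the chart at `p` would therefore be one for the intrinsic fundamental
    -- tensor at `q`.
    have h4 : ∀ w, fundForm (fun y : E => F.L (⟨q, y⟩ : TangentBundle 𝓘(ℝ, E) M))
        (ofFibreCoord p q z.2) (ofFibreCoord p q u) w = 0 := by
      intro w
      have h5 := hu (fibreCoord p ⟨q, w⟩)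
      rw [totalForm, h1, fundForm_comp (f := fun y : E => F.L ⟨q, y⟩) _ h3] at h5
      have h6 := ofFibreCoord_fibreCoord (E := E) hq w
      rw [ofFibreCoord] at h6
      rwa [h6] at h5
    have h5 := F.nondegenerate _ hz'.2 _ h4
    have h6 := fibreCoord_ofFibreCoord (E := E) hq u
    rw [h5, fibreCoord_eq, map_zero] at h6
    exact h6.symm

/-- Both coordinate expressions read the same function `F.L`. This transfers all transformation laws
to the manifold. -/
theorem isMetricChange (p q : M) :
    IsMetricChange (F.localDom p) (F.localL p) (F.localDom q) (F.localL q)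
      (transitionDom p q) (transition p q) where
  source := F.isLocalMetric p
  target := F.isLocalMetric q
  isOpen := isOpen_transitionDom p q
  smooth _ hx := contDiffAt_transition p q hx
  surjective _ hx := transition_surjective p q hx
  maps z hz hU := by
    have hz' := F.mem_localDom.1 hz
    have hp := (extChartAt 𝓘(ℝ, E) p).map_target hz'.1
    have h1 := F.mem_localDom_of_mem_dom (p := q)
      (z := ⟨(extChartAt 𝓘(ℝ, E) p).symm z.1, ofFibreCoord p _ z.2⟩) hU.2 hz'.2
    rw [fibreCoord_change hp hU.2, fibreCoord_ofFibreCoord hp,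
      (extChartAt 𝓘(ℝ, E) p).right_inv hz'.1] at h1
    exact h1
  eq x hx y := by
    have hp := (extChartAt 𝓘(ℝ, E) p).map_target hx.1
    rw [F.localL_eq p hx.1, localL]
    have h1 := PartialEquiv.left_inv _ (mem_tangentChart_source (p := q)
      (z := ⟨(extChartAt 𝓘(ℝ, E) p).symm x, ofFibreCoord p _ y⟩) hx.2)
    rw [← h1, tangentChart_apply, fibreCoord_change hp hx.2, fibreCoord_ofFibreCoord hp,
      (extChartAt 𝓘(ℝ, E) p).right_inv hx.1]
    rfl

/-- The fundamental tensor in the preferred chart at another point. -/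
theorem g_apply_eq [FiniteDimensional ℝ E] {p q : M} (hq : q ∈ (extChartAt 𝓘(ℝ, E) p).source)
    {v : TangentSpace 𝓘(ℝ, E) q} (hv : (⟨q, v⟩ : TangentBundle 𝓘(ℝ, E) M) ∈ F.dom)
    (u w : TangentSpace 𝓘(ℝ, E) q) :
    F.g q v u w = totalForm (F.localL p)
      (extChartAt 𝓘(ℝ, E) p q, fibreCoord p (⟨q, v⟩ : TangentBundle 𝓘(ℝ, E) M))
      (fibreCoord p (⟨q, u⟩ : TangentBundle 𝓘(ℝ, E) M))
      (fibreCoord p (⟨q, w⟩ : TangentBundle 𝓘(ℝ, E) M)) := by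
  have hqq := mem_extChartAt_source (I := 𝓘(ℝ, E)) q
  have h1 := F.mem_localDom_of_mem_dom (p := q) hqq hv
  rw [fibreCoord_self] at h1
  have h2 := (F.isMetricChange q p).totalForm_eq h1 (extChartAt_mem_transitionDom hqq hq) u w
  rw [F.g_eq, h2, fibreCoord_change hqq hq, fibreCoord_change hqq hq u, fibreCoord_change hqq hq w,
    fibreCoord_self, fibreCoord_self, fibreCoord_self]
  have h3 : transition q p (extChartAt 𝓘(ℝ, E) q q) = extChartAt 𝓘(ℝ, E) p q := by
    simp [transition]
  rw [← h3]
  rfl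

end Metric

end Charts

end PseudoFinsler

end

/-! ### Covariant derivative and Jacobi defect along curves on the manifold. -/

noncomputable section

namespace PseudoFinsler

section CurvesOnManifold

variable {E M : Type*} [NormedAddCommGroup E] [NormedSpace ℝ E]
  [TopologicalSpace M] [ChartedSpace E M] [IsManifold 𝓘(ℝ, E) ∞ M]

/-- The coordinate expression of a curve. -/
def chartCurve (E : Type*) {M : Type*} [NormedAddCommGroup E] [NormedSpace ℝ E]
    [TopologicalSpace M] [ChartedSpace E M] (p : M) (γ : ℝ → M) (τ : ℝ) : E :=
  extChartAt 𝓘(ℝ, E) p (γ τ)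

/-- The coordinate expression of a vector field along a curve. -/
def chartField (p : M) (γ : ℝ → M) (V : (t : ℝ) → TangentSpace 𝓘(ℝ, E) (γ t)) (τ : ℝ) : E :=
  fibreCoord p (⟨γ τ, V τ⟩ : TangentBundle 𝓘(ℝ, E) M)

variable {S : Set ℝ} {γ : ℝ → M} {V : (t : ℝ) → TangentSpace 𝓘(ℝ, E) (γ t)} {t : ℝ} {p q : M}

theorem chartField_self (γ : ℝ → M) (V : (t : ℝ) → TangentSpace 𝓘(ℝ, E) (γ t)) (t : ℝ) :
    chartField (γ t) γ V t = V t := fibreCoord_self (γ t) (V t)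

omit [IsManifold 𝓘(ℝ, E) ∞ M] in
theorem eventually_mem_source (hγ : ContMDiffOn 𝓘(ℝ, ℝ) 𝓘(ℝ, E) ∞ γ S) (ht : t ∈ S)
    (hp : γ t ∈ (extChartAt 𝓘(ℝ, E) p).source) :
    ∀ᶠ τ in 𝓝[S] t, γ τ ∈ (extChartAt 𝓘(ℝ, E) p).source :=
  (hγ t ht).continuousWithinAt.eventually_mem ((isOpen_extChartAt_source p).mem_nhds hp)

theorem contDiffWithinAt_chartCurve (hγ : ContMDiffOn 𝓘(ℝ, ℝ) 𝓘(ℝ, E) ∞ γ S) (ht : t ∈ S)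
    (hp : γ t ∈ (extChartAt 𝓘(ℝ, E) p).source) :
    ContDiffWithinAt ℝ ∞ (chartCurve E p γ) S t := by
  rw [extChartAt_source] at hp
  exact ((contMDiffWithinAt_iff_target_of_mem_source hp).1 (hγ t ht)).2.contDiffWithinAt

theorem isSmoothFieldAlong_iff (hγ : ContMDiffOn 𝓘(ℝ, ℝ) 𝓘(ℝ, E) ∞ γ S) (ht : t ∈ S)
    (hp : γ t ∈ (extChartAt 𝓘(ℝ, E) p).source) :
    ContMDiffWithinAt 𝓘(ℝ, ℝ) 𝓘(ℝ, E).tangent ∞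
      (fun t => (⟨γ t, V t⟩ : TangentBundle 𝓘(ℝ, E) M)) S t ↔
    ContDiffWithinAt ℝ ∞ (chartField p γ V) S t := by
  have h := Bundle.Trivialization.contMDiffWithinAt_iff (n := ∞) (IM := 𝓘(ℝ, ℝ)) (IB := 𝓘(ℝ, E))
    (e := trivializationAt E (TangentSpace 𝓘(ℝ, E)) p)
    (f := fun t => (⟨γ t, V t⟩ : TangentBundle 𝓘(ℝ, E) M)) (s := S) (x₀ := t) (by
      rw [TangentBundle.trivializationAt_source]; rwa [extChartAt_source] at hp)
  rw [← contMDiffWithinAt_iff_contDiffWithinAt]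
  exact h.trans (and_iff_right (hγ t ht))

theorem IsSmoothFieldAlong.contDiffWithinAt (hV : IsSmoothFieldAlong S γ V)
    (hγ : ContMDiffOn 𝓘(ℝ, ℝ) 𝓘(ℝ, E) ∞ γ S) (ht : t ∈ S)
    (hp : γ t ∈ (extChartAt 𝓘(ℝ, E) p).source) :
    ContDiffWithinAt ℝ ∞ (chartField p γ V) S t :=
  (isSmoothFieldAlong_iff hγ ht hp).1 (hV t ht)

omit [IsManifold 𝓘(ℝ, E) ∞ M] in
theorem chartCurve_change (hp : γ t ∈ (extChartAt 𝓘(ℝ, E) p).source) :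
    transition p q (chartCurve E p γ t) = chartCurve E q γ t := by
  simp only [transition, chartCurve, Function.comp_apply]
  rw [(extChartAt 𝓘(ℝ, E) p).left_inv hp]

theorem chartField_change (hp : γ t ∈ (extChartAt 𝓘(ℝ, E) p).source)
    (hq : γ t ∈ (extChartAt 𝓘(ℝ, E) q).source) :
    chartField q γ V t =
      fderiv ℝ (transition p q) (chartCurve E p γ t) (chartField p γ V t) :=
  fibreCoord_change hp hq (V t)

omit [IsManifold 𝓘(ℝ, E) ∞ M] in
theorem eventually_chartCurve_change (hγ : ContMDiffOn 𝓘(ℝ, ℝ) 𝓘(ℝ, E) ∞ γ S) (ht : t ∈ S)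
    (hp : γ t ∈ (extChartAt 𝓘(ℝ, E) p).source) :
    chartCurve E q γ =ᶠ[𝓝[S] t] fun τ => transition p q (chartCurve E p γ τ) := by
  filter_upwards [eventually_mem_source hγ ht hp] with τ h1
  exact (chartCurve_change h1).symm

theorem eventually_chartField_change (hγ : ContMDiffOn 𝓘(ℝ, ℝ) 𝓘(ℝ, E) ∞ γ S) (ht : t ∈ S)
    (hp : γ t ∈ (extChartAt 𝓘(ℝ, E) p).source) (hq : γ t ∈ (extChartAt 𝓘(ℝ, E) q).source) :
    chartField q γ V =ᶠ[𝓝[S] t]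
      fun τ => fderiv ℝ (transition p q) (chartCurve E p γ τ) (chartField p γ V τ) := by
  filter_upwards [eventually_mem_source hγ ht hp, eventually_mem_source hγ ht hq] with τ h1 h2
  exact chartField_change h1 h2

/-- Coordinate identities hold only while the curve stays in the charts concerned. Second-order
expressions therefore need the first derivatives to agree as germs, not only at `t`. -/
theorem derivWithin_eventuallyEq {w z : ℝ → E} (h : w =ᶠ[𝓝[S] t] z) :
    derivWithin w S =ᶠ[𝓝[S] t] derivWithin z S := by
  filter_upwards [eventually_eventually_nhdsWithin.2 h, self_mem_nhdsWithin] with τ h1 h2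
  exact EventuallyEq.derivWithin_eq h1 (Filter.Eventually.self_of_nhdsWithin (p := fun σ => w σ = z σ) h1 h2)

theorem localPrime_congr {ℓ : E → E → ℝ} {x x' v v' : ℝ → E} (ht : t ∈ S) (hx : x =ᶠ[𝓝[S] t] x')
    (hv : v =ᶠ[𝓝[S] t] v') : localPrime ℓ S x v t = localPrime ℓ S x' v' t := by
  rw [localPrime, localPrime, hx.derivWithin_eq (hx.self_of_nhdsWithin ht),
    hv.derivWithin_eq (hv.self_of_nhdsWithin ht), hx.self_of_nhdsWithin ht,
    hv.self_of_nhdsWithin ht]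

theorem linearizedSpray_congr {ℓ : E → E → ℝ} {x x' v v' : ℝ → E} (ht : t ∈ S)
    (hx : x =ᶠ[𝓝[S] t] x') (hv : v =ᶠ[𝓝[S] t] v') :
    linearizedSpray ℓ S x v t = linearizedSpray ℓ S x' v' t := by
  have h := derivWithin_eventuallyEq hv
  rw [linearizedSpray, linearizedSpray, hx.derivWithin_eq (hx.self_of_nhdsWithin ht),
    h.derivWithin_eq (h.self_of_nhdsWithin ht), h.self_of_nhdsWithin ht, hx.self_of_nhdsWithin ht,
    hv.self_of_nhdsWithin ht]

omit [IsManifold 𝓘(ℝ, E) ∞ M] in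
theorem velocity_eq (hγ : ContMDiffOn 𝓘(ℝ, ℝ) 𝓘(ℝ, E) ∞ γ S) (ht : t ∈ S) :
    velocity S γ t = derivWithin (chartCurve E (γ t) γ) S t := by
  have h : MDifferentiableWithinAt 𝓘(ℝ, ℝ) 𝓘(ℝ, E) γ S t :=
    (hγ t ht).mdifferentiableWithinAt (by simp)
  rw [velocity, h.mfderivWithin]
  simp only [writtenInExtChartAt, mfld_simps, derivWithin]
  rfl

theorem chartField_velocity (hS : UniqueDiffOn ℝ S) (hγ : ContMDiffOn 𝓘(ℝ, ℝ) 𝓘(ℝ, E) ∞ γ S)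
    (ht : t ∈ S) (hp : γ t ∈ (extChartAt 𝓘(ℝ, E) p).source) :
    chartField p γ (velocity S γ) t = derivWithin (chartCurve E p γ) S t := by
  have h0 := mem_extChartAt_source (I := 𝓘(ℝ, E)) (γ t)
  have h1 := eventually_chartCurve_change (q := p) hγ ht h0
  have hU : chartCurve E (γ t) γ t ∈ transitionDom (γ t) p := extChartAt_mem_transitionDom h0 hp
  have h2 : HasDerivWithinAt (fun τ => transition (γ t) p (chartCurve E (γ t) γ τ)) _ S t :=
    ((contDiffAt_transition _ _ hU).differentiableAt (by simp)).hasFDerivAt.comp_hasDerivWithinAt t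
      ((contDiffWithinAt_chartCurve hγ ht h0).differentiableWithinAt (by simp)).hasDerivWithinAt
  rw [h1.derivWithin_eq (h1.self_of_nhdsWithin ht), h2.derivWithin (hS t ht),
    chartField_change h0 hp, chartField_self, velocity_eq hγ ht]

namespace Metric

variable {F : Metric E M}

/-- A smooth curve with admissible velocity. -/
structure IsAdmissibleOn (F : Metric E M) (S : Set ℝ) (γ : ℝ → M) : Prop where
  uniqueDiffOn : UniqueDiffOn ℝ S
  smooth : ContMDiffOn 𝓘(ℝ, ℝ) 𝓘(ℝ, E) ∞ γ S
  admissible : ∀ t ∈ S, (⟨γ t, velocity S γ t⟩ : TangentBundle 𝓘(ℝ, E) M) ∈ F.dom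

theorem IsGeodesic.isAdmissibleOn {a b : ℝ} (h : F.IsGeodesic a b γ) (hab : a < b) :
    F.IsAdmissibleOn (Icc a b) γ := ⟨uniqueDiffOn_Icc hab, h.smooth, h.admissible⟩

namespace IsAdmissibleOn

variable (h : F.IsAdmissibleOn S γ) (ht : t ∈ S)

include h ht

theorem mem_localDom (hp : γ t ∈ (extChartAt 𝓘(ℝ, E) p).source) :
    (chartCurve E p γ t, derivWithin (chartCurve E p γ) S t) ∈ F.localDom p := by
  rw [← chartField_velocity h.uniqueDiffOn h.smooth ht hp]
  exact F.mem_localDom_of_mem_dom (z := ⟨γ t, velocity S γ t⟩) hp (h.admissible t ht)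

theorem eventually_velocity (hp : γ t ∈ (extChartAt 𝓘(ℝ, E) p).source) :
    chartField p γ (velocity S γ) =ᶠ[𝓝[S] t] derivWithin (chartCurve E p γ) S := by
  filter_upwards [eventually_mem_source h.smooth ht hp, self_mem_nhdsWithin] with τ h1 h2
  exact chartField_velocity h.uniqueDiffOn h.smooth h2 h1

variable [FiniteDimensional ℝ E]

theorem g_eq (hp : γ t ∈ (extChartAt 𝓘(ℝ, E) p).source) (u w : TangentSpace 𝓘(ℝ, E) (γ t)) :
    F.g (γ t) (velocity S γ t) u w = totalForm (F.localL p)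
      (chartCurve E p γ t, derivWithin (chartCurve E p γ) S t)
      (fibreCoord p (⟨γ t, u⟩ : TangentBundle 𝓘(ℝ, E) M))
      (fibreCoord p (⟨γ t, w⟩ : TangentBundle 𝓘(ℝ, E) M)) := by
  rw [← chartField_velocity h.uniqueDiffOn h.smooth ht hp]
  exact F.g_apply_eq hp (h.admissible t ht) u w

/-- The last slot of the Christoffel symbol is the reference vector itself, so the symbol collapses
to the nonlinear connection. -/
theorem prime_eq_localPrime_self (V : (t : ℝ) → TangentSpace 𝓘(ℝ, E) (γ t)) :
    F.prime S γ V t = localPrime (F.localL (γ t)) S (chartCurve E (γ t) γ)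
      (chartField (γ t) γ V) t := by
  have h0 := mem_extChartAt_source (I := 𝓘(ℝ, E)) (γ t)
  have h1 := (F.isLocalMetric (γ t)).christoffel_self_right (h.mem_localDom ht h0)
    (chartField (γ t) γ V t)
  simp only at h1
  rw [localPrime, ← h1, chartField_self]
  have h2 : F.prime S γ V t = derivWithin (chartField (γ t) γ V) S t +
    christoffel (F.localL (γ t)) (chartCurve E (γ t) γ t) (velocity S γ t) (V t)
      (velocity S γ t) := rfl
  rw [h2, velocity_eq h.smooth ht]

/-- The covariant derivative of a vector field along a curve in an arbitrary chart. -/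
theorem chartField_prime (hp : γ t ∈ (extChartAt 𝓘(ℝ, E) p).source)
    (hV : IsSmoothFieldAlong S γ V) :
    chartField p γ (F.prime S γ V) t =
      localPrime (F.localL p) S (chartCurve E p γ) (chartField p γ V) t := by
  have h0 := mem_extChartAt_source (I := 𝓘(ℝ, E)) (γ t)
  have h1 := (F.isMetricChange (γ t) p).localPrime_eq h.uniqueDiffOn ht
    (extChartAt_mem_transitionDom h0 hp) (contDiffWithinAt_chartCurve h.smooth ht h0)
    (hV.contDiffWithinAt h.smooth ht h0) (h.mem_localDom ht h0)
  rw [localPrime_congr ht (eventually_chartCurve_change h.smooth ht h0)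
    (eventually_chartField_change h.smooth ht h0 hp)]
  refine Eq.trans ?_ h1.symm
  rw [chartField_change h0 hp, chartField_self, h.prime_eq_localPrime_self ht]

theorem eventually_prime (hp : γ t ∈ (extChartAt 𝓘(ℝ, E) p).source)
    (hV : IsSmoothFieldAlong S γ V) :
    chartField p γ (F.prime S γ V) =ᶠ[𝓝[S] t]
      localPrime (F.localL p) S (chartCurve E p γ) (chartField p γ V) := by
  filter_upwards [eventually_mem_source h.smooth ht hp, self_mem_nhdsWithin] with τ h1 h2
  exact h.chartField_prime h2 h1 hV

omit ht in
theorem isSmoothFieldAlong_prime (hV : IsSmoothFieldAlong S γ V) :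
    IsSmoothFieldAlong S γ (F.prime S γ V) := by
  intro t ht
  have h0 := mem_extChartAt_source (I := 𝓘(ℝ, E)) (γ t)
  rw [isSmoothFieldAlong_iff h.smooth ht h0]
  have h1 := h.eventually_prime ht h0 hV
  exact ((F.isLocalMetric (γ t)).contDiffWithinAt_localPrime h.uniqueDiffOn ht
    (contDiffWithinAt_chartCurve h.smooth ht h0) (hV.contDiffWithinAt h.smooth ht h0)
    (h.mem_localDom ht h0)).congr_of_eventuallyEq h1 (h1.self_of_nhdsWithin ht)

omit ht [FiniteDimensional ℝ E] in
theorem isSmoothFieldAlong_velocity : IsSmoothFieldAlong S γ (velocity (E := E) S γ) := by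
  intro t ht
  have h0 : γ t ∈ (extChartAt 𝓘(ℝ, E) (γ t)).source := mem_extChartAt_source (γ t)
  rw [isSmoothFieldAlong_iff h.smooth ht h0]
  have h1 := h.eventually_velocity ht h0
  exact (contDiffWithinAt_derivWithin h.uniqueDiffOn ht
    (contDiffWithinAt_chartCurve h.smooth ht h0)).congr_of_eventuallyEq h1
      (h1.self_of_nhdsWithin ht)

variable (hgeo : ∀ t ∈ S, F.prime S γ (velocity S γ) t = 0)

include hgeo

theorem localPrime_velocity (hp : γ t ∈ (extChartAt 𝓘(ℝ, E) p).source) :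
    localPrime (F.localL p) S (chartCurve E p γ) (derivWithin (chartCurve E p γ) S) t = 0 := by
  rw [← localPrime_congr ht EventuallyEq.rfl (h.eventually_velocity ht hp),
    ← h.chartField_prime ht hp h.isSmoothFieldAlong_velocity, chartField, hgeo t ht,
    fibreCoord_eq]
  exact map_zero _

/-- Product rule for the fundamental tensor along a geodesic. -/
theorem hasDerivWithinAt_g {W : (t : ℝ) → TangentSpace 𝓘(ℝ, E) (γ t)}
    (hV : IsSmoothFieldAlong S γ V) (hW : IsSmoothFieldAlong S γ W) :
    HasDerivWithinAt (fun τ => F.g (γ τ) (velocity S γ τ) (V τ) (W τ))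
      (F.g (γ t) (velocity S γ t) (F.prime S γ V t) (W t)
        + F.g (γ t) (velocity S γ t) (V t) (F.prime S γ W t)) S t := by
  have h0 := mem_extChartAt_source (I := 𝓘(ℝ, E)) (γ t)
  have hx := contDiffWithinAt_chartCurve h.smooth ht h0
  have hd : ∀ {w : ℝ → E}, ContDiffWithinAt ℝ ∞ w S t →
      HasDerivWithinAt w (derivWithin w S t) S t := fun hw =>
    (hw.differentiableWithinAt (by simp)).hasDerivWithinAt
  have hz := h.mem_localDom ht h0
  have h1 := (F.isLocalMetric (γ t)).hasDerivWithinAt_totalForm hz (hd hx)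
    (hd (contDiffWithinAt_derivWithin h.uniqueDiffOn ht hx))
    (hd (hV.contDiffWithinAt h.smooth ht h0)) (hd (hW.contDiffWithinAt h.smooth ht h0))
  -- The Cartan term of the product rule is evaluated on the covariant derivative of the velocity,
  -- which vanishes for a geodesic.
  have hE := h.localPrime_velocity ht hgeo h0
  have hr := (F.isLocalMetric (γ t)).christoffel_self_right hz
  simp only at hr
  rw [localPrime] at hE
  simp only [hr] at h1
  rw [hE, map_zero, zero_apply, zero_apply, mul_zero, add_zero] at h1
  have e : (fun τ => F.g (γ τ) (velocity S γ τ) (V τ) (W τ)) =ᶠ[𝓝[S] t] fun τ =>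
      totalForm (F.localL (γ t)) (chartCurve E (γ t) γ τ, derivWithin (chartCurve E (γ t) γ) S τ)
        (chartField (γ t) γ V τ) (chartField (γ t) γ W τ) := by
    filter_upwards [eventually_mem_source h.smooth ht h0, self_mem_nhdsWithin] with τ h2 h3
    exact h.g_eq h3 h2 (V τ) (W τ)
  refine (h1.congr_of_eventuallyEq e (e.self_of_nhdsWithin ht)).congr_deriv ?_
  rw [h.g_eq ht h0, h.g_eq ht h0]
  have e1 : fibreCoord (γ t) (⟨γ t, F.prime S γ V t⟩ : TangentBundle 𝓘(ℝ, E) M) = _ :=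
    h.chartField_prime ht h0 hV
  have e2 : fibreCoord (γ t) (⟨γ t, F.prime S γ W t⟩ : TangentBundle 𝓘(ℝ, E) M) = _ :=
    h.chartField_prime ht h0 hW
  rw [e1, e2]
  rfl

end IsAdmissibleOn

/-- The Jacobi defect `V'' - R (γ', V) γ'`. -/
def jacobiDefect (F : Metric E M) (S : Set ℝ) (γ : ℝ → M)
    (V : (t : ℝ) → TangentSpace 𝓘(ℝ, E) (γ t)) (t : ℝ) : TangentSpace 𝓘(ℝ, E) (γ t) :=
  F.prime S γ (F.prime S γ V) t - F.jacobiOperator S γ V (velocity S γ) t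

namespace IsAdmissibleOn

variable [FiniteDimensional ℝ E] (h : F.IsAdmissibleOn S γ)
  (hgeo : ∀ t ∈ S, F.prime S γ (velocity S γ) t = 0)
  (hV : IsSmoothFieldAlong S γ V) (ht : t ∈ S)

include h hgeo hV ht

omit hgeo in
theorem prime_prime_eq : F.prime S γ (F.prime S γ V) t =
    localPrime (F.localL (γ t)) S (chartCurve E (γ t) γ)
      (localPrime (F.localL (γ t)) S (chartCurve E (γ t) γ) (chartField (γ t) γ V)) t := by
  have h0 := mem_extChartAt_source (I := 𝓘(ℝ, E)) (γ t)
  rw [h.prime_eq_localPrime_self ht]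
  exact localPrime_congr (E := E) ht EventuallyEq.rfl (h.eventually_prime ht h0 hV)

/-- The curvature is V'' minus the linearized spray, so subtracting it from V'' leaves only the
linearized spray. -/
theorem jacobiDefect_eq_self : F.jacobiDefect S γ V t =
    linearizedSpray (F.localL (γ t)) S (chartCurve E (γ t) γ) (chartField (γ t) γ V) t := by
  have h0 := mem_extChartAt_source (I := 𝓘(ℝ, E)) (γ t)
  have h1 := (F.isLocalMetric (γ t)).variationCurvature_velocity h.uniqueDiffOn ht
    (contDiffWithinAt_chartCurve h.smooth ht h0) (hV.contDiffWithinAt h.smooth ht h0)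
    (h.mem_localDom ht h0) (h.localPrime_velocity ht hgeo h0) (h.eventually_velocity ht h0)
  rw [jacobiDefect, h.prime_prime_eq hV ht]
  have h2 : F.jacobiOperator S γ V (velocity S γ) t = _ := h1
  rw [h2]
  have h3 : ∀ u w : E, u - (u - w) = w := sub_sub_cancel
  exact h3 (localPrime (F.localL (γ t)) S (chartCurve E (γ t) γ)
    (localPrime (F.localL (γ t)) S (chartCurve E (γ t) γ) (chartField (γ t) γ V)) t) _

/-- By definition the defect is computed in a chart that moves with `t`. Covariance of the
linearized spray along a geodesic gives its expression at all nearby times in one fixed chart. -/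
theorem chartField_jacobiDefect (hp : γ t ∈ (extChartAt 𝓘(ℝ, E) p).source) :
    chartField p γ (F.jacobiDefect S γ V) t =
      linearizedSpray (F.localL p) S (chartCurve E p γ) (chartField p γ V) t := by
  have h0 := mem_extChartAt_source (I := 𝓘(ℝ, E)) (γ t)
  have hx : ∀ᶠ τ in 𝓝[S] t, ContDiffWithinAt ℝ ∞ (chartCurve E (γ t) γ) S τ ∧
      chartCurve E (γ t) γ τ ∈ transitionDom (γ t) p := by
    filter_upwards [eventually_mem_source h.smooth ht h0, eventually_mem_source h.smooth ht hp,
      self_mem_nhdsWithin] with τ h1 h2 h3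
    exact ⟨contDiffWithinAt_chartCurve h.smooth h3 h1, extChartAt_mem_transitionDom h1 h2⟩
  have hv : ∀ᶠ τ in 𝓝[S] t, ContDiffWithinAt ℝ ∞ (chartField (γ t) γ V) S τ := by
    filter_upwards [eventually_mem_source h.smooth ht h0, self_mem_nhdsWithin] with τ h1 h3
    exact hV.contDiffWithinAt h.smooth h3 h1
  have hz := h.mem_localDom ht h0
  have hE : derivWithin (derivWithin (chartCurve E (γ t) γ) S) S t + spray (F.localL (γ t))
      (chartCurve E (γ t) γ t, derivWithin (chartCurve E (γ t) γ) S t) = 0 := by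
    rw [← (F.isLocalMetric (γ t)).nonlinearConnection_self hz]
    exact h.localPrime_velocity ht hgeo h0
  have h1 := (F.isMetricChange (γ t) p).linearizedSpray_eq h.uniqueDiffOn ht hx hv hz hE
  rw [linearizedSpray_congr ht (eventually_chartCurve_change h.smooth ht h0)
    (eventually_chartField_change h.smooth ht h0 hp)]
  refine Eq.trans ?_ h1.symm
  rw [chartField_change h0 hp, chartField_self, h.jacobiDefect_eq_self hgeo hV ht]

-- Smoothness makes the defect integrable against smooth fields, and lets the fundamental lemma
-- conclude at the endpoints as well.
omit ht in
theorem isSmoothFieldAlong_jacobiDefect : IsSmoothFieldAlong S γ (F.jacobiDefect S γ V) := by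
  intro t ht
  have h0 := mem_extChartAt_source (I := 𝓘(ℝ, E)) (γ t)
  rw [isSmoothFieldAlong_iff h.smooth ht h0]
  have h1 : chartField (γ t) γ (F.jacobiDefect S γ V) =ᶠ[𝓝[S] t]
      linearizedSpray (F.localL (γ t)) S (chartCurve E (γ t) γ) (chartField (γ t) γ V) := by
    filter_upwards [eventually_mem_source h.smooth ht h0, self_mem_nhdsWithin] with τ h1 h2
    exact h.chartField_jacobiDefect hgeo hV h2 h1
  exact ((F.isLocalMetric (γ t)).contDiffWithinAt_linearizedSpray h.uniqueDiffOn ht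
    (contDiffWithinAt_chartCurve h.smooth ht h0) (hV.contDiffWithinAt h.smooth ht h0)
    (h.mem_localDom ht h0)).congr_of_eventuallyEq h1 (h1.self_of_nhdsWithin ht)

omit ht in
/-- Skew-symmetry of the curvature term at interior parameters. -/
theorem g_jacobiOperator {W : (t : ℝ) → TangentSpace 𝓘(ℝ, E) (γ t)} (hSt : S ∈ 𝓝 t)
    (hW : IsSmoothFieldAlong S γ W) :
    F.g (γ t) (velocity S γ t) (F.jacobiOperator S γ V W t) (velocity S γ t) =
      F.g (γ t) (velocity S γ t) (F.jacobiDefect S γ V t) (W t)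
        - F.g (γ t) (velocity S γ t) (F.prime S γ (F.prime S γ V) t) (W t) := by
  have ht := mem_of_mem_nhds hSt
  have h0 := mem_extChartAt_source (I := 𝓘(ℝ, E)) (γ t)
  have hz := h.mem_localDom ht h0
  have h1 := (F.isLocalMetric (γ t)).totalForm_variationCurvature h.uniqueDiffOn hSt
    (contDiffWithinAt_chartCurve h.smooth ht h0) (hV.contDiffWithinAt h.smooth ht h0)
    (hW.contDiffWithinAt h.smooth ht h0) hz (h.localPrime_velocity ht hgeo h0)
  have h2 : ∀ u w : TangentSpace 𝓘(ℝ, E) (γ t), F.g (γ t) (velocity S γ t) u w =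
      totalForm (F.localL (γ t))
        (chartCurve E (γ t) γ t, derivWithin (chartCurve E (γ t) γ) S t) u w := by
    intro u w
    rw [h.g_eq ht h0, fibreCoord_self, fibreCoord_self]
  rw [h2, h2, h2, h.jacobiDefect_eq_self hgeo hV ht, h.prime_prime_eq hV ht,
    velocity_eq h.smooth ht, ← chartField_self (t := t) (V := W)]
  rw [(F.isLocalMetric (γ t)).totalForm_symm hz (chartField (γ t) γ W t), map_sub, sub_apply] at h1
  exact (eq_neg_of_add_eq_zero_left h1).trans (neg_sub _ _)

end IsAdmissibleOn

end Metric

end CurvesOnManifold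

end PseudoFinsler

end

/-! ### Normal fields along an immersion, by the implicit function theorem. -/

noncomputable section

namespace PseudoFinsler

section ImplicitFunction

/-- The implicit function theorem, with smoothness on a neighbourhood. -/
theorem exists_implicitFunction {E₁ E₂ G : Type*} [NormedAddCommGroup E₁] [NormedSpace ℝ E₁]
    [CompleteSpace E₁] [NormedAddCommGroup E₂] [NormedSpace ℝ E₂] [CompleteSpace E₂]
    [NormedAddCommGroup G] [NormedSpace ℝ G] [CompleteSpace G] {f : E₁ × E₂ → G} {u : E₁ × E₂}
    (hf : ∀ᶠ z in 𝓝 u, ContDiffAt ℝ ∞ f z)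
    (hinv : (fderiv ℝ f u ∘L .inr ℝ E₁ E₂).IsInvertible) :
    ∃ ψ : E₁ → E₂, ψ u.1 = u.2 ∧ ∀ᶠ x in 𝓝 u.1, ContDiffAt ℝ ∞ ψ x ∧ f (x, ψ x) = f u := by
  have hfu := hf.self_of_nhds
  set ψ := hfu.implicitFunction (by simp) hinv
  have hψ : ψ u.1 = u.2 := hfu.implicitFunction_apply_self (by simp) hinv
  have h1 : ContDiffAt ℝ ∞ ψ u.1 := hfu.contDiffAt_implicitFunction (by simp) hinv
  have h2 : ∀ᶠ x in 𝓝 u.1, f (x, ψ x) = f u := hfu.eventually_apply_implicitFunction (by simp) hinv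
  have h3 : ∀ᶠ x in 𝓝 u.1, ContinuousAt ψ x :=
    ((h1.of_le (m := 1) (by simp)).eventually (by simp)).mono fun x hx => hx.continuousAt
  have h4 : Tendsto (fun x => (x, ψ x)) (𝓝 u.1) (𝓝 u) := by
    have := (continuousAt_id (x := u.1)).prodMk h1.continuousAt
    rwa [ContinuousAt, hψ] at this
  have h5 : ∀ᶠ z in 𝓝 u, (fderiv ℝ f z ∘L .inr ℝ E₁ E₂).IsInvertible := by
    have : ContinuousAt (fun z => fderiv ℝ f z ∘L .inr ℝ E₁ E₂) u :=
      (hfu.fderiv_right (m := ∞) (by simp)).continuousAt.clm_comp continuousAt_const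
    exact this.eventually_mem (ContinuousLinearEquiv.isOpen.mem_nhds hinv)
  refine ⟨ψ, hψ, ?_⟩
  filter_upwards [h2, h3, h4.eventually h5, h4.eventually hf, h2.eventually_nhds] with
    x h2x h3x h5x hfx h2n
  refine ⟨?_, h2x⟩
  -- Smoothness of infinite order at `u.1` gives only a neighbourhood depending on each finite
  -- order. The theorem is therefore applied again at each nearby point (x, ψ x); local uniqueness
  -- and continuity of ψ identify the new implicit function with ψ near x.
  have h6 := hfx.eventually_apply_eq_iff_implicitFunction (by simp) h5x
  have h7 : Tendsto (fun y => (y, ψ y)) (𝓝 x) (𝓝 (x, ψ x)) := continuousAt_id.prodMk h3x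
  refine (hfx.contDiffAt_implicitFunction (by simp) h5x).congr_of_eventuallyEq ?_
  filter_upwards [h7.eventually h6, h2n] with y h8 h9
  exact (h8.1 (h9.trans h2x.symm)).symm

variable {E K : Type*} [NormedAddCommGroup E] [NormedSpace ℝ E]
  [NormedAddCommGroup K] [NormedSpace ℝ K]

/-- Local existence of normal vector fields along an immersion, in coordinates. -/
theorem IsLocalMetric.exists_normalField [FiniteDimensional ℝ E] [FiniteDimensional ℝ K]
    {Ω : Set (E × E)} {ℓ : E → E → ℝ} (hℓ : IsLocalMetric Ω ℓ)
    {f : K → E} {k₀ : K} {v : E} (hf : ∀ᶠ k in 𝓝 k₀, ContDiffAt ℝ ∞ f k) (hv : (f k₀, v) ∈ Ω)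
    (horth : ∀ c, totalForm ℓ (f k₀, v) v (fderiv ℝ f k₀ c) = 0)
    (hnd : ∀ c, (∀ c', totalForm ℓ (f k₀, v) (fderiv ℝ f k₀ c) (fderiv ℝ f k₀ c') = 0) → c = 0) :
    ∃ y : K → E, y k₀ = v ∧ ∀ᶠ k in 𝓝 k₀, ContDiffAt ℝ ∞ y k ∧ (f k, y k) ∈ Ω ∧
      ∀ c, totalForm ℓ (f k, y k) (y k) (fderiv ℝ f k c) = 0 := by
  have : CompleteSpace E := FiniteDimensional.complete ℝ E
  have : CompleteSpace K := FiniteDimensional.complete ℝ K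
  -- The normal vector over `k` is sought as v plus a tangential correction with parameter in `K`,
  -- which gives as many unknowns as orthogonality equations.
  set Z : K × K → E × E := fun z => (f z.1, v + fderiv ℝ f z.1 z.2) with hZ
  have hZs : ∀ z : K × K, ContDiffAt ℝ ∞ f z.1 → ContDiffAt ℝ ∞ Z z := by
    intro z hz
    have h1 : ContDiffAt ℝ ∞ (fun z : K × K => f z.1) z := ContDiffAt.comp z hz contDiffAt_fst
    have h2 : ContDiffAt ℝ ∞ (fun z : K × K => fderiv ℝ f z.1) z :=
      ContDiffAt.comp (g := fderiv ℝ f) (f := Prod.fst) z (hz.fderiv_right (m := ∞) (by simp))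
        contDiffAt_fst
    exact h1.prodMk (contDiffAt_const.add (h2.clm_apply contDiffAt_snd))
  -- By Euler's identity half the fibre derivative at y is g_y(y, ·), so the zeros of `Φ` are the
  -- normal vectors. In this form the derivative of `Φ` involves no Cartan term.
  set Φ : K × K → K →L[ℝ] ℝ := fun z =>
    ((1 / 2 : ℝ) • fibreDeriv ℓ (Z z)).comp (fderiv ℝ f z.1) with hΦ
  have hΦs : ∀ z : K × K, ContDiffAt ℝ ∞ f z.1 → Z z ∈ Ω → ContDiffAt ℝ ∞ Φ z := by
    intro z hz hzΩ
    have h2 : ContDiffAt ℝ ∞ (fun z : K × K => fderiv ℝ f z.1) z :=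
      ContDiffAt.comp (g := fderiv ℝ f) (f := Prod.fst) z (hz.fderiv_right (m := ∞) (by simp))
        contDiffAt_fst
    exact (ContDiffAt.const_smul (1 / 2 : ℝ)
      (ContDiffAt.comp z (hℓ.contDiffAt_fibreDeriv hzΩ) (hZs z hz))).clm_comp h2
  have hZ0 : Z (k₀, 0) = (f k₀, v) := by simp [hZ]
  have hZ0Ω : Z (k₀, 0) ∈ Ω := by rwa [hZ0]
  have hfst : Tendsto Prod.fst (𝓝 ((k₀, 0) : K × K)) (𝓝 k₀) := continuousAt_fst
  have hfe := hfst.eventually hf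
  have hZΩ : ∀ᶠ z in 𝓝 ((k₀, 0) : K × K), Z z ∈ Ω :=
    (hZs (k₀, 0) hf.self_of_nhds).continuousAt.eventually_mem (hℓ.isOpen.mem_nhds hZ0Ω)
  have hΦe : ∀ᶠ z in 𝓝 ((k₀, 0) : K × K), ContDiffAt ℝ ∞ Φ z := by
    filter_upwards [hfe, hZΩ] with z h1 h2 using hΦs z h1 h2
  -- The partial derivative in the correction is g_v restricted to the tangent space, which the
  -- nondegeneracy hypothesis makes invertible.
  have hder : ∀ c c', fderiv ℝ Φ (k₀, 0) (0, c) c' =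
      totalForm ℓ (f k₀, v) (fderiv ℝ f k₀ c) (fderiv ℝ f k₀ c') := by
    intro c c'
    have h1 : HasFDerivAt (fun c : K => Φ (k₀, c))
        ((fderiv ℝ Φ (k₀, 0)).comp (.inr ℝ K K)) 0 :=
      HasFDerivAt.comp (x := (0 : K)) (g := Φ) (f := fun c => (k₀, c))
        (hΦe.self_of_nhds.differentiableAt (by simp)).hasFDerivAt (hasFDerivAt_prodMk_right k₀ 0)
    have h2 : HasFDerivAt (fun c : K => v + fderiv ℝ f k₀ c) (fderiv ℝ f k₀) 0 :=
      (fderiv ℝ f k₀).hasFDerivAt.const_add v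
    have h3 := hasFDerivAt_slice_right (hℓ.differentiableAt_fibreDeriv hv)
    have h3' : HasFDerivAt (fun y => fibreDeriv ℓ (f k₀, y))
        ((fderiv ℝ (fibreDeriv ℓ) (f k₀, v)).comp (.inr ℝ E E)) (v + fderiv ℝ f k₀ 0) := by
      simpa using h3
    have h4 := HasFDerivAt.comp (x := (0 : K)) (f := fun c : K => v + fderiv ℝ f k₀ c)
      (g := fun y => fibreDeriv ℓ (f k₀, y)) h3' h2
    have h5 := ((h4.const_smul (1 / 2 : ℝ)).clm_comp (hasFDerivAt_const (fderiv ℝ f k₀) (0 : K)))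
    have h6 := congrArg (fun L => L c c') (h1.unique h5)
    simp only [ContinuousLinearMap.comp_apply, ContinuousLinearMap.inr_apply] at h6
    rw [h6, hℓ.totalForm_apply hv]
    simp
  have hinv : (fderiv ℝ Φ (k₀, 0) ∘L .inr ℝ K K).IsInvertible := by
    have hinj : Function.Injective (fderiv ℝ Φ (k₀, 0) ∘L .inr ℝ K K) := by
      rw [injective_iff_map_eq_zero]
      intro c hc
      refine hnd c fun c' => ?_
      rw [← hder]
      exact congrArg (fun L => L c') hc
    have hfin : Module.finrank ℝ K = Module.finrank ℝ (K →L[ℝ] ℝ) := by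
      rw [← LinearMap.toContinuousLinearMap.finrank_eq]
      exact (Subspace.dual_finrank_eq).symm
    exact ⟨(LinearEquiv.ofInjectiveOfFinrankEq (fderiv ℝ Φ (k₀, 0) ∘L .inr ℝ K K).toLinearMap
      hinj hfin).toContinuousLinearEquiv, by ext; rfl⟩
  obtain ⟨ψ, hψ, hψe⟩ := exists_implicitFunction hΦe hinv
  have h0 : Φ (k₀, 0) = 0 := by
    ext c
    have h1 := horth c
    rw [hℓ.totalForm_self_left hv] at h1
    simpa [hΦ, hZ] using h1
  refine ⟨fun k => v + fderiv ℝ f k (ψ k), by simp [show ψ k₀ = 0 from hψ], ?_⟩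
  have h4 : Tendsto (fun k => (k, ψ k)) (𝓝 k₀) (𝓝 (k₀, 0)) := by
    have := (continuousAt_id (x := k₀)).prodMk hψe.self_of_nhds.1.continuousAt
    simp only [ContinuousAt, hψ] at this
    exact this
  filter_upwards [hf, hψe, h4.eventually hZΩ] with k h5 h6 h7
  refine ⟨contDiffAt_const.add ((h5.fderiv_right (m := ∞) (by simp)).clm_apply h6.1), h7, ?_⟩
  intro c
  have h8 := congrArg (fun L => L c) (h6.2.trans h0)
  rw [hℓ.totalForm_self_left h7]
  simpa [hΦ] using h8

end ImplicitFunction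

/-! ### Projection onto a nondegenerate subspace. -/

section Projection

variable {E : Type*} [NormedAddCommGroup E] [NormedSpace ℝ E]
  {B : E →L[ℝ] E →L[ℝ] ℝ} {T : Submodule ℝ E}

/-- Nondegeneracy makes T → T* injective, hence bijective in finite dimension; the functional of v
on T is thus represented by a vector of T. This excludes the default value in `tanProj`. -/
theorem tanProj_spec [FiniteDimensional ℝ T] (h : ∀ u ∈ T, (∀ w ∈ T, B u w = 0) → u = 0) (v : E) :
    tanProj B T v ∈ T ∧ ∀ w ∈ T, B (v - tanProj B T v) w = 0 := by
  have hex : ∃ z ∈ T, ∀ w ∈ T, B (v - z) w = 0 := by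
    let φ : E →ₗ[ℝ] Module.Dual ℝ T :=
      { toFun u := (B u).toLinearMap.comp T.subtype
        map_add' u w := by ext; simp
        map_smul' c u := by ext; simp }
    have hinj : Function.Injective (φ.comp T.subtype) := by
      rw [injective_iff_map_eq_zero]
      intro u hu
      exact Subtype.ext (h u u.2 fun w hw => congrArg (fun L => L ⟨w, hw⟩) hu)
    have hsurj := (LinearMap.injective_iff_surjective_of_finrank_eq_finrank
      (Subspace.dual_finrank_eq (K := ℝ) (V := T)).symm).1 hinj
    obtain ⟨z, hz⟩ := hsurj (φ v)
    refine ⟨z, z.2, fun w hw => ?_⟩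
    have := congrArg (fun L => L ⟨w, hw⟩) hz
    rw [map_sub, sub_apply, sub_eq_zero]
    exact this.symm
  rw [tanProj, dif_pos hex]
  exact hex.choose_spec

theorem tanProj_eq_iff [FiniteDimensional ℝ T] (h : ∀ u ∈ T, (∀ w ∈ T, B u w = 0) → u = 0)
    {v z : E} (hz : z ∈ T) : tanProj B T v = z ↔ ∀ w ∈ T, B (v - z) w = 0 := by
  obtain ⟨h1, h2⟩ := tanProj_spec h v
  refine ⟨fun h3 => h3 ▸ h2, fun h3 => sub_eq_zero.1 (h _ (T.sub_mem h1 hz) fun w hw => ?_)⟩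
  have h4 := h2 w hw
  have h5 := h3 w hw
  rw [map_sub, sub_apply] at h4 h5 ⊢
  linarith

end Projection

end PseudoFinsler

end

/-! ### Submanifolds and sections over them in coordinates. -/

noncomputable section

namespace PseudoFinsler

section Submanifolds

variable {E M : Type*} [NormedAddCommGroup E] [NormedSpace ℝ E]
  [TopologicalSpace M] [ChartedSpace E M]
  {K : Type*} [NormedAddCommGroup K] [NormedSpace ℝ K] {P : Set M} [ChartedSpace K P]

/-- The coordinate expression of the inclusion of `P` into `M`, in the preferred charts at `p`. -/
def paramMap (E K : Type*) {M : Type*} [NormedAddCommGroup E] [NormedSpace ℝ E]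
    [TopologicalSpace M] [ChartedSpace E M] [NormedAddCommGroup K] [NormedSpace ℝ K] {P : Set M}
    [ChartedSpace K P] (p : P) (k : K) : E :=
  extChartAt 𝓘(ℝ, E) (p : M) ((extChartAt 𝓘(ℝ, K) p).symm k : P)

/-- The points of `P` in the domains of the preferred charts of `P` and of `M` at `p`. -/
def paramSource (E K : Type*) {M : Type*} [NormedAddCommGroup E] [NormedSpace ℝ E]
    [TopologicalSpace M] [ChartedSpace E M] [NormedAddCommGroup K] [NormedSpace ℝ K] {P : Set M}
    [ChartedSpace K P] (p : P) : Set P :=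
  (extChartAt 𝓘(ℝ, K) p).source ∩ Subtype.val ⁻¹' (extChartAt 𝓘(ℝ, E) (p : M)).source

/-- The coordinate expression of a section over `P` of the tangent bundle of `M`. -/
def sectionCoord [IsManifold 𝓘(ℝ, E) ∞ M] (p : P) (W : (q : P) → TangentSpace 𝓘(ℝ, E) (q : M))
    (k : K) : E :=
  fibreCoord (p : M) (⟨((extChartAt 𝓘(ℝ, K) p).symm k : P), W ((extChartAt 𝓘(ℝ, K) p).symm k)⟩ :
    TangentBundle 𝓘(ℝ, E) M)

theorem isOpen_paramSource (p : P) : IsOpen (paramSource E K p) :=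
  (isOpen_extChartAt_source p).inter
    ((isOpen_extChartAt_source (p : M)).preimage continuous_subtype_val)

theorem mem_paramSource (p : P) : p ∈ paramSource E K p :=
  ⟨mem_extChartAt_source p, mem_extChartAt_source (p : M)⟩

theorem eventually_paramSource (p : P) :
    ∀ᶠ k in 𝓝 (extChartAt 𝓘(ℝ, K) p p), k ∈ (extChartAt 𝓘(ℝ, K) p).target ∧
      (extChartAt 𝓘(ℝ, K) p).symm k ∈ paramSource E K p := by
  refine Filter.Eventually.and (extChartAt_target_mem_nhds p) ((continuousAt_extChartAt_symm p).eventually_mem ?_)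
  rw [extChartAt_to_inv]
  exact (isOpen_paramSource p).mem_nhds (mem_paramSource p)

variable (hP : IsSubmanifold E K P) {p : P}

include hP

namespace IsSubmanifold

theorem contDiffAt_paramMap [IsManifold 𝓘(ℝ, E) ∞ M] {q : P} (hq : q ∈ paramSource E K p) :
    ContDiffAt ℝ ∞ (paramMap E K p) (extChartAt 𝓘(ℝ, K) p q) := by
  have := hP.isManifold
  have hk := (extChartAt 𝓘(ℝ, K) p).map_source hq.1
  have h1 : ContMDiffAt 𝓘(ℝ, K) 𝓘(ℝ, K) ∞ (extChartAt 𝓘(ℝ, K) p).symm (extChartAt 𝓘(ℝ, K) p q) :=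
    (contMDiffOn_extChartAt_symm p).contMDiffAt ((isOpen_extChartAt_target p).mem_nhds hk)
  have h2 : ContMDiffAt 𝓘(ℝ, K) 𝓘(ℝ, E) ∞ (Subtype.val : P → M)
      ((extChartAt 𝓘(ℝ, K) p).symm (extChartAt 𝓘(ℝ, K) p q)) := hP.smooth _
  have h3 : ContMDiffAt 𝓘(ℝ, E) 𝓘(ℝ, E) ∞ (extChartAt 𝓘(ℝ, E) (p : M))
      ((extChartAt 𝓘(ℝ, K) p).symm (extChartAt 𝓘(ℝ, K) p q) : P) := by
    rw [(extChartAt 𝓘(ℝ, K) p).left_inv hq.1]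
    refine contMDiffAt_extChartAt' ?_
    have := hq.2
    rwa [mem_preimage, extChartAt_source] at this
  exact (ContMDiffAt.comp (g := extChartAt 𝓘(ℝ, E) (p : M))
    (f := fun k => (((extChartAt 𝓘(ℝ, K) p).symm k : P) : M)) (extChartAt 𝓘(ℝ, K) p q) h3
    (h2.comp _ h1)).contDiffAt

theorem inclDeriv_eq [IsManifold 𝓘(ℝ, E) ∞ M] (q : P) :
    inclDeriv (E := E) K P q = fderiv ℝ (paramMap E K q) (extChartAt 𝓘(ℝ, K) q q) := by
  have h := (hP.smooth q).mdifferentiableAt (by simp)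
  rw [inclDeriv, h.mfderiv]
  simp only [writtenInExtChartAt, mfld_simps, fderivWithin_univ]
  rfl

/-- Factor the parametrization at `p` near `q` through the preferred charts at `q`. `A` is the
derivative of the transition map of `P`; its surjectivity shows that the derivative of the
parametrization has the whole tangent space of `P` at `q` as its range. -/
theorem fderiv_paramMap [IsManifold 𝓘(ℝ, E) ∞ M] {q : P} (hq : q ∈ paramSource E K p) :
    ∃ A : K → K, Function.Surjective A ∧ ∀ c,
    fderiv ℝ (paramMap E K p) (extChartAt 𝓘(ℝ, K) p q) c =
      fibreCoord (p : M) (⟨(q : M), inclDeriv (E := E) K P q (A c)⟩ : TangentBundle 𝓘(ℝ, E) M) := by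
  have := hP.isManifold
  have hqq := mem_extChartAt_source (I := 𝓘(ℝ, K)) q
  have hqE := mem_extChartAt_source (I := 𝓘(ℝ, E)) (q : M)
  have hU := extChartAt_mem_transitionDom hq.1 hqq
  have hV := extChartAt_mem_transitionDom hqE hq.2
  have e1 : transition (E := K) p q (extChartAt 𝓘(ℝ, K) p q) = extChartAt 𝓘(ℝ, K) q q := by
    simp only [transition, Function.comp_apply, (extChartAt 𝓘(ℝ, K) p).left_inv hq.1]
  have e2 : paramMap E K q (extChartAt 𝓘(ℝ, K) q q) = extChartAt 𝓘(ℝ, E) (q : M) q := by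
    rw [paramMap, extChartAt_to_inv]
  refine ⟨fderiv ℝ (transition (E := K) p q) (extChartAt 𝓘(ℝ, K) p q), transition_surjective p q hU,
    fun c => ?_⟩
  have h1 : HasFDerivAt (transition (E := K) p q) _ (extChartAt 𝓘(ℝ, K) p q) :=
    ((contDiffAt_transition p q hU).differentiableAt (by simp)).hasFDerivAt
  have h2 : HasFDerivAt (paramMap E K q)
      (fderiv ℝ (paramMap E K q) (extChartAt 𝓘(ℝ, K) q q)) (transition (E := K) p q (extChartAt 𝓘(ℝ, K) p q)) := by
    rw [e1]
    exact ((hP.contDiffAt_paramMap (mem_paramSource q)).differentiableAt (by simp)).hasFDerivAt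
  have h3 : HasFDerivAt (transition (q : M) (p : M))
      (fderiv ℝ (transition (q : M) (p : M)) (extChartAt 𝓘(ℝ, E) (q : M) q))
      (paramMap E K q (transition (E := K) p q (extChartAt 𝓘(ℝ, K) p q))) := by
    rw [e1, e2]
    exact ((contDiffAt_transition _ _ hV).differentiableAt (by simp)).hasFDerivAt
  have h4 := HasFDerivAt.comp (g := transition (q : M) (p : M))
    (f := paramMap E K q ∘ transition (E := K) p q) (extChartAt 𝓘(ℝ, K) p q) h3 (h2.comp _ h1)
  have h5 : paramMap E K p =ᶠ[𝓝 (extChartAt 𝓘(ℝ, K) p q)]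
      transition (q : M) (p : M) ∘ paramMap E K q ∘ transition (E := K) p q := by
    have hc : ContinuousAt (extChartAt 𝓘(ℝ, K) p).symm (extChartAt 𝓘(ℝ, K) p q) :=
      continuousAt_extChartAt_symm' hq.1
    have hs : ∀ᶠ k in 𝓝 (extChartAt 𝓘(ℝ, K) p q),
        (extChartAt 𝓘(ℝ, K) p).symm k ∈ paramSource E K q := by
      refine hc.eventually_mem ?_
      rw [(extChartAt 𝓘(ℝ, K) p).left_inv hq.1]
      exact (isOpen_paramSource q).mem_nhds (mem_paramSource q)
    filter_upwards [hs] with k hk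
    simp only [Function.comp_apply, paramMap, transition]
    rw [(extChartAt 𝓘(ℝ, K) q).left_inv hk.1, (extChartAt 𝓘(ℝ, E) (q : M)).left_inv hk.2]
  set κ := fderiv ℝ (transition (E := K) p q) (extChartAt 𝓘(ℝ, K) p q) c with hκ
  have h6 := fibreCoord_change hqE hq.2 (inclDeriv (E := E) K P q κ)
  have h7 : fibreCoord (q : M)
      (⟨(q : M), inclDeriv (E := E) K P q κ⟩ : TangentBundle 𝓘(ℝ, E) M) =
        fderiv ℝ (paramMap E K q) (extChartAt 𝓘(ℝ, K) q q) κ := by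
    rw [← hP.inclDeriv_eq]
    exact fibreCoord_self (q : M) (inclDeriv (E := E) K P q κ)
  rw [h7] at h6
  rw [(h4.congr_of_eventuallyEq h5).fderiv, h6]
  rfl

theorem fibreCoord_mem_range [IsManifold 𝓘(ℝ, E) ∞ M] {q : P} (hq : q ∈ paramSource E K p)
    {w : TangentSpace 𝓘(ℝ, E) (q : M)} (hw : w ∈ tangentSubspace (E := E) K P q) :
    ∃ c, fibreCoord (p : M) (⟨(q : M), w⟩ : TangentBundle 𝓘(ℝ, E) M) =
      fderiv ℝ (paramMap E K p) (extChartAt 𝓘(ℝ, K) p q) c := by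
  obtain ⟨A, hA, h⟩ := hP.fderiv_paramMap hq
  obtain ⟨κ, rfl⟩ := hw
  obtain ⟨c, rfl⟩ := hA κ
  exact ⟨c, (h c).symm⟩

theorem ofFibreCoord_mem_tangentSubspace [IsManifold 𝓘(ℝ, E) ∞ M] {q : P}
    (hq : q ∈ paramSource E K p) (c : K) :
    ofFibreCoord (p : M) (q : M) (fderiv ℝ (paramMap E K p) (extChartAt 𝓘(ℝ, K) p q) c) ∈
      tangentSubspace (E := E) K P q := by
  obtain ⟨A, -, h⟩ := hP.fderiv_paramMap hq
  rw [h]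
  exact ⟨A c, (ofFibreCoord_fibreCoord hq.2 (inclDeriv (E := E) K P q (A c))).symm⟩

theorem contMDiffAt_section_iff [IsManifold 𝓘(ℝ, E) ∞ M] {q : P} (hq : q ∈ paramSource E K p)
    {W : (q : P) → TangentSpace 𝓘(ℝ, E) (q : M)} :
    ContMDiffAt 𝓘(ℝ, K) 𝓘(ℝ, E).tangent ∞
      (fun q : P => (⟨(q : M), W q⟩ : TangentBundle 𝓘(ℝ, E) M)) q ↔
    ContMDiffAt 𝓘(ℝ, K) 𝓘(ℝ, E) ∞
      (fun q : P => fibreCoord (p : M) (⟨(q : M), W q⟩ : TangentBundle 𝓘(ℝ, E) M)) q := by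
  have h := Bundle.Trivialization.contMDiffAt_iff (n := ∞) (IM := 𝓘(ℝ, K)) (IB := 𝓘(ℝ, E))
    (e := trivializationAt E (TangentSpace 𝓘(ℝ, E)) (p : M))
    (f := fun q : P => (⟨(q : M), W q⟩ : TangentBundle 𝓘(ℝ, E) M)) (x₀ := q) (by
      rw [TangentBundle.trivializationAt_source]
      have := hq.2
      rwa [mem_preimage, extChartAt_source] at this)
  exact h.trans (and_iff_right (hP.smooth q))

/-- The section of `TM` over `P` with prescribed coordinate expression. -/
theorem isSmoothSection_ofFibreCoord [IsManifold 𝓘(ℝ, E) ∞ M] {U : Set P} {y : K → E}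
    (hU : ∀ q ∈ U, q ∈ paramSource E K p ∧ ContDiffAt ℝ ∞ y (extChartAt 𝓘(ℝ, K) p q))
    (hUo : IsOpen U) :
    IsSmoothSection K P U fun q => ofFibreCoord (p : M) (q : M) (y (extChartAt 𝓘(ℝ, K) p q)) := by
  have := hP.isManifold
  intro q hq
  refine ContMDiffAt.contMDiffWithinAt ?_
  rw [hP.contMDiffAt_section_iff (hU q hq).1]
  have h1 : ContMDiffAt 𝓘(ℝ, K) 𝓘(ℝ, E) ∞ (fun q : P => y (extChartAt 𝓘(ℝ, K) p q)) q := by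
    refine ContMDiffAt.comp q (hU q hq).2.contMDiffAt (contMDiffAt_extChartAt' ?_)
    have := (hU q hq).1.1
    rwa [extChartAt_source] at this
  refine h1.congr_of_eventuallyEq ?_
  filter_upwards [hUo.mem_nhds hq] with r hr
  exact fibreCoord_ofFibreCoord (hU r hr).1.2 _

theorem contDiffAt_sectionCoord [IsManifold 𝓘(ℝ, E) ∞ M] {U : Set P} (hU : IsOpen U) (hp : p ∈ U)
    {W : (q : P) → TangentSpace 𝓘(ℝ, E) (q : M)} (hW : IsSmoothSection K P U W) :
    ContDiffAt ℝ ∞ (sectionCoord p W) (extChartAt 𝓘(ℝ, K) p p) := by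
  have := hP.isManifold
  have h1 := (hP.contMDiffAt_section_iff (mem_paramSource p)).1 (hW.contMDiffAt (hU.mem_nhds hp))
  have h2 : ContMDiffAt 𝓘(ℝ, K) 𝓘(ℝ, K) ∞ (extChartAt 𝓘(ℝ, K) p).symm (extChartAt 𝓘(ℝ, K) p p) :=
    (contMDiffOn_extChartAt_symm p).contMDiffAt (extChartAt_target_mem_nhds p)
  have h3 : (extChartAt 𝓘(ℝ, K) p).symm (extChartAt 𝓘(ℝ, K) p p) = p := extChartAt_to_inv p
  exact (ContMDiffAt.comp (g := fun q : P => fibreCoord (p : M)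
    (⟨(q : M), W q⟩ : TangentBundle 𝓘(ℝ, E) M)) _ (by rw [h3]; exact h1) h2).contDiffAt

/-- Injectivity of the differential of the inclusion turns `leftInverse` into a genuine left
inverse, so the derivative of the components is taken along `κ`. -/
theorem covDerivSub_eq [IsManifold 𝓘(ℝ, E) ∞ M] (F : Metric E M) {U : Set P} (hU : IsOpen U)
    (hp : p ∈ U) {W : (q : P) → TangentSpace 𝓘(ℝ, E) (q : M)} (hW : IsSmoothSection K P U W)
    (v : TangentSpace 𝓘(ℝ, E) (p : M)) (κ : K) :
    F.covDerivSub K P p v W (inclDeriv K P p κ) =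
      fderiv ℝ (sectionCoord p W) (extChartAt 𝓘(ℝ, K) p p) κ +
        christoffel (F.localL p) (extChartAt 𝓘(ℝ, E) (p : M) p) v (W p)
          (fderiv ℝ (paramMap E K p) (extChartAt 𝓘(ℝ, K) p p) κ) := by
  have h1 := ((hP.contMDiffAt_section_iff (mem_paramSource p)).1
    (hW.contMDiffAt (hU.mem_nhds hp))).mdifferentiableAt (by simp)
  have h2 : (inclDeriv (E := E) K P p : K →ₗ[ℝ] E).leftInverse (inclDeriv (E := E) K P p κ) = κ :=
    LinearMap.leftInverse_apply_of_inj (LinearMap.ker_eq_bot.2 (hP.immersion p)) κ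
  rw [Metric.covDerivSub, h2, hP.inclDeriv_eq, h1.mfderiv]
  simp only [writtenInExtChartAt, mfld_simps, fderivWithin_univ]
  rfl

end IsSubmanifold

end Submanifolds

end PseudoFinsler

end

/-! ### Second fundamental forms and their adjointness. -/

noncomputable section

namespace PseudoFinsler

section SecondFundamentalForms

variable {E M : Type*} [NormedAddCommGroup E] [NormedSpace ℝ E] [FiniteDimensional ℝ E]
  [TopologicalSpace M] [ChartedSpace E M] [IsManifold 𝓘(ℝ, E) ∞ M]
  {K : Type*} [NormedAddCommGroup K] [NormedSpace ℝ K] {P : Set M} [ChartedSpace K P]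
  {F : Metric E M} {p : P} {v : TangentSpace 𝓘(ℝ, E) (p : M)}

omit [FiniteDimensional ℝ E] in
theorem ofFibreCoord_self (r : M) (y : E) : ofFibreCoord r r y = y := by
  rw [ofFibreCoord]
  exact tangentCoordChange_self (E := E) (mem_extChartAt_source r)

omit [FiniteDimensional ℝ E] in
theorem Metric.ofFibreCoord_mem_dom (F : Metric E M) {r q : M}
    (hq : q ∈ (extChartAt 𝓘(ℝ, E) r).source) {y : E}
    (h : (extChartAt 𝓘(ℝ, E) r q, y) ∈ F.localDom r) :
    (⟨q, ofFibreCoord r q y⟩ : TangentBundle 𝓘(ℝ, E) M) ∈ F.dom := by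
  have h1 : ∀ q', q' = q → (⟨q', ofFibreCoord r q' y⟩ : TangentBundle 𝓘(ℝ, E) M) ∈ F.dom →
      (⟨q, ofFibreCoord r q y⟩ : TangentBundle 𝓘(ℝ, E) M) ∈ F.dom := by
    rintro _ rfl h2
    exact h2
  exact h1 _ ((extChartAt 𝓘(ℝ, E) r).left_inv hq) (F.mem_localDom.1 h).2

omit [FiniteDimensional ℝ E] in
theorem IsSubmanifold.inclDeriv_coord (hP : IsSubmanifold E K P) (c : K) :
    inclDeriv (E := E) K P p c = fderiv ℝ (paramMap E K p) (extChartAt 𝓘(ℝ, K) p p) c := by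
  rw [hP.inclDeriv_eq]

omit [FiniteDimensional ℝ E] [IsManifold 𝓘(ℝ, E) ∞ M] in
theorem paramMap_self : paramMap E K p (extChartAt 𝓘(ℝ, K) p p) = extChartAt 𝓘(ℝ, E) (p : M) p := by
  rw [paramMap, extChartAt_to_inv]

omit [FiniteDimensional ℝ E] in
theorem sectionCoord_self (W : (q : P) → TangentSpace 𝓘(ℝ, E) (q : M)) :
    sectionCoord p W (extChartAt 𝓘(ℝ, K) p p) = W p := by
  have h : ∀ q : P, q = p → fibreCoord (p : M) (⟨q, W q⟩ : TangentBundle 𝓘(ℝ, E) M) = W p := by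
    rintro q rfl
    exact fibreCoord_self _ _
  exact h _ (extChartAt_to_inv p)

omit [FiniteDimensional ℝ E] in
-- The extension is the coordinate field of the parametrization with constant coefficient vector
-- `c`.
theorem exists_isTangentExtension (hP : IsSubmanifold E K P) {w : E}
    (hw : w ∈ tangentSubspace (E := E) K P p) :
    ∃ W, Metric.IsTangentExtension (E := E) K P p w W := by
  have := hP.isManifold
  obtain ⟨c, hc⟩ := hw
  refine ⟨fun q => ofFibreCoord (p : M) (q : M)
    (fderiv ℝ (paramMap E K p) (extChartAt 𝓘(ℝ, K) p q) c), ?_, paramSource E K p,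
    isOpen_paramSource p, mem_paramSource p, ?_, fun q hq =>
    hP.ofFibreCoord_mem_tangentSubspace hq c⟩
  · rw [← hc]
    exact (ofFibreCoord_self (p : M) _).trans (hP.inclDeriv_coord c).symm
  · refine hP.isSmoothSection_ofFibreCoord
      (y := fun k => fderiv ℝ (paramMap E K p) k c) (fun q hq => ⟨hq, ?_⟩) (isOpen_paramSource p)
    exact ((hP.contDiffAt_paramMap hq).fderiv_right (m := ∞) (by simp)).clm_apply contDiffAt_const

/-- Transport to `P` of the coordinate normal field. It guarantees that the normal second
fundamental form is computed from an actual extension and is not the default zero. -/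
theorem exists_isNormalExtension [FiniteDimensional ℝ K] (hP : IsSubmanifold E K P)
    (hv : (⟨p, v⟩ : TangentBundle 𝓘(ℝ, E) M) ∈ F.dom) (hn : F.IsNondegenerateNormal K P p v) :
    ∃ N, F.IsNormalExtension K P p v N := by
  have := hP.isManifold
  set k₀ := extChartAt 𝓘(ℝ, K) p p with hk₀
  have hpar : ∀ᶠ k in 𝓝 k₀, ContDiffAt ℝ ∞ (paramMap E K p) k := by
    filter_upwards [eventually_paramSource (E := E) p] with k hk
    have := hP.contDiffAt_paramMap hk.2
    rwa [(extChartAt 𝓘(ℝ, K) p).right_inv hk.1] at this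
  have hΩ : (paramMap E K p k₀, v) ∈ F.localDom p := by
    have := F.mem_localDom_of_mem_dom (p := (p : M)) (mem_extChartAt_source (p : M)) hv
    rwa [fibreCoord_self, ← paramMap_self (K := K)] at this
  have hg : F.g p v = totalForm (F.localL p) (paramMap E K p k₀, v) := by
    rw [F.g_eq, paramMap_self]
  obtain ⟨y, hy, hye⟩ := (F.isLocalMetric p).exists_normalField hpar hΩ
    (fun c => by
      rw [← hg, ← hP.inclDeriv_coord c]
      exact hn.orthogonal _ ⟨c, rfl⟩)
    (fun c hc => by
      refine hP.immersion p ((hn.nondegenerate (inclDeriv (E := E) K P p c) ⟨c, rfl⟩ ?_).trans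
        (map_zero (inclDeriv (E := E) K P p)).symm)
      rintro w ⟨c', rfl⟩
      have := hc c'
      rw [← hg, ← hP.inclDeriv_coord c, ← hP.inclDeriv_coord c'] at this
      exact this)
  obtain ⟨O, hO, hOo, hkO⟩ := eventually_nhds_iff.1 hye
  refine ⟨fun q => ofFibreCoord (p : M) (q : M) (y (extChartAt 𝓘(ℝ, K) p q)), ?_,
    paramSource E K p ∩ ((extChartAt 𝓘(ℝ, K) p).source ∩ extChartAt 𝓘(ℝ, K) p ⁻¹' O), ?_, ?_, ?_, ?_⟩
  · exact (ofFibreCoord_self (p : M) _).trans hy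
  · exact (isOpen_paramSource p).inter
      ((continuousOn_extChartAt p).isOpen_inter_preimage (isOpen_extChartAt_source p) hOo)
  · exact ⟨mem_paramSource p, mem_extChartAt_source p, hkO⟩
  · exact hP.isSmoothSection_ofFibreCoord (fun q hq => ⟨hq.1, (hO _ hq.2.2).1⟩)
      ((isOpen_paramSource p).inter
        ((continuousOn_extChartAt p).isOpen_inter_preimage (isOpen_extChartAt_source p) hOo))
  · intro q hq
    obtain ⟨-, h1, h2⟩ := hO _ hq.2.2
    have e : paramMap E K p (extChartAt 𝓘(ℝ, K) p q) = extChartAt 𝓘(ℝ, E) (p : M) q := by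
      rw [paramMap, (extChartAt 𝓘(ℝ, K) p).left_inv hq.1.1]
    have hdom : (⟨q, ofFibreCoord (p : M) (q : M) (y (extChartAt 𝓘(ℝ, K) p q))⟩ :
        TangentBundle 𝓘(ℝ, E) M) ∈ F.dom := F.ofFibreCoord_mem_dom hq.1.2 (e ▸ h1)
    refine ⟨hdom, fun w hw => ?_⟩
    obtain ⟨c, hc⟩ := hP.fibreCoord_mem_range hq.1 hw
    refine (F.g_apply_eq hq.1.2 hdom _ w).trans ?_
    rw [fibreCoord_ofFibreCoord hq.1.2, hc, ← e]
    exact h2 c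

/-- Differentiating the orthogonality of a normal and a tangent extension. -/
theorem g_covDerivSub_add (hP : IsSubmanifold E K P) (hv : (⟨p, v⟩ : TangentBundle 𝓘(ℝ, E) M) ∈ F.dom)
    {N W : (q : P) → TangentSpace 𝓘(ℝ, E) (q : M)} {w u : E}
    (hN : F.IsNormalExtension K P p v N) (hW : Metric.IsTangentExtension (E := E) K P p w W)
    (hu : u ∈ tangentSubspace (E := E) K P p) :
    F.g p v (F.covDerivSub K P p v N u) w + F.g p v v (F.covDerivSub K P p v W u) = 0 := by
  obtain ⟨hNp, U, hU, hpU, hNs, hNU⟩ := hN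
  obtain ⟨hWp, U', hU', hpU', hWs, hWU⟩ := hW
  obtain ⟨κ, rfl⟩ := hu
  set k₀ := extChartAt 𝓘(ℝ, K) p p with hk₀
  have hΩ : (paramMap E K p k₀, sectionCoord p N k₀) ∈ F.localDom p := by
    have := F.mem_localDom_of_mem_dom (p := (p : M)) (mem_extChartAt_source (p : M)) hv
    rw [sectionCoord_self, hNp]
    rwa [fibreCoord_self, ← paramMap_self (K := K)] at this
  have hd : ∀ {y : K → E}, ContDiffAt ℝ ∞ y k₀ → HasFDerivWithinAt y (fderiv ℝ y k₀) univ k₀ :=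
    fun hy => (hy.differentiableAt (by simp)).hasFDerivAt.hasFDerivWithinAt
  have hNc := hP.contDiffAt_sectionCoord hU hpU hNs
  have hWc := hP.contDiffAt_sectionCoord hU' hpU' hWs
  obtain ⟨D, hD, hDe⟩ := (F.isLocalMetric p).hasFDerivWithinAt_totalForm hΩ
    (hd (hP.contDiffAt_paramMap (mem_paramSource p))) (hd hNc) (hd hNc) (hd hWc)
  rw [hasFDerivWithinAt_univ] at hD
  have hz : (fun k => totalForm (F.localL p) (paramMap E K p k, sectionCoord p N k)
      (sectionCoord p N k) (sectionCoord p W k)) =ᶠ[𝓝 k₀] fun _ => (0 : ℝ) := by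
    have h1 : ∀ᶠ k in 𝓝 k₀, (extChartAt 𝓘(ℝ, K) p).symm k ∈ U ∩ U' := by
      refine (continuousAt_extChartAt_symm p).eventually_mem ?_
      rw [extChartAt_to_inv]
      exact (hU.inter hU').mem_nhds ⟨hpU, hpU'⟩
    filter_upwards [h1, eventually_paramSource (E := E) p] with k h2 h3
    have h4 := (hNU _ h2.1).2 _ (hWU _ h2.2)
    rwa [F.g_apply_eq h3.2.2 (hNU _ h2.1).1] at h4
  -- The pairing g_N(N, W) vanishes identically near `p`, so its derivative, expanded by the almost
  -- metric product rule, is zero.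
  have hD0 : D = 0 := (hD.congr_of_eventuallyEq hz.symm).unique (hasFDerivAt_const 0 k₀)
  have h := hDe κ
  -- N is both the reference vector and a factor of the pairing, so the Cartan term vanishes
  -- whatever the derivative of N is.
  rw [hD0, zero_apply, sectionCoord_self, sectionCoord_self, hNp, hWp, paramMap_self,
    (F.isLocalMetric p).cartanForm_self_mid (z := (extChartAt 𝓘(ℝ, E) (p : M) p, v))] at h
  · rw [zero_apply, mul_zero, add_zero] at h
    have e1 := hP.covDerivSub_eq F hU hpU hNs v κ
    have e2 := hP.covDerivSub_eq F hU' hpU' hWs v κ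
    rw [hNp] at e1
    rw [hWp] at e2
    have e3 : (inclDeriv (E := E) K P p : K →ₗ[ℝ] E) κ = inclDeriv K P p κ := rfl
    rw [e3, e1, e2, F.g_eq]
    exact h.symm
  · rw [sectionCoord_self, hNp, paramMap_self] at hΩ
    exact hΩ

theorem normalSecondFundamentalForm_mem [FiniteDimensional ℝ K]
    (hn : F.IsNondegenerateNormal K P p v) (u : E) :
    F.normalSecondFundamentalForm K P p v u ∈ tangentSubspace (E := E) K P p := by
  rw [Metric.normalSecondFundamentalForm]
  split_ifs
  · exact (tanProj_spec hn.nondegenerate _).1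
  · exact Submodule.zero_mem _

theorem tanProj_eq_normalSecondFundamentalForm_iff [FiniteDimensional ℝ K]
    (hn : F.IsNondegenerateNormal K P p v) (x u : E) :
    tanProj (F.g p v) (tangentSubspace K P p) x = F.normalSecondFundamentalForm K P p v u ↔
      ∀ w ∈ tangentSubspace (E := E) K P p,
        F.g p v x w = F.g p v (F.normalSecondFundamentalForm K P p v u) w := by
  rw [tanProj_eq_iff hn.nondegenerate (normalSecondFundamentalForm_mem hn u)]
  simp only [map_sub, sub_apply, sub_eq_zero]

/-- The two second fundamental forms are adjoint to each other up to sign. -/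
theorem g_secondFundamentalForm [FiniteDimensional ℝ K] (hP : IsSubmanifold E K P)
    (hv : (⟨p, v⟩ : TangentBundle 𝓘(ℝ, E) M) ∈ F.dom) (hn : F.IsNondegenerateNormal K P p v)
    {u w : E} (hu : u ∈ tangentSubspace (E := E) K P p)
    (hw : w ∈ tangentSubspace (E := E) K P p) :
    F.g p v (F.secondFundamentalForm K P p v u w) v =
      -F.g p v (F.normalSecondFundamentalForm K P p v u) w := by
  have hz := F.mem_localDom_of_mem_dom (p := (p : M)) (mem_extChartAt_source (p : M)) hv
  rw [fibreCoord_self] at hz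
  have hsymm : ∀ x y : E, F.g p v x y = F.g p v y x := by
    intro x y
    rw [F.g_eq]
    exact (F.isLocalMetric p).totalForm_symm hz x y
  have hex := exists_isTangentExtension hP hw
  have hexN := exists_isNormalExtension hP hv hn
  -- The differentiated orthogonality holds for any pair of extensions, so the chosen ones suffice
  -- and independence of the choice is not needed.
  rw [Metric.secondFundamentalForm, dif_pos hex, Metric.normalSecondFundamentalForm, dif_pos hexN]
  have h1 := g_covDerivSub_add hP hv hexN.choose_spec hex.choose_spec hu
  have h2 := tanProj_spec hn.nondegenerate (F.covDerivSub K P p v hex.choose u)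
  have h3 := (tanProj_spec hn.nondegenerate (F.covDerivSub K P p v hexN.choose u)).2 w hw
  have h4 := hn.orthogonal _ h2.1
  -- Pairing with v ignores the tangential part, so the normal projection may be replaced by the
  -- full derivative. Pairing with the tangent vector w likewise ignores the part of ∇N normal to P.
  rw [norProj, hsymm _ v, map_sub, h4, sub_zero]
  rw [map_sub, sub_apply] at h3
  linarith

end SecondFundamentalForms

end PseudoFinsler

end

/-! ### Smooth fields along the geodesic used as test fields. -/

noncomputable section

namespace PseudoFinsler

section FieldsAlongCurves

variable {E M : Type*} [NormedAddCommGroup E] [NormedSpace ℝ E]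
  [TopologicalSpace M] [ChartedSpace E M] [IsManifold 𝓘(ℝ, E) ∞ M]
  {S : Set ℝ} {γ : ℝ → M} {W : (t : ℝ) → TangentSpace 𝓘(ℝ, E) (γ t)}

theorem IsSmoothFieldAlong.smul (hγ : ContMDiffOn 𝓘(ℝ, ℝ) 𝓘(ℝ, E) ∞ γ S) {φ : ℝ → ℝ}
    (hφ : ContDiff ℝ ∞ φ) (hW : IsSmoothFieldAlong S γ W) :
    IsSmoothFieldAlong S γ fun t => φ t • W t := by
  intro t ht
  have h0 : γ t ∈ (extChartAt 𝓘(ℝ, E) (γ t)).source := mem_extChartAt_source (γ t)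
  rw [isSmoothFieldAlong_iff hγ ht h0]
  have h1 : chartField (γ t) γ (fun t => φ t • W t) = fun τ => φ τ • chartField (γ t) γ W τ :=
    funext fun τ => fibreCoord_smul (γ t) (γ τ) (φ τ) (W τ)
  rw [h1]
  exact hφ.contDiffAt.contDiffWithinAt.smul (hW.contDiffWithinAt hγ ht h0)

/-- Smooth vector fields along a curve with a prescribed value. -/
theorem exists_isSmoothFieldAlong (hγ : ContMDiffOn 𝓘(ℝ, ℝ) 𝓘(ℝ, E) ∞ γ S) {t₀ : ℝ} (ht₀ : t₀ ∈ S)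
    (e : E) : ∃ W : (t : ℝ) → TangentSpace 𝓘(ℝ, E) (γ t), IsSmoothFieldAlong S γ W ∧ W t₀ = e := by
  have hs : ∀ᶠ t in 𝓝 t₀, t ∈ S → γ t ∈ (extChartAt 𝓘(ℝ, E) (γ t₀)).source :=
    eventually_nhdsWithin_iff.1 (eventually_mem_source hγ ht₀ (mem_extChartAt_source (γ t₀)))
  -- A field constant in the chart at γ t₀ is cut off by a bump function supported at times whose
  -- points, for parameters in `S`, lie in that chart. Outside the support the product is locally
  -- zero.
  obtain ⟨φ, hφs, -, hφ, -, hφ1⟩ := exists_contDiff_tsupport_subset (n := ⊤) hs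
  refine ⟨fun t => φ t • ofFibreCoord (γ t₀) (γ t) e, fun t ht => ?_, ?_⟩
  · by_cases hp : γ t ∈ (extChartAt 𝓘(ℝ, E) (γ t₀)).source
    · rw [isSmoothFieldAlong_iff hγ ht hp]
      have h1 : chartField (γ t₀) γ (fun t => φ t • ofFibreCoord (γ t₀) (γ t) e) =ᶠ[𝓝[S] t]
          fun τ => φ τ • e := by
        filter_upwards [eventually_mem_source hγ ht hp] with τ hτ
        rw [chartField, fibreCoord_smul, fibreCoord_ofFibreCoord hτ]
      exact (hφ.contDiffAt.contDiffWithinAt.smul contDiffWithinAt_const).congr_of_eventuallyEq h1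
        (h1.self_of_nhdsWithin ht)
    · rw [isSmoothFieldAlong_iff hγ ht (mem_extChartAt_source (γ t))]
      have h2 : t ∉ tsupport φ := fun h => hp (hφs h ht)
      have h1 : chartField (γ t) γ (fun t => φ t • ofFibreCoord (γ t₀) (γ t) e) =ᶠ[𝓝[S] t]
          fun _ => 0 := by
        filter_upwards [nhdsWithin_le_nhds (notMem_tsupport_iff_eventuallyEq.1 h2)] with τ hτ
        rw [chartField, fibreCoord_smul, hτ]
        exact zero_smul ℝ _
      exact contDiffWithinAt_const.congr_of_eventuallyEq h1 (h1.self_of_nhdsWithin ht)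
  · simp only [hφ1, one_smul]
    exact ofFibreCoord_self (γ t₀) e

end FieldsAlongCurves

/-! ### Integration by parts and the kernel of the index form. -/

section IndexForm

variable {E M : Type*} [NormedAddCommGroup E] [NormedSpace ℝ E] [FiniteDimensional ℝ E]
  [TopologicalSpace M] [ChartedSpace E M] [IsManifold 𝓘(ℝ, E) ∞ M]
  {F : Metric E M} {a b : ℝ} {γ : ℝ → M} {V W : (t : ℝ) → TangentSpace 𝓘(ℝ, E) (γ t)}

namespace Metric.IsGeodesic

variable (hγ : F.IsGeodesic a b γ) (hab : a < b)

include hγ hab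

theorem continuousOn_g (hV : IsSmoothFieldAlong (Icc a b) γ V)
    (hW : IsSmoothFieldAlong (Icc a b) γ W) :
    ContinuousOn (fun t => F.g (γ t) (velocity (Icc a b) γ t) (V t) (W t)) (Icc a b) := fun _ ht =>
  ((hγ.isAdmissibleOn hab).hasDerivWithinAt_g ht hγ.parallel hV hW).continuousWithinAt

/-- The fundamental lemma of the calculus of variations for vector fields along a geodesic. -/
theorem eq_zero_of_integral_g_eq_zero (hV : IsSmoothFieldAlong (Icc a b) γ V)
    (h : ∀ W : (t : ℝ) → TangentSpace 𝓘(ℝ, E) (γ t), IsSmoothFieldAlong (Icc a b) γ W →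
      W a = 0 → W b = 0 → ∫ t in a..b, F.g (γ t) (velocity (Icc a b) γ t) (V t) (W t) = 0)
    {t : ℝ} (ht : t ∈ Icc a b) : V t = 0 := by
  -- Since g may be indefinite, testing V against itself proves nothing. Instead each value e is
  -- extended to a field W, and g(V, W) is shown to vanish on the whole interval.
  refine F.nondegenerate _ (hγ.admissible t ht) _ fun e => ?_
  obtain ⟨W, hW, rfl⟩ := exists_isSmoothFieldAlong hγ.smooth ht e
  have hc := hγ.continuousOn_g hab hV hW
  have hz : EqOn (fun t => F.g (γ t) (velocity (Icc a b) γ t) (V t) (W t)) 0 (Ioo a b) := by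
    intro c hcI
    by_contra hne
    set f : ℝ → ℝ := fun t => F.g (γ t) (velocity (Icc a b) γ t) (V t) (W t) with hf
    have hcc : ContinuousAt f c := hc.continuousAt (Icc_mem_nhds hcI.1 hcI.2)
    have hpos : 0 < f c * f c := mul_self_pos.2 hne
    -- Multiplying by `f c` treats both signs at once: near c the product is positive, and a bump
    -- function there contradicts the vanishing of the integral.
    have hU : ∀ᶠ s in 𝓝 c, s ∈ Ioo a b ∧ 0 < f s * f c :=
      Filter.Eventually.and (isOpen_Ioo.mem_nhds hcI) ((hcc.mul_const (f c)).eventually_const_lt hpos)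
    obtain ⟨φ, hφs, -, hφ, hφr, hφ1⟩ := exists_contDiff_tsupport_subset (n := ⊤) hU
    have hφ0 : ∀ s, s ∉ Ioo a b → φ s = 0 := fun s hs =>
      image_eq_zero_of_notMem_tsupport fun h => hs (hφs h).1
    have hge : ∀ s, 0 ≤ φ s := fun s => (hφr ⟨s, rfl⟩).1
    have h1 := h (fun s => φ s • W s) (hW.smul hγ.smooth hφ)
      (by simp only [hφ0 a (by simp), zero_smul]) (by simp only [hφ0 b (by simp), zero_smul])
    have e : ∀ s, F.g (γ s) (velocity (Icc a b) γ s) (V s) (φ s • W s) = φ s * f s := fun s =>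
      map_smul (F.g (γ s) (velocity (Icc a b) γ s) (V s)) (φ s) (W s)
    simp only [e] at h1
    have h2 : 0 < ∫ s in a..b, φ s * f s * f c := by
      refine intervalIntegral.integral_pos hab
        ((hφ.continuous.continuousOn.mul hc).mul continuousOn_const) (fun s _ => ?_)
        ⟨c, Ioo_subset_Icc_self hcI, by rw [hφ1, one_mul]; exact hpos⟩
      by_cases hs : s ∈ tsupport φ
      · rw [mul_assoc]
        exact mul_nonneg (hge s) (hφs hs).2.le
      · rw [image_eq_zero_of_notMem_tsupport hs, zero_mul, zero_mul]
    rw [intervalIntegral.integral_mul_const, h1, zero_mul] at h2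
    exact lt_irrefl _ h2
  -- Continuity carries the vanishing from the open interval to its endpoints.
  exact hz.of_subset_closure hc continuousOn_const Ioo_subset_Icc_self
    (by rw [closure_Ioo hab.ne]) ht

variable {KP KQ : Type*} [NormedAddCommGroup KP] [NormedSpace ℝ KP] [FiniteDimensional ℝ KP]
  [NormedAddCommGroup KQ] [NormedSpace ℝ KQ] [FiniteDimensional ℝ KQ]
  {P Q : Set M} [ChartedSpace KP P] [ChartedSpace KQ Q]
  (hP : IsSubmanifold E KP P) (hQ : IsSubmanifold E KQ Q) (ha : γ a ∈ P) (hb : γ b ∈ Q)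
  (hnP : F.IsNondegenerateNormal KP P ⟨γ a, ha⟩ (velocity (Icc a b) γ a))
  (hnQ : F.IsNondegenerateNormal KQ Q ⟨γ b, hb⟩ (velocity (Icc a b) γ b))

include hP hQ hnP hnQ

/-- The index form after integration by parts. -/
theorem indexForm_eq (hV : V ∈ tangentFields KP KQ P Q a b γ ha hb)
    (hW : W ∈ tangentFields KP KQ P Q a b γ ha hb) :
    F.indexForm KP KQ P Q a b γ ha hb V W =
      -(∫ t in a..b, F.g (γ t) (velocity (Icc a b) γ t) (F.jacobiDefect (Icc a b) γ V t) (W t))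
      + (F.g (γ b) (velocity (Icc a b) γ b) (F.prime (Icc a b) γ V b) (W b)
          - F.g (γ b) (velocity (Icc a b) γ b)
            (F.normalSecondFundamentalForm KQ Q ⟨γ b, hb⟩ (velocity (Icc a b) γ b) (V b)) (W b))
      - (F.g (γ a) (velocity (Icc a b) γ a) (F.prime (Icc a b) γ V a) (W a)
          - F.g (γ a) (velocity (Icc a b) γ a)
            (F.normalSecondFundamentalForm KP P ⟨γ a, ha⟩ (velocity (Icc a b) γ a) (V a)) (W a)) := by
  obtain ⟨hVs, hVa, hVb⟩ := hV
  obtain ⟨hWs, hWa, hWb⟩ := hW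
  have hA := hγ.isAdmissibleOn hab
  have hV1 := hA.isSmoothFieldAlong_prime hVs
  have hV2 := hA.isSmoothFieldAlong_prime hV1
  have hW1 := hA.isSmoothFieldAlong_prime hWs
  have hJ := hA.isSmoothFieldAlong_jacobiDefect hγ.parallel hVs
  have hint : ∀ {X Y : (t : ℝ) → TangentSpace 𝓘(ℝ, E) (γ t)}, IsSmoothFieldAlong (Icc a b) γ X →
      IsSmoothFieldAlong (Icc a b) γ Y → IntervalIntegrable
        (fun t => F.g (γ t) (velocity (Icc a b) γ t) (X t) (Y t)) MeasureTheory.volume a b :=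
    fun hX hY => (hγ.continuousOn_g hab hX hY).intervalIntegrable_of_Icc hab.le
  -- The primitive is g(V', W), with derivative g(V'', W) + g(V', W').
  have hftc := intervalIntegral.integral_eq_sub_of_hasDeriv_right_of_le hab.le
    (hγ.continuousOn_g hab hV1 hWs) (fun t ht =>
      ((hA.hasDerivWithinAt_g (Ioo_subset_Icc_self ht) hγ.parallel hV1 hWs).hasDerivAt
        (Icc_mem_nhds ht.1 ht.2)).hasDerivWithinAt) ((hint hV2 hWs).add (hint hV1 hW1))
  have hcongr : (∫ t in a..b,
      (-(F.g (γ t) (velocity (Icc a b) γ t)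
            (F.jacobiOperator (Icc a b) γ V W t) (velocity (Icc a b) γ t))
        + F.g (γ t) (velocity (Icc a b) γ t)
            (F.prime (Icc a b) γ V t) (F.prime (Icc a b) γ W t))) =
      ∫ t in a..b, ((F.g (γ t) (velocity (Icc a b) γ t)
            (F.prime (Icc a b) γ (F.prime (Icc a b) γ V) t) (W t)
          + F.g (γ t) (velocity (Icc a b) γ t)
            (F.prime (Icc a b) γ V t) (F.prime (Icc a b) γ W t))
          - F.g (γ t) (velocity (Icc a b) γ t) (F.jacobiDefect (Icc a b) γ V t) (W t)) := by
    -- The skew-symmetry of the curvature rests on two-sided mixed partials and is available only at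
    -- interior times, which suffices under the integral.
    refine intervalIntegral.integral_congr_Ioo_of_le hab.le fun t ht => ?_
    have := hA.g_jacobiOperator hγ.parallel hVs (Icc_mem_nhds ht.1 ht.2) hWs
    simp only [this]
    ring
  have hSP := g_secondFundamentalForm hP (hγ.admissible a (left_mem_Icc.2 hab.le)) hnP hVa hWa
  have hSQ := g_secondFundamentalForm hQ (hγ.admissible b (right_mem_Icc.2 hab.le)) hnQ hVb hWb
  rw [Metric.indexForm, hcongr,
    intervalIntegral.integral_sub ((hint hV2 hWs).add (hint hV1 hW1)) (hint hJ hWs), hftc, hSP, hSQ]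
  ring

/-- Test fields vanishing at both ends isolate the integral, hence the defect. Once it is zero, test
fields vanishing at one end isolate the boundary term at the other, and their values there range
over the whole tangent space of the submanifold. -/
theorem mem_indexKernel_iff (hV : V ∈ tangentFields KP KQ P Q a b γ ha hb) :
    (∀ W ∈ tangentFields KP KQ P Q a b γ ha hb, F.indexForm KP KQ P Q a b γ ha hb V W = 0) ↔
      (∀ t ∈ Icc a b, F.jacobiDefect (Icc a b) γ V t = 0) ∧
      tanProj (F.g (γ a) (velocity (Icc a b) γ a)) (tangentSubspace KP P ⟨γ a, ha⟩)
          (F.prime (Icc a b) γ V a) =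
        F.normalSecondFundamentalForm KP P ⟨γ a, ha⟩ (velocity (Icc a b) γ a) (V a) ∧
      tanProj (F.g (γ b) (velocity (Icc a b) γ b)) (tangentSubspace KQ Q ⟨γ b, hb⟩)
          (F.prime (Icc a b) γ V b) =
        F.normalSecondFundamentalForm KQ Q ⟨γ b, hb⟩ (velocity (Icc a b) γ b) (V b) := by
  have haI := left_mem_Icc.2 hab.le
  have hbI := right_mem_Icc.2 hab.le
  have hJ := (hγ.isAdmissibleOn hab).isSmoothFieldAlong_jacobiDefect hγ.parallel hV.1
  have hJ0 : (∀ t ∈ Icc a b, F.jacobiDefect (Icc a b) γ V t = 0) →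
      ∀ W : (t : ℝ) → TangentSpace 𝓘(ℝ, E) (γ t), ∫ t in a..b,
        F.g (γ t) (velocity (Icc a b) γ t) (F.jacobiDefect (Icc a b) γ V t) (W t) = 0 := by
    intro h W
    rw [intervalIntegral.integral_congr (g := fun _ => (0 : ℝ)), intervalIntegral.integral_zero]
    intro t ht
    rw [uIcc_of_le hab.le] at ht
    have e : ∀ B : E →L[ℝ] E →L[ℝ] ℝ, ∀ w : E, B (F.jacobiDefect (Icc a b) γ V t) w = 0 := by
      rw [h t ht]
      exact fun B w => B.map_zero₂ w
    exact e _ _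
  have hta := tanProj_eq_normalSecondFundamentalForm_iff hnP (F.prime (Icc a b) γ V a) (V a)
  have htb := tanProj_eq_normalSecondFundamentalForm_iff hnQ (F.prime (Icc a b) γ V b) (V b)
  constructor
  · intro h
    have h1 : ∀ t ∈ Icc a b, F.jacobiDefect (Icc a b) γ V t = 0 := by
      intro t ht
      refine hγ.eq_zero_of_integral_g_eq_zero hab hJ (fun W hW hWa hWb => ?_) ht
      have hWm : W ∈ tangentFields KP KQ P Q a b γ ha hb :=
        ⟨hW, by rw [hWa]; exact Submodule.zero_mem _, by rw [hWb]; exact Submodule.zero_mem _⟩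
      have h2 := h W hWm
      have e1 : ∀ α : E →L[ℝ] ℝ, α (W a) = 0 := fun α => by rw [hWa]; exact map_zero α
      have e2 : ∀ α : E →L[ℝ] ℝ, α (W b) = 0 := fun α => by rw [hWb]; exact map_zero α
      rw [hγ.indexForm_eq hab hP hQ ha hb hnP hnQ hV hWm, e1, e1, e2, e2] at h2
      linarith
    have key : ∀ {W : (t : ℝ) → TangentSpace 𝓘(ℝ, E) (γ t)},
        W ∈ tangentFields KP KQ P Q a b γ ha hb → _ := fun hW =>
      (hγ.indexForm_eq hab hP hQ ha hb hnP hnQ hV hW).symm.trans (h _ hW)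
    simp only [hJ0 h1] at key
    refine ⟨h1, hta.2 fun w hw => ?_, htb.2 fun w hw => ?_⟩
    · obtain ⟨W, hW, rfl⟩ := exists_isSmoothFieldAlong hγ.smooth haI w
      -- The cutoff equals 1 at `a` and has support to the left of `b`. It keeps the prescribed
      -- value at `a` and makes the field vanish at `b`, hence tangent to `Q`.
      obtain ⟨φ, hφs, -, hφ, -, hφ1⟩ := exists_contDiff_tsupport_subset (n := ⊤) (Iio_mem_nhds hab)
      have hφ0 : φ b = 0 := image_eq_zero_of_notMem_tsupport fun hh => lt_irrefl b (hφs hh)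
      have ea : φ a • W a = W a := by rw [hφ1, one_smul]
      have eb : φ b • W b = 0 := by rw [hφ0, zero_smul]
      have e0 : ∀ T : Submodule ℝ E, φ b • W b ∈ T := fun T => by rw [eb]; exact T.zero_mem
      have h2 := key (W := fun t => φ t • W t) ⟨hW.smul hγ.smooth hφ,
        Submodule.smul_mem _ (φ a) hw, e0 _⟩
      have e2 : ∀ α : E →L[ℝ] ℝ, α (φ b • W b) = 0 := fun α => by rw [eb]; exact map_zero α
      have e1 : ∀ α : E →L[ℝ] ℝ, α (φ a • W a) = α (W a) := fun α => by rw [ea]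
      rw [e1, e1, e2, e2] at h2
      linarith
    · obtain ⟨W, hW, rfl⟩ := exists_isSmoothFieldAlong hγ.smooth hbI w
      obtain ⟨φ, hφs, -, hφ, -, hφ1⟩ := exists_contDiff_tsupport_subset (n := ⊤) (Ioi_mem_nhds hab)
      have hφ0 : φ a = 0 := image_eq_zero_of_notMem_tsupport fun hh => lt_irrefl a (hφs hh)
      have eb : φ b • W b = W b := by rw [hφ1, one_smul]
      have ea : φ a • W a = 0 := by rw [hφ0, zero_smul]
      have e0 : ∀ T : Submodule ℝ E, φ a • W a ∈ T := fun T => by rw [ea]; exact T.zero_mem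
      have h2 := key (W := fun t => φ t • W t) ⟨hW.smul hγ.smooth hφ, e0 _,
        Submodule.smul_mem _ (φ b) hw⟩
      have e2 : ∀ α : E →L[ℝ] ℝ, α (φ b • W b) = α (W b) := fun α => by rw [eb]
      have e1 : ∀ α : E →L[ℝ] ℝ, α (φ a • W a) = 0 := fun α => by rw [ea]; exact map_zero α
      rw [e1, e1, e2, e2] at h2
      linarith
  · rintro ⟨h1, h2, h3⟩ W hW
    rw [hγ.indexForm_eq hab hP hQ ha hb hnP hnQ hV hW, hJ0 h1]
    have e1 := hta.1 h2 _ hW.2.1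
    have e2 := htb.1 h3 _ hW.2.2
    linarith

end Metric.IsGeodesic

end IndexForm

end PseudoFinsler

end

/-! ### The kernel of the index form. -/

theorem proposition3p11
    {E M KP KQ : Type*}
    [NormedAddCommGroup E] [NormedSpace ℝ E] [FiniteDimensional ℝ E]
    [TopologicalSpace M] [T2Space M] [ChartedSpace E M] [IsManifold 𝓘(ℝ, E) ∞ M]
    [NormedAddCommGroup KP] [NormedSpace ℝ KP] [FiniteDimensional ℝ KP]
    [NormedAddCommGroup KQ] [NormedSpace ℝ KQ] [FiniteDimensional ℝ KQ]
    (F : PseudoFinsler.Metric E M)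
    (P Q : Set M) [ChartedSpace KP P] [ChartedSpace KQ Q]
    (hP : PseudoFinsler.IsSubmanifold E KP P) (hQ : PseudoFinsler.IsSubmanifold E KQ Q)
    (a b : ℝ) (hab : a < b) (γ : ℝ → M) (hγ : F.IsGeodesic a b γ)
    (ha : γ a ∈ P) (hb : γ b ∈ Q)
    (hnP : F.IsNondegenerateNormal KP P ⟨γ a, ha⟩ (PseudoFinsler.velocity (Icc a b) γ a))
    (hnQ : F.IsNondegenerateNormal KQ Q ⟨γ b, hb⟩ (PseudoFinsler.velocity (Icc a b) γ b)) :
    F.indexKernel KP KQ P Q a b γ ha hb =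
      {V | V ∈ PseudoFinsler.tangentFields KP KQ P Q a b γ ha hb ∧
        (∀ t ∈ Icc a b,
          F.prime (Icc a b) γ (F.prime (Icc a b) γ V) t =
            F.jacobiOperator (Icc a b) γ V (PseudoFinsler.velocity (Icc a b) γ) t) ∧
        PseudoFinsler.tanProj (F.g (γ a) (PseudoFinsler.velocity (Icc a b) γ a))
            (PseudoFinsler.tangentSubspace KP P ⟨γ a, ha⟩) (F.prime (Icc a b) γ V a) =
          F.normalSecondFundamentalForm KP P ⟨γ a, ha⟩
            (PseudoFinsler.velocity (Icc a b) γ a) (V a) ∧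
        PseudoFinsler.tanProj (F.g (γ b) (PseudoFinsler.velocity (Icc a b) γ b))
            (PseudoFinsler.tangentSubspace KQ Q ⟨γ b, hb⟩) (F.prime (Icc a b) γ V b) =
          F.normalSecondFundamentalForm KQ Q ⟨γ b, hb⟩
            (PseudoFinsler.velocity (Icc a b) γ b) (V b)} := by
  have hJ : ∀ (V : (t : ℝ) → TangentSpace 𝓘(ℝ, E) (γ t)) (t : ℝ),
      F.jacobiDefect (Icc a b) γ V t = 0 ↔
        F.prime (Icc a b) γ (F.prime (Icc a b) γ V) t =
          F.jacobiOperator (Icc a b) γ V (PseudoFinsler.velocity (Icc a b) γ) t :=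
    fun V t => sub_eq_zero
  ext V
  simp only [PseudoFinsler.Metric.indexKernel, mem_ofPred_eq, ← hJ]
  exact and_congr_right fun hV => hγ.mem_indexKernel_iff hab hP hQ ha hb hnP hnQ hV
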